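/- Let $R$ be a complete discrete valuation ring with fraction field $K$ of characteristic $0$ and algebraically closed residue field $k$ of characteristic $p>0$, let $\pi$ be a uniformizer, $v_K$ the valuation with $v_K(\pi)=1$, and let $\zeta\in R$ be a primitive $p$-th root of unity. Let $A=R[[T]]\{T^{-1}\}$ be the ring of Laurent series $\sum_{\nu\in\mathbb Z}a_\nu T^\nu$ over $R$ with $a_\nu\to 0$ as $\nu\to-\infty$; its reduction modulo $\pi$ is $k((t))$, and $f\mapsto\bar f$ denotes reduction. A parameter of an $R$-algebra $S$ is an element $Z$ such that $S=R[[Z]]\{Z^{-1}\}$, i.e. some isomorphism of $R$-algebras $R[[T]]\{T^{-1}\}\to S$ sends $T$ to $Z$. For $a\in\mathbb F_p$, $\zeta^a$ has the obvious meaning. For $x\equiv1\bmod\pi$ and an integer $m$ prime to $p$, $x^{1/m}$ is the unique $m$-th root of $x$ congruent to $1$ modulo $\pi$. Let $B$ be a finite $A$-algebra of degree $p$, flat over $R$, and $G$ a group of order $p$ of $A$-algebra automorphisms of $B$ with $B^G=A$ (in particular $A\subset B$), such that $\bar B=B\otimes_R k$ is a field, purely inseparable of degree $p$ over $\bar A=k((t))$.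 Then $B$ is a complete discrete valuation ring with uniformizer $\pi$, its residue field is of the form $k((z))$, and for every $z$ with $\bar B=k((z))$ and every lift $Z\in B$ of $z$ one has $B=R[[Z]]\{Z^{-1}\}$. Let $\delta$ be the valuation of the different of $B/A$. (A) Suppose $\delta=v_K(p)$. If $u\in A^\times$ and $B=A[y]/(y^p-u)$, there is a unique isomorphism $\varphi:G\to\mathbb Z/p\mathbb Z$ with $\sigma y=\zeta^{\varphi(\sigma)}y$ for all $\sigma\in G$. Conversely fix any isomorphism $\varphi:G\to\mathbb Z/p\mathbb Z$. Then $\operatorname{Spec}B\to\operatorname{Spec}A$ is an fppf-torsor under $\mu_p$ on which $\sigma\in G$ acts as the point $\zeta^{\varphi(\sigma)}$ of $\mu_p$. There are $u\in A^\times$ and $y\in B$ with $B=A[y]/(y^p-u)$ and $\sigma y=\zeta^{\varphi(\sigma)}y$ for all $\sigma$ (call $(u,y)$ an equation for $\varphi$); the unit $u$ is unique exactly up to multiplication by $p$-th powers of units of $A$. The form $\omega=d\bar u/\bar u$ is non-zero and depends only on $\varphi$, and its residue $h$ lies in $\mathbb F_p$. (a) If $h\ne0$, then for every equation $(u,y)$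 for $\varphi$ one has $\operatorname{ord}_t\bar u\equiv h\bmod p$ and $y=Z^{\operatorname{ord}_t\bar u}$ for a parameter $Z$ of $B$ with $\sigma Z=\zeta^{\varphi(\sigma)/h}Z$ for all $\sigma\in G$. Moreover, for every integer $N$ with $N\equiv h\bmod p$ there are an equation $(u,y)$ for $\varphi$ and a parameter $Z$ of $B$ with $y=Z^N$ and $\sigma Z=\zeta^{\varphi(\sigma)/h}Z$ for all $\sigma\in G$. (b) If $h=0$, then $m:=1+\operatorname{ord}_t\omega$ is positive and prime to $p$, and for a suitable equation $(u,y)$ for $\varphi$ there is a parameter $Z$ of $B$ with $y=1+Z^m$ and, for all $\sigma\in G$, $$\sigma Z=\zeta^{\varphi(\sigma)/m}\,Z\,\bigl(1+\zeta^{-\varphi(\sigma)}(\zeta^{\varphi(\sigma)}-1)Z^{-m}\bigr)^{1/m}.$$ (B) Suppose $0<\delta<v_K(p)$. Then $v_K(p)=\delta+n(p-1)$ for an integer $n>0$, and $P_n(X):=((\pi^nX+1)^p-1)/\pi^{pn}$ has coefficients in $R$. Let $\mathcal H_n=\operatorname{Spec}R[x]/(P_n(x))$ be the group scheme with comultiplication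 $x\mapsto x\otimes1+1\otimes x+\pi^n x\otimes x$. If $u\in A$ and $B=A[w]/(P_n(w)-u)$, there is a unique isomorphism $\varphi:G\to\mathbb Z/p\mathbb Z$ with $\sigma(\pi^nw+1)=\zeta^{\varphi(\sigma)}(\pi^nw+1)$ for all $\sigma\in G$. Conversely fix any isomorphism $\varphi:G\to\mathbb Z/p\mathbb Z$. Then $\operatorname{Spec}B\to\operatorname{Spec}A$ is an fppf-torsor under $\mathcal H_n$ on which $\sigma\in G$ acts as the point $x=(\zeta^{\varphi(\sigma)}-1)/\pi^n$. There are $u\in A$ and $w\in B$ with $B=A[w]/(P_n(w)-u)$ and $\sigma(\pi^nw+1)=\zeta^{\varphi(\sigma)}(\pi^nw+1)$ for all $\sigma$; for every such pair $\bar u\notin k((t^p))$, and $\bar u$ is unique exactly up to addition of $p$-th powers in $k((t))$. The form $\omega=d\bar u$ is non-zero and depends only on $\varphi$, and $m:=1+\operatorname{ord}_t\omega$ is prime to $p$. For a suitable such pair $(u,w)$ there is a parameter $Z$ of $B$ with $w=Z^m$ and, for all $\sigma\in G$, $$\sigma Z=\zeta^{\varphi(\sigma)/m}\,Z\,\bigl(1+\pi^{-n}(\zeta^{\varphi(\sigma)}-1)\zeta^{-\varphi(\sigma)}Z^{-m}\bigr)^{1/m}.$$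 -/

import Mathlib

open scoped TensorProduct Polynomial

noncomputable section

/-- The ring `R[[T]]{T⁻¹}` of Laurent series `∑ a_i T ^ i`, `i ∈ ℤ`, with coefficients in a local
ring `R` such that `a_i → 0` in the `𝔪`-adic topology when `i → -∞`. -/
@[ext]
structure BoundarySeries (R : Type*) [CommRing R] [IsLocalRing R] where
  coeff : ℤ → R
  tendsto_zero : ∀ N : ℕ, ∃ M : ℤ, ∀ i < M, coeff i ∈ IsLocalRing.maximalIdeal R ^ N

namespace BoundarySeries
open IsLocalRing

section basic

variable {R : Type*} [CommRing R] [IsLocalRing R]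

/-- Coefficientwise reduction along a ring homomorphism which kills a power of the maximal ideal. -/
def mapLaurent {S : Type*} [CommRing S] (φ : R →+* S) (N : ℕ)
    (h : ∀ x ∈ maximalIdeal R ^ N, φ x = 0) (f : BoundarySeries R) : LaurentSeries S :=
  HahnSeries.ofSuppBddBelow (fun i => φ (f.coeff i)) (by
    obtain ⟨M, hM⟩ := f.tendsto_zero N
    refine ⟨M, fun i hi => ?_⟩
    by_contra hlt
    exact hi (h _ (hM i (not_le.mp hlt))))

@[simp] theorem mapLaurent_coeff {S : Type*} [CommRing S] (φ : R →+* S) (N : ℕ)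
    (h : ∀ x ∈ maximalIdeal R ^ N, φ x = 0) (f : BoundarySeries R) (i : ℤ) :
    (mapLaurent φ N h f).coeff i = φ (f.coeff i) := rfl

/-- Reduction modulo `𝔪 ^ N`. -/
def modPow (N : ℕ) (f : BoundarySeries R) : LaurentSeries (R ⧸ maximalIdeal R ^ N) :=
  mapLaurent (Ideal.Quotient.mk _) N (fun _ hx => Ideal.Quotient.eq_zero_iff_mem.mpr hx) f

@[simp] theorem modPow_coeff (N : ℕ) (f : BoundarySeries R) (i : ℤ) :
    (modPow N f).coeff i = Ideal.Quotient.mk _ (f.coeff i) := rfl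

theorem mapLaurent_eq_map {S : Type*} [CommRing S] (φ : R →+* S) (N : ℕ)
    (h : ∀ x ∈ maximalIdeal R ^ N, φ x = 0) (f : BoundarySeries R) :
    mapLaurent φ N h f = (modPow N f).map (Ideal.Quotient.lift (maximalIdeal R ^ N) φ h) := by
  ext i
  simp

/-- The constant series `r`. -/
def const (r : R) : BoundarySeries R where
  coeff i := if i = 0 then r else 0
  tendsto_zero N := ⟨0, fun i hi => by simp [hi.ne]⟩

/-- The variable `T`. -/
def T : BoundarySeries R where
  coeff i := if i = 1 then 1 else 0
  tendsto_zero _ := ⟨0, fun i hi => by rw [if_neg (by omega)]; exact zero_mem _⟩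

instance : Zero (BoundarySeries R) := ⟨⟨fun _ => 0, fun _ => ⟨0, fun _ _ => zero_mem _⟩⟩⟩

instance : One (BoundarySeries R) := ⟨const 1⟩

instance : Add (BoundarySeries R) := ⟨fun f g => ⟨fun i => f.coeff i + g.coeff i, fun N => by
  obtain ⟨M, hM⟩ := f.tendsto_zero N
  obtain ⟨M', hM'⟩ := g.tendsto_zero N
  exact ⟨min M M', fun i hi => add_mem (hM i (lt_of_lt_of_le hi (min_le_left _ _)))
    (hM' i (lt_of_lt_of_le hi (min_le_right _ _)))⟩⟩⟩

instance : Neg (BoundarySeries R) := ⟨fun f => ⟨fun i => -f.coeff i, fun N => by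
  obtain ⟨M, hM⟩ := f.tendsto_zero N
  exact ⟨M, fun i hi => neg_mem (hM i hi)⟩⟩⟩

instance : Sub (BoundarySeries R) := ⟨fun f g => ⟨fun i => f.coeff i - g.coeff i, fun N => by
  obtain ⟨M, hM⟩ := f.tendsto_zero N
  obtain ⟨M', hM'⟩ := g.tendsto_zero N
  exact ⟨min M M', fun i hi => sub_mem (hM i (lt_of_lt_of_le hi (min_le_left _ _)))
    (hM' i (lt_of_lt_of_le hi (min_le_right _ _)))⟩⟩⟩

instance : NatCast (BoundarySeries R) := ⟨fun n => const (n : R)⟩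
instance : IntCast (BoundarySeries R) := ⟨fun n => const (n : R)⟩

instance : SMul ℕ (BoundarySeries R) := ⟨fun n f => ⟨fun i => n • f.coeff i, fun N => by
  obtain ⟨M, hM⟩ := f.tendsto_zero N
  exact ⟨M, fun i hi => nsmul_mem (hM i hi) n⟩⟩⟩

instance : SMul ℤ (BoundarySeries R) := ⟨fun n f => ⟨fun i => n • f.coeff i, fun N => by
  obtain ⟨M, hM⟩ := f.tendsto_zero N
  exact ⟨M, fun i hi => zsmul_mem (hM i hi) n⟩⟩⟩

@[simp] theorem coeff_add (f g : BoundarySeries R) (i : ℤ) :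
    (f + g).coeff i = f.coeff i + g.coeff i := rfl

theorem coeff_const (r : R) (i : ℤ) : (const r).coeff i = if i = 0 then r else 0 := rfl

theorem modPow_const (N : ℕ) (r : R) :
    modPow N (const r) = HahnSeries.C (Ideal.Quotient.mk _ r) := by
  ext i
  rw [modPow_coeff, HahnSeries.C_apply, HahnSeries.coeff_single, coeff_const]
  split_ifs <;> simp

section mul

variable [IsAdicComplete (maximalIdeal R) R]

/-- Existence of the Cauchy product: the convolution sums converge `𝔪`-adically. -/
theorem exists_mul (f g : BoundarySeries R) :
    ∃ h : BoundarySeries R, ∀ N, modPow N h = modPow N f * modPow N g := by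
  have key : ∀ i : ℤ, ∃ r : R, ∀ N : ℕ,
      Ideal.Quotient.mk (maximalIdeal R ^ N) r = (modPow N f * modPow N g).coeff i := by
    intro i
    choose a ha using fun N : ℕ =>
      Ideal.Quotient.mk_surjective (I := maximalIdeal R ^ N) ((modPow N f * modPow N g).coeff i)
    obtain ⟨L, hL⟩ := IsPrecomplete.prec (I := maximalIdeal R) (M := R) inferInstance (f := a) (by
      intro m n hmn
      rw [SModEq.sub_mem, smul_eq_mul, Ideal.mul_top, ← Ideal.Quotient.eq, ha m]
      have hc : ∀ q : BoundarySeries R, modPow m q =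
          (modPow n q).map (Ideal.Quotient.factor (Ideal.pow_le_pow_right hmn)) := by
        intro q; ext j; simp
      have := congrArg (fun s : LaurentSeries _ => s.coeff i)
        (HahnSeries.map_mul (Ideal.Quotient.factor (Ideal.pow_le_pow_right
          (I := maximalIdeal R) hmn)).toNonUnitalRingHom (x := modPow n f) (y := modPow n g))
      rw [hc f, hc g]
      refine this.symm.trans ?_
      simp only [HahnSeries.map_coeff]
      rw [← ha n]
      rfl)
    refine ⟨L, fun N => ?_⟩
    have := hL N
    rw [SModEq.sub_mem, smul_eq_mul, Ideal.mul_top, ← Ideal.Quotient.eq, ha N] at this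
    exact this.symm
  choose r hr using key
  refine ⟨⟨r, fun N => ?_⟩, fun N => ?_⟩
  · refine ⟨(modPow N f * modPow N g).order, fun i hi => ?_⟩
    rw [← Ideal.Quotient.eq_zero_iff_mem, hr i N]
    exact HahnSeries.coeff_eq_zero_of_lt_order hi
  · ext i
    exact hr i N

/-- The product: `(f g)_n = ∑_{i + j = n} f_i g_j`, see `coeff_mul_sub_sum_mem`. -/
instance : Mul (BoundarySeries R) := ⟨fun f g => (exists_mul f g).choose⟩

theorem modPow_mul (f g : BoundarySeries R) (N : ℕ) :
    modPow N (f * g) = modPow N f * modPow N g := (exists_mul f g).choose_spec N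

/-- The coefficients of the product are the `𝔪`-adic sums of the Cauchy product. -/
theorem coeff_mul_sub_sum_mem (f g : BoundarySeries R) (n : ℤ) (N : ℕ) :
    ∃ s₀ : Finset ℤ, ∀ s : Finset ℤ, s₀ ⊆ s →
      (f * g).coeff n - ∑ i ∈ s, f.coeff i * g.coeff (n - i) ∈ maximalIdeal R ^ N := by
  classical
  refine ⟨(Finset.antidiagonal (modPow N f).isPWO_support (modPow N g).isPWO_support n).image
    Prod.fst, fun s hs => ?_⟩
  rw [← Ideal.Quotient.eq, ← modPow_coeff, modPow_mul, HahnSeries.coeff_mul, map_sum]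
  symm
  rw [← Finset.sum_subset hs, Finset.sum_image]
  · refine Finset.sum_congr rfl fun x hx => ?_
    obtain ⟨-, -, h3⟩ := Finset.mem_antidiagonal.mp hx
    rw [← h3]; simp
  · intro x hx y hy hxy
    obtain ⟨-, -, h3⟩ := Finset.mem_antidiagonal.mp hx
    obtain ⟨-, -, h4⟩ := Finset.mem_antidiagonal.mp hy
    refine Prod.ext hxy ?_
    have hxy' : x.1 = y.1 := hxy
    omega
  · intro i _ hi
    rw [map_mul, ← modPow_coeff, ← modPow_coeff]
    by_contra hne
    apply hi
    rw [Finset.mem_image]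
    exact ⟨(i, n - i), Finset.mem_antidiagonal.mpr ⟨left_ne_zero_of_mul hne,
      right_ne_zero_of_mul hne, by simp⟩, rfl⟩

instance : Pow (BoundarySeries R) ℕ := ⟨fun f n => npowRec n f⟩

theorem modPow_injective :
    Function.Injective fun (f : BoundarySeries R) (N : ℕ) => modPow N f := by
  intro f g hfg
  ext i
  rw [← sub_eq_zero]
  refine IsHausdorff.haus (I := maximalIdeal R) inferInstance _ fun N => ?_
  rw [SModEq.zero, smul_eq_mul, Ideal.mul_top, ← Ideal.Quotient.eq]
  exact congrArg (fun s : LaurentSeries _ => s.coeff i) (congrFun hfg N)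

instance : CommRing (BoundarySeries R) :=
  modPow_injective.commRing _
    (by funext N; ext i; exact map_zero _)
    (by funext N; exact (modPow_const N 1).trans (by simp))
    (fun f g => by funext N; ext i; exact map_add _ _ _)
    (fun f g => by funext N; exact modPow_mul f g N)
    (fun f => by funext N; ext i; exact map_neg _ _)
    (fun f g => by funext N; ext i; exact map_sub _ _ _)
    (fun n f => by funext N; ext i; exact map_nsmul _ _ _)
    (fun n f => by funext N; ext i; exact map_zsmul _ _ _)
    (fun f n => by
      funext N
      induction n with
      | zero => exact (modPow_const N 1).trans (by simp)
      | succ n ih =>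
        rw [pow_succ, Pi.mul_apply, ← ih]
        exact modPow_mul _ f N)
    (fun n => by funext N; exact (modPow_const N _).trans (by simp))
    (fun n => by funext N; exact (modPow_const N _).trans (by simp))

instance : Algebra R (BoundarySeries R) := RingHom.toAlgebra
  { toFun := const
    map_one' := rfl
    map_mul' := fun a b => modPow_injective (by
      funext N
      simp only [modPow_mul, modPow_const, map_mul])
    map_zero' := by ext i; exact ite_self _
    map_add' := fun a b => by
      ext i
      simp only [coeff_const, coeff_add]
      split_ifs <;> simp }

theorem algebraMap_apply (r : R) : algebraMap R (BoundarySeries R) r = const r := rfl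

/-- The residue homomorphism `R[[T]]{T⁻¹} → k((t))`. -/
def residue : BoundarySeries R →+* LaurentSeries (ResidueField R) where
  toFun := mapLaurent (IsLocalRing.residue R) 1
    (fun x hx => (IsLocalRing.residue_eq_zero_iff x).mpr (by simpa using hx))
  map_one' := by
    ext i
    change IsLocalRing.residue R (if i = 0 then 1 else 0) = _
    rw [HahnSeries.coeff_one]
    split_ifs <;> simp
  map_mul' f g := by
    rw [mapLaurent_eq_map, modPow_mul, mapLaurent_eq_map, mapLaurent_eq_map]
    exact HahnSeries.map_mul (Ideal.Quotient.lift (maximalIdeal R ^ 1) (IsLocalRing.residue R)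
      (fun x hx => (IsLocalRing.residue_eq_zero_iff x).mpr (by simpa using hx))).toNonUnitalRingHom
  map_zero' := by ext i; exact map_zero _
  map_add' f g := by ext i; exact map_add _ _ _

@[simp] theorem residue_coeff (f : BoundarySeries R) (i : ℤ) :
    (residue f).coeff i = IsLocalRing.residue R (f.coeff i) := rfl

theorem coeff_const_mul (r : R) (f : BoundarySeries R) (i : ℤ) :
    (const r * f).coeff i = r * f.coeff i := by
  rw [← sub_eq_zero]
  refine IsHausdorff.haus (I := maximalIdeal R) inferInstance _ fun N => ?_
  rw [SModEq.zero, smul_eq_mul, Ideal.mul_top, ← Ideal.Quotient.eq, ← modPow_coeff, modPow_mul,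
    modPow_const, HahnSeries.C_mul_eq_smul]
  simp

end mul

end basic

section domain

variable {R : Type*} [CommRing R] [IsDomain R] [IsDiscreteValuationRing R] [IsAdicComplete (maximalIdeal R) R]

/-- A nonzero series is `π ^ N` times a series with nonzero residue. -/
theorem exists_eq_const_mul {π : R} (hπ : Irreducible π) {f : BoundarySeries R} (hf : f ≠ 0) :
    ∃ (N : ℕ) (g : BoundarySeries R), f = const (π ^ N) * g ∧ residue g ≠ 0 := by
  classical
  have hex : ∃ N : ℕ, ∃ i, ¬ π ^ (N + 1) ∣ f.coeff i := by
    by_contra! hall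
    apply hf
    ext i
    refine IsHausdorff.haus (I := maximalIdeal R) inferInstance _ fun N => ?_
    rw [SModEq.zero, smul_eq_mul, Ideal.mul_top, hπ.maximalIdeal_eq, Ideal.span_singleton_pow,
      Ideal.mem_span_singleton]
    exact (pow_dvd_pow π N.le_succ).trans (hall N i)
  obtain ⟨i, hi⟩ := Nat.find_spec hex
  set N := Nat.find hex with hN
  have hdvd : ∀ j, π ^ N ∣ f.coeff j := by
    intro j
    rcases Nat.eq_zero_or_pos N with h0 | h0
    · simp [h0]
    · have := Nat.find_min hex (m := N - 1) (by omega)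
      push Not at this
      simpa [Nat.sub_add_cancel h0] using this j
  choose c hc using hdvd
  refine ⟨N, ⟨c, fun K => ?_⟩, ?_, ?_⟩
  · obtain ⟨M, hM⟩ := f.tendsto_zero (N + K)
    refine ⟨M, fun j hj => ?_⟩
    have := hM j hj
    rw [hπ.maximalIdeal_eq, Ideal.span_singleton_pow, Ideal.mem_span_singleton, pow_add, hc j]
      at this
    rw [hπ.maximalIdeal_eq, Ideal.span_singleton_pow, Ideal.mem_span_singleton]
    exact (mul_dvd_mul_iff_left (pow_ne_zero _ hπ.ne_zero)).mp this
  · ext j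
    rw [coeff_const_mul, hc j]
  · intro h0
    have := congrArg (fun s : LaurentSeries _ => s.coeff i) h0
    simp only [residue_coeff, HahnSeries.coeff_zero, IsLocalRing.residue_eq_zero_iff,
      hπ.maximalIdeal_eq, Ideal.mem_span_singleton] at this
    apply hi
    rw [hc i, pow_succ]
    exact mul_dvd_mul_left _ this

instance : IsDomain (BoundarySeries R) := by
  obtain ⟨π, hπ⟩ := IsDiscreteValuationRing.exists_irreducible R
  have : Nontrivial (BoundarySeries R) := ⟨⟨0, 1, fun h => by
    have := congrArg (fun s => residue s) h
    simp at this⟩⟩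
  have : NoZeroDivisors (BoundarySeries R) := ⟨by
    intro a b hab
    by_contra! hne
    obtain ⟨N, f, rfl, hf⟩ := exists_eq_const_mul hπ hne.1
    obtain ⟨M, g, rfl, hg⟩ := exists_eq_const_mul hπ hne.2
    have h1 : const (π ^ (N + M)) * (f * g) = 0 := by
      rw [← hab, ← algebraMap_apply, ← algebraMap_apply, ← algebraMap_apply, pow_add, map_mul]
      ring
    have h2 : f * g = 0 := by
      ext i
      have := congrArg (fun s => coeff s i) h1
      simp only [coeff_const_mul] at this
      exact (mul_eq_zero.mp this).resolve_left (pow_ne_zero _ hπ.ne_zero)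
    have := congrArg residue h2
    rw [map_mul, map_zero] at this
    exact (mul_ne_zero hf hg) this⟩
  exact NoZeroDivisors.to_isDomain _

end domain

end BoundarySeries

section GroupScheme

open Polynomial

variable {R : Type*} [CommRing R]

theorem exists_isogenyPoly {π : R} {n p : ℕ} (hp : p.Prime) (h : π ^ (n * (p - 1)) ∣ (p : R)) :
    ∃ f : R[X], f.Monic ∧ C (π ^ (p * n)) * f = (C (π ^ n) * X + 1) ^ p - 1 := by
  nontriviality R
  obtain ⟨c, hc⟩ := h
  have hp1 : 1 ≤ p := hp.one_le
  refine ⟨X ^ p + ∑ i ∈ Finset.Ico 1 p, C (((p.choose i / p : ℕ) : R) * c * π ^ (n * (i - 1))) *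
    X ^ i, ?_, ?_⟩
  · apply monic_X_pow_add
    refine (degree_sum_le _ _).trans_lt ?_
    rw [Finset.sup_lt_iff (by simp)]
    intro i hi
    refine (degree_C_mul_X_pow_le _ _).trans_lt ?_
    exact_mod_cast (Finset.mem_Ico.mp hi).2
  · rw [add_pow, Finset.sum_range_succ, Finset.range_eq_Ico, Finset.sum_eq_sum_Ico_succ_bot hp.pos,
      mul_add, Finset.mul_sum]
    have : ∀ i ∈ Finset.Ico 1 p, C (π ^ (p * n)) *
        (C (((p.choose i / p : ℕ) : R) * c * π ^ (n * (i - 1))) * X ^ i) =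
        (C (π ^ n) * X) ^ i * 1 ^ (p - i) * (p.choose i : R[X]) := by
      intro i hi
      obtain ⟨hi1, hi2⟩ := Finset.mem_Ico.mp hi
      obtain ⟨d, hd⟩ := hp.dvd_choose_self (by omega : i ≠ 0) hi2
      rw [hd, Nat.mul_div_cancel_left _ hp.pos, one_pow, mul_one, mul_pow, ← C_pow, ← mul_assoc,
        ← C_mul, mul_right_comm (C _), ← C_eq_natCast, ← C_mul]
      congr 2
      rw [Nat.cast_mul, hc]
      have e1 : p * n = n + n * (p - 1) := by
        obtain ⟨q, rfl⟩ : ∃ q, p = q + 1 := ⟨p - 1, by omega⟩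
        simp; ring
      have e2 : π ^ n * π ^ (n * (i - 1)) = (π ^ n) ^ i := by
        obtain ⟨q, rfl⟩ : ∃ q, i = q + 1 := ⟨i - 1, by omega⟩
        rw [← pow_add, ← pow_mul]; congr 1; simp; ring
      rw [e1, pow_add, ← e2]
      ring
    rw [Finset.sum_congr rfl this]
    simp [mul_pow, ← pow_mul, mul_comm n p]
    ring

/-- The polynomial `((π ^ n X + 1) ^ p - 1) / π ^ (p n)`. -/
def isogenyPoly {π : R} {n p : ℕ} (hp : p.Prime) (h : π ^ (n * (p - 1)) ∣ (p : R)) : R[X] :=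
  (exists_isogenyPoly hp h).choose

theorem isogenyPoly_monic {π : R} {n p : ℕ} (hp : p.Prime) (h : π ^ (n * (p - 1)) ∣ (p : R)) :
    (isogenyPoly hp h).Monic := (exists_isogenyPoly hp h).choose_spec.1

theorem isogenyPoly_spec {π : R} {n p : ℕ} (hp : p.Prime) (h : π ^ (n * (p - 1)) ∣ (p : R)) :
    C (π ^ (p * n)) * isogenyPoly hp h = (C (π ^ n) * X + 1) ^ p - 1 :=
  (exists_isogenyPoly hp h).choose_spec.2

theorem aeval_isogenyPoly_eq_zero_iff {π : R} {n p : ℕ} (hp : p.Prime)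
    (h : π ^ (n * (p - 1)) ∣ (p : R)) {S : Type*} [CommRing S] [Algebra R S] [IsDomain R]
    [Module.IsTorsionFree R S] (hπ : π ≠ 0) (z : S) :
    aeval z (isogenyPoly hp h) = 0 ↔ (algebraMap R S (π ^ n) * z + 1) ^ p = 1 := by
  have := congrArg (aeval z) (isogenyPoly_spec hp h)
  simp only [map_mul, map_sub, map_pow, map_add, aeval_X, aeval_C, map_one] at this
  rw [← sub_eq_zero (a := _ ^ p), map_pow, ← this, ← map_pow, ← Algebra.smul_def,
    smul_eq_zero_iff_right (pow_ne_zero _ hπ)]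

variable {π : R} {n p : ℕ}

/-- The coordinate ring `R[x] / (((π ^ n x + 1) ^ p - 1) / π ^ (p n))` of the group scheme `ℋ_n`,
the kernel of `ψ_n : 𝒢^(n) → 𝒢^(pn)`, `x ↦ ((π ^ n x + 1) ^ p - 1) / π ^ (p n)`. Here
`𝒢^(n) = Spec R[x, 1 / (π ^ n x + 1)]`; in the quotient `π ^ n x + 1` is already invertible, see
`HRing.pow_eq_one`. -/
abbrev HRing (_hπ : π ≠ 0) (hp : p.Prime) (h : π ^ (n * (p - 1)) ∣ (p : R)) : Type _ :=
  AdjoinRoot (isogenyPoly hp h)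

namespace HRing

variable (hπ : π ≠ 0) (hp : p.Prime) (h : π ^ (n * (p - 1)) ∣ (p : R))

/-- The coordinate `x` on `ℋ_n`. -/
def x : HRing hπ hp h := AdjoinRoot.root _

variable {hπ hp h} in
theorem hom_ext {S : Type*} [Semiring S] [Algebra R S] {f g : HRing hπ hp h →ₐ[R] S}
    (hfg : f (x hπ hp h) = g (x hπ hp h)) : f = g := AdjoinRoot.algHom_ext hfg

variable [IsDomain R]

instance : Module.Free R (HRing hπ hp h) := (isogenyPoly_monic hp h).free_adjoinRoot

theorem pow_eq_one : (algebraMap R _ (π ^ n) * x hπ hp h + 1) ^ p = 1 := by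
  rw [← aeval_isogenyPoly_eq_zero_iff hp h hπ]
  exact (AdjoinRoot.aeval_eq _).trans AdjoinRoot.mk_self

/-- Algebra maps out of the coordinate ring of `ℋ_n`. -/
def lift {S : Type*} [CommRing S] [Algebra R S] [Module.IsTorsionFree R S] (z : S)
    (hz : (algebraMap R S (π ^ n) * z + 1) ^ p = 1) : HRing hπ hp h →ₐ[R] S :=
  AdjoinRoot.liftAlgHom _ (Algebra.ofId R S) z ((aeval_isogenyPoly_eq_zero_iff hp h hπ z).mpr hz)

@[simp] theorem lift_x {S : Type*} [CommRing S] [Algebra R S] [Module.IsTorsionFree R S] (z : S)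
    (hz : (algebraMap R S (π ^ n) * z + 1) ^ p = 1) : lift hπ hp h z hz (x hπ hp h) = z := by
  unfold lift x
  exact AdjoinRoot.liftAlgHom_root ..

/-- `x ↦ x ⊗ 1 + 1 ⊗ x + π ^ n x ⊗ x`. -/
def comul : HRing hπ hp h →ₐ[R] HRing hπ hp h ⊗[R] HRing hπ hp h :=
  lift hπ hp h (x hπ hp h ⊗ₜ 1 + 1 ⊗ₜ x hπ hp h + π ^ n • (x hπ hp h ⊗ₜ x hπ hp h)) (by
    have e : algebraMap R (HRing hπ hp h ⊗[R] HRing hπ hp h) (π ^ n) *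
        (x hπ hp h ⊗ₜ 1 + 1 ⊗ₜ x hπ hp h + π ^ n • (x hπ hp h ⊗ₜ x hπ hp h)) + 1 =
        (algebraMap R _ (π ^ n) * x hπ hp h + 1) ⊗ₜ[R]
          (algebraMap R _ (π ^ n) * x hπ hp h + 1) := by
      simp only [← Algebra.smul_def, TensorProduct.add_tmul, TensorProduct.tmul_add, smul_add,
        TensorProduct.smul_tmul', TensorProduct.tmul_smul, Algebra.TensorProduct.one_def]
      abel
    rw [e, Algebra.TensorProduct.tmul_pow, pow_eq_one, Algebra.TensorProduct.one_def])

/-- `x ↦ 0`. -/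
def counit : HRing hπ hp h →ₐ[R] R := lift hπ hp h 0 (by simp)

/-- `x ↦ -x / (π ^ n x + 1)`, where `(π ^ n x + 1)⁻¹ = (π ^ n x + 1) ^ (p - 1)`. -/
def antipode : HRing hπ hp h →ₐ[R] HRing hπ hp h :=
  lift hπ hp h (-x hπ hp h * (algebraMap R _ (π ^ n) * x hπ hp h + 1) ^ (p - 1)) (by
    have h1 := pow_eq_one hπ hp h
    set s := algebraMap R (HRing hπ hp h) (π ^ n) * x hπ hp h with hs
    have e : algebraMap R (HRing hπ hp h) (π ^ n) * (-x hπ hp h * (s + 1) ^ (p - 1)) + 1 =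
        (s + 1) ^ (p - 1) := by
      have : (s + 1) * (s + 1) ^ (p - 1) = 1 := by
        rw [← pow_succ', Nat.sub_add_cancel hp.one_le, h1]
      linear_combination (-1 : HRing hπ hp h) * this + (s + 1) ^ (p - 1) * hs
    rw [e, ← pow_mul, mul_comm, pow_mul, h1, one_pow])

@[simp] theorem comul_x : comul hπ hp h (x hπ hp h) =
    x hπ hp h ⊗ₜ 1 + 1 ⊗ₜ x hπ hp h + π ^ n • (x hπ hp h ⊗ₜ x hπ hp h) := lift_x ..

@[simp] theorem counit_x : counit hπ hp h (x hπ hp h) = 0 := lift_x ..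

@[simp] theorem antipode_x : antipode hπ hp h (x hπ hp h) =
    -x hπ hp h * (algebraMap R _ (π ^ n) * x hπ hp h + 1) ^ (p - 1) := lift_x ..

instance : Bialgebra R (HRing hπ hp h) :=
  Bialgebra.ofAlgHom (comul hπ hp h) (counit hπ hp h)
    (hom_ext (by
      simp [TensorProduct.add_tmul, TensorProduct.tmul_add, TensorProduct.smul_tmul',
        Algebra.TensorProduct.one_def]
      simp only [← TensorProduct.smul_tmul', TensorProduct.tmul_smul]
      abel))
    (hom_ext (by simp))
    (hom_ext (by simp))

theorem antipode_aux : antipode hπ hp h (x hπ hp h) + x hπ hp h +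
    π ^ n • (antipode hπ hp h (x hπ hp h) * x hπ hp h) = 0 := by
  have h1 := pow_eq_one hπ hp h
  have h2 : (algebraMap R _ (π ^ n) * x hπ hp h + 1) *
      (algebraMap R _ (π ^ n) * x hπ hp h + 1) ^ (p - 1) = 1 := by
    rw [← pow_succ', Nat.sub_add_cancel hp.one_le, h1]
  rw [antipode_x, Algebra.smul_def]
  linear_combination (-x hπ hp h) * h2

instance : HopfAlgebra R (HRing hπ hp h) :=
  HopfAlgebra.ofAlgHom (antipode hπ hp h)
    (hom_ext (by
      change Algebra.TensorProduct.lift _ _ (fun _ _ ↦ Commute.all _ _) (comul hπ hp h _) =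
        Algebra.ofId _ _ (counit hπ hp h _)
      rw [comul_x, counit_x, map_zero, ← antipode_aux hπ hp h]
      simp only [map_add, map_smul, Algebra.TensorProduct.lift_tmul, map_one, AlgHom.id_apply,
        mul_one, one_mul]))
    (hom_ext (by
      change Algebra.TensorProduct.lift _ _ (fun _ _ ↦ Commute.all _ _) (comul hπ hp h _) =
        Algebra.ofId _ _ (counit hπ hp h _)
      rw [comul_x, counit_x, map_zero, ← antipode_aux hπ hp h]
      simp only [map_add, map_smul, Algebra.TensorProduct.lift_tmul, map_one, AlgHom.id_apply,
        mul_one, one_mul, mul_comm, add_comm]))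

end HRing
end GroupScheme

section SpecialFiber

open IsLocalRing

/-- The special fibre `S̄ = S ⊗_R k = S / 𝔪 S` of an `R`-algebra `S`. -/
def SpecialFiber (R S : Type*) [CommRing R] [IsLocalRing R] [CommRing S] [Algebra R S] : Type _ :=
  S ⧸ (maximalIdeal R).map (algebraMap R S)

instance (R S : Type*) [CommRing R] [IsLocalRing R] [CommRing S] [Algebra R S] :
    CommRing (SpecialFiber R S) :=
  inferInstanceAs (CommRing (S ⧸ (maximalIdeal R).map (algebraMap R S)))

/-- The reduction map `S → S̄`. -/
def SpecialFiber.mk (R : Type*) {S : Type*} [CommRing R] [IsLocalRing R] [CommRing S]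
    [Algebra R S] : S →+* SpecialFiber R S :=
  Ideal.Quotient.mk ((maximalIdeal R).map (algebraMap R S))

/-- For a tower `R → A → B`, the special fibre `B̄` is an `Ā`-algebra. -/
instance (R A B : Type*) [CommRing R] [IsLocalRing R] [CommRing A] [CommRing B] [Algebra R A]
    [Algebra R B] [Algebra A B] [IsScalarTower R A B] :
    Algebra (SpecialFiber R A) (SpecialFiber R B) :=
  RingHom.toAlgebra (Ideal.quotientMap ((maximalIdeal R).map (algebraMap R B)) (algebraMap A B) (by
    rw [← Ideal.map_le_iff_le_comap, Ideal.map_map, ← IsScalarTower.algebraMap_eq]))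

/-- `Z` is a parameter of the `R`-algebra `S`: one has `S = R[[Z]]{Z⁻¹}`. -/
def IsParameter (R : Type*) {S : Type*} [CommRing R] [IsLocalRing R]
    [IsAdicComplete (maximalIdeal R) R] [CommRing S] [Algebra R S] (Z : S) : Prop :=
  ∃ e : BoundarySeries R ≃ₐ[R] S, e BoundarySeries.T = Z

/-- `z` is a parameter of the `k`-algebra `S̄`: one has `S̄ = k((z))`. -/
def IsResidueParameter (R : Type*) {S : Type*} [CommRing R] [IsLocalRing R] [CommRing S]
    [Algebra R S] (z : SpecialFiber R S) : Prop :=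
  ∃ e : LaurentSeries (ResidueField R) ≃+* SpecialFiber R S,
    e (HahnSeries.single 1 1) = z ∧
    ∀ r : R, e (HahnSeries.C (IsLocalRing.residue R r)) = SpecialFiber.mk R (algebraMap R S r)

/-- `ρ = x ^ (1 / m)`, the `m`-th root of `x` which is congruent to `1` modulo `𝔪`. -/
def IsPrincipalRoot (R : Type*) {S : Type*} [CommRing R] [IsLocalRing R] [CommRing S]
    [Algebra R S] (m : ℤ) (x : S) (ρ : Sˣ) : Prop :=
  ((ρ ^ m : Sˣ) : S) = x ∧ SpecialFiber.mk R (ρ : S) = 1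

/-- The valuation of the different of `B / A`, where `ϖ` is a uniformizer of the discrete
valuation ring `B`. -/
def differentVal (A : Type*) {B : Type*} [CommRing A] [CommRing B] [Algebra A B] [IsDomain A]
    [IsDedekindDomain B] [Module.IsTorsionFree A B] (ϖ : B) : ℕ∞ :=
  emultiplicity (Ideal.span {ϖ}) (differentIdeal A B)

end SpecialFiber

section Torsor

variable {R A B H : Type*} [CommRing R] [CommRing A] [CommRing B] [Algebra R A] [Algebra R B]
  [Algebra A B] [IsScalarTower R A B] [CommRing H]

/-- The coaction `ρ : B → B ⊗_R H` makes `Spec B → Spec A` an `fppf`-torsor under the affine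
`R`-group scheme `Spec H`: it is an action over `A`, the morphism `Spec B → Spec A` is faithfully
flat and of finite presentation, and `Spec B × Spec H → Spec B ×_A Spec B`, `(b, g) ↦ (b, b g)`
is an isomorphism. -/
structure IsTorsor [HopfAlgebra R H] (ρ : B →ₐ[A] B ⊗[R] H) : Prop where
  coassoc : (Algebra.TensorProduct.assoc R R R B H H).toAlgHom.comp
      ((Algebra.TensorProduct.map (ρ.restrictScalars R) (.id R H)).comp (ρ.restrictScalars R)) =
    (Algebra.TensorProduct.map (.id R B) (Bialgebra.comulAlgHom R H)).comp (ρ.restrictScalars R)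
  counit : (Algebra.TensorProduct.map (.id R B) (Bialgebra.counitAlgHom R H)).comp
      (ρ.restrictScalars R) = (Algebra.TensorProduct.rid R R B).symm
  faithfullyFlat : Module.FaithfullyFlat A B
  finitePresentation : Algebra.FinitePresentation A B
  bijective : Function.Bijective (Algebra.TensorProduct.lift
    (Algebra.TensorProduct.includeLeft : B →ₐ[A] B ⊗[R] H) ρ (fun _ _ => Commute.all _ _))

/-- The endomorphism of `B` by which the point `g` of `Spec H` with values in `R` acts. -/
def pointAction [Algebra R H] (ρ : B →ₐ[A] B ⊗[R] H) (g : H →ₐ[R] R) : B →ₐ[R] B :=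
  (Algebra.TensorProduct.rid R R B).toAlgHom.comp
    ((Algebra.TensorProduct.map (.id R B) g).comp (ρ.restrictScalars R))

/-- The coordinate ring `R[x] / (x ^ p - 1)` of `μ_p`, as the group algebra of `ℤ / p`. -/
abbrev MuRing (R : Type*) [CommRing R] (p : ℕ) : Type _ :=
  MonoidAlgebra R (Multiplicative (ZMod p))

/-- The coordinate on `μ_p`. -/
def MuRing.x (R : Type*) [CommRing R] (p : ℕ) : MuRing R p :=
  MonoidAlgebra.of R _ (Multiplicative.ofAdd 1)

/-- `B = A[X] / (f)`, where `b` is the class of `X`. -/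
def IsPresentedBy (f : A[X]) (b : B) : Prop :=
  ∃ e : AdjoinRoot f ≃ₐ[A] B, e (AdjoinRoot.root f) = b

variable {p : ℕ} {G : Subgroup (B ≃ₐ[A] B)}

/-- `B = A[y] / (y ^ p - u)`, and `σ y = ζ ^ φ(σ) y` for all `σ ∈ G`. -/
structure IsMultiplicativePresentation (ζ : R) (φ : G ≃* Multiplicative (ZMod p)) (u : Aˣ) (y : B) :
    Prop where
  isPresentedBy : IsPresentedBy (Polynomial.X ^ p - Polynomial.C (u : A)) y
  action (σ : G) : (σ : B ≃ₐ[A] B) y = algebraMap R B (ζ ^ (φ σ).toAdd.val) * y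

/-- `B = A[w] / (((π ^ n w + 1) ^ p - 1) / π ^ (p n) - u)`, and
`σ (π ^ n w + 1) = ζ ^ φ(σ) (π ^ n w + 1)` for all `σ ∈ G`. -/
structure IsAdditivePresentation {π : R} {n : ℕ} (hp : p.Prime)
    (h : π ^ (n * (p - 1)) ∣ (p : R)) (ζ : R) (φ : G ≃* Multiplicative (ZMod p)) (u : A) (w : B) :
    Prop where
  isPresentedBy :
    IsPresentedBy ((isogenyPoly hp h).map (algebraMap R A) - Polynomial.C u) w
  action (σ : G) : (σ : B ≃ₐ[A] B) (algebraMap R B (π ^ n) * w + 1) =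
    algebraMap R B (ζ ^ (φ σ).toAdd.val) * (algebraMap R B (π ^ n) * w + 1)

end Torsor

end

/-! Write A for `R[[T]]{T⁻¹}`. The whole proof reads B through one map, the Frobenius residue Φ : B
→ k((t)), which sends b to the reduction of b ^ p (`IsFrobeniusResidue`). It exists because the
special fibre of B is purely inseparable of degree p over that of A, so p-th powers fall into
k((t)). Since k((t)) also has degree p over its subfield of p-th powers, Φ is onto
(`exists_isFrobeniusResidue`). Thus Φ identifies the special fibre of B with k((t)), the special
fibre of A becoming the subfield of p-th powers. Three dictionary entries follow. A root b of a
monic polynomial of degree p over A presents B by that polynomial iff Φ b is not a p-th power, by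
Nakayama (`isPresentedBy_iff`). If y ^ p = u then Φ y is the reduction of u. And Z is a parameter as
soon as Φ Z has order 1 (`isParameter`): the substitution T ↦ Z converges for the weak topology and
is bijective because it is so modulo π.

Next comes Kummer theory (`exists_kummer`). Independence of characters gives a unit y on which G
acts through φ. Let n be maximal such that y is congruent to an element of A modulo π ^ n; this is
bounded, since σ y - y = (ζ - 1) y for a generator σ. If n = 0, then Φ y is not a p-th power and y ^
p = u presents B. If n > 0, dividing y by an element of A gives y = π ^ n w + 1 with Φ w not a p-th
power, and P_n(w) = u presents B. The different is generated by the derivative of the equation at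
the generator, so its valuation is v(p) in the first case and v(p) - n(p - 1) in the second
(`exists_presentation`). This separates (A) from (B). The torsor structures are written down on the
generator and checked there.

The remaining freedom is to multiply y, or π ^ n w + 1, by units of A. It changes the reduction of u
by p-th powers, multiplicatively in (A) and additively in (B), so du/u, respectively du, is well
defined after reduction. Moving modulo p-th powers, one arranges that y, y - 1 or w has Φ of order m
prime to p. Such an element is Z ^ m with Φ Z of order 1, by Hensel's lemma. Finally σ acts
trivially on the special fibre and ζ reduces to 1, so σ Z is determined by σ (Z ^ m) through the
unique m-th root congruent to 1 (`exists_action_eq`). -/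

set_option linter.unusedSectionVars false

/-! ### The weak topology on `R[[T]]{T⁻¹}` and completeness -/

namespace BoundarySeries
open IsLocalRing

section

variable {R : Type*} [CommRing R] [IsLocalRing R]

@[simp] theorem coeff_sub (f g : BoundarySeries R) (i : ℤ) :
    (f - g).coeff i = f.coeff i - g.coeff i := rfl

theorem coeff_one (i : ℤ) : (1 : BoundarySeries R).coeff i = if i = 0 then 1 else 0 := rfl

variable [IsAdicComplete (maximalIdeal R) R]

@[simp] theorem coeff_smul (r : R) (f : BoundarySeries R) (i : ℤ) :
    (r • f).coeff i = r * f.coeff i := by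
  rw [Algebra.smul_def, algebraMap_apply, coeff_const_mul]

theorem coeff_sum {ι : Type*} (s : Finset ι) (f : ι → BoundarySeries R) (i : ℤ) :
    (∑ j ∈ s, f j).coeff i = ∑ j ∈ s, (f j).coeff i :=
  map_sum ({ toFun := fun f => f.coeff i, map_zero' := rfl, map_add' := fun _ _ => rfl } :
    BoundarySeries R →+ R) f s

theorem residue_surjective : Function.Surjective (residue (R := R)) := by
  classical
  intro g
  choose l hl using IsLocalRing.residue_surjective (R := R)
  refine ⟨⟨fun i => if g.coeff i = 0 then 0 else l (g.coeff i), fun N => ⟨g.order, fun i hi => ?_⟩⟩,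
    ?_⟩
  · rw [if_pos (HahnSeries.coeff_eq_zero_of_lt_order hi)]
    exact zero_mem _
  · ext i
    rw [residue_coeff]
    dsimp only
    split_ifs with h
    · rw [h, map_zero]
    · exact hl _

/-- The series whose coefficients of index `< L` lie in `𝔪 ^ N`. -/
def small (N : ℕ) (L : ℤ) : Submodule R (BoundarySeries R) where
  carrier := {f | ∀ i < L, f.coeff i ∈ maximalIdeal R ^ N}
  add_mem' hf hg i hi := add_mem (hf i hi) (hg i hi)
  zero_mem' _ _ := zero_mem _
  smul_mem' r f hf i hi := by
    rw [coeff_smul]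
    exact Ideal.mul_mem_left _ _ (hf i hi)

theorem mem_small {N : ℕ} {L : ℤ} {f : BoundarySeries R} :
    f ∈ small N L ↔ ∀ i < L, f.coeff i ∈ maximalIdeal R ^ N := Iff.rfl

theorem small_anti {N : ℕ} {L L' : ℤ} (h : L ≤ L') : (small N L' : Submodule R _) ≤ small N L :=
  fun _ hf i hi => hf i (hi.trans_le h)

theorem small_anti_left {N N' : ℕ} {L : ℤ} (h : N ≤ N') :
    (small N' L : Submodule R _) ≤ small N L :=
  fun _ hf i hi => Ideal.pow_le_pow_right h (hf i hi)

theorem exists_mem_small (f : BoundarySeries R) (N : ℕ) : ∃ L, f ∈ small N L :=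
  f.tendsto_zero N

theorem mem_small_iff_modPow {N : ℕ} {L : ℤ} {f : BoundarySeries R} :
    f ∈ small N L ↔ ∀ i < L, (modPow N f).coeff i = 0 := by
  simp only [mem_small, modPow_coeff, Ideal.Quotient.eq_zero_iff_mem]

/-- Modulo 𝔪 ^ N this is the additivity of lower bounds for supports of Laurent series. -/
theorem mul_mem_small {N : ℕ} {L M : ℤ} {f g : BoundarySeries R} (hf : f ∈ small N L)
    (hg : g ∈ small N M) : f * g ∈ small N (L + M) := by
  rw [mem_small_iff_modPow] at *
  intro i hi
  rw [modPow_mul, HahnSeries.coeff_mul]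
  refine Finset.sum_eq_zero fun x hx => ?_
  obtain ⟨h1, h2, h3⟩ := Finset.mem_antidiagonal.mp hx
  exfalso
  have e1 : L ≤ x.1 := by
    by_contra h
    exact h1 (hf _ (not_le.mp h))
  have e2 : M ≤ x.2 := by
    by_contra h
    exact h2 (hg _ (not_le.mp h))
  omega

theorem one_mem_small (N : ℕ) : (1 : BoundarySeries R) ∈ small N 0 := fun i hi => by
  rw [coeff_one, if_neg hi.ne]
  exact zero_mem _

theorem pow_mem_small {N : ℕ} {L : ℤ} {f : BoundarySeries R} (hf : f ∈ small N L) (n : ℕ) :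
    f ^ n ∈ small N (n * L) := by
  induction n with
  | zero => simpa using one_mem_small N
  | succ n ih =>
    rw [pow_succ, Nat.cast_succ, add_one_mul]
    exact mul_mem_small ih hf

theorem eq_zero_of_mem_small {f : BoundarySeries R} (h : ∀ N L, f ∈ small N L) : f = 0 := by
  ext i
  refine IsHausdorff.haus (I := maximalIdeal R) inferInstance _ fun N => ?_
  rw [SModEq.zero, smul_eq_mul, Ideal.mul_top]
  exact h N (i + 1) i (by omega)

/-- Weak Cauchy sequences converge. -/
theorem exists_limit (s : ℕ → BoundarySeries R)
    (hs : ∀ N L, ∃ n₀, ∀ n ≥ n₀, s n - s n₀ ∈ small N L) :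
    ∃ f, ∀ N L, ∃ n₀, ∀ n ≥ n₀, s n - f ∈ small N L := by
  choose n₀ hn₀ using hs
  -- The Cauchy condition with bound i + 1 controls the coefficient of index i, which gives an
  -- 𝔪-adic Cauchy sequence in R.
  have key : ∀ i : ℤ, ∃ r : R, ∀ N : ℕ, (s (n₀ N (i + 1))).coeff i - r ∈ maximalIdeal R ^ N := by
    intro i
    obtain ⟨r, hr⟩ := IsPrecomplete.prec (I := maximalIdeal R) (M := R) inferInstance
      (f := fun N => (s (n₀ N (i + 1))).coeff i) (by
        intro m n hmn
        rw [SModEq.sub_mem, smul_eq_mul, Ideal.mul_top]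
        have h1 := hn₀ m (i + 1) _ (le_max_left (n₀ m (i + 1)) (n₀ n (i + 1))) i (by omega)
        have h2 := small_anti_left hmn
          (hn₀ n (i + 1) _ (le_max_right (n₀ m (i + 1)) (n₀ n (i + 1)))) i (by omega)
        have := sub_mem h2 h1
        simpa using this)
    refine ⟨r, fun N => ?_⟩
    have := hr N
    rwa [SModEq.sub_mem, smul_eq_mul, Ideal.mul_top] at this
  choose r hr using key
  have key2 : ∀ N i n, n₀ N (i + 1) ≤ n → (s n).coeff i - r i ∈ maximalIdeal R ^ N := by
    intro N i n hn
    have := add_mem (hn₀ N (i + 1) n hn i (by omega)) (hr i N)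
    simpa using this
  have key3 : ∀ N L i n, n₀ N L ≤ n → i < L → (s n).coeff i - r i ∈ maximalIdeal R ^ N := by
    intro N L i n hn hi
    have h1 := hn₀ N L _ (le_max_left (n₀ N L) (n₀ N (i + 1))) i hi
    have h2 := key2 N i _ (le_max_right (n₀ N L) (n₀ N (i + 1)))
    have h3 := hn₀ N L _ hn i hi
    have := add_mem (sub_mem h3 h1) h2
    simpa using this
  refine ⟨⟨r, fun N => ?_⟩, fun N L => ⟨n₀ N L, fun n hn i hi => key3 N L i n hn hi⟩⟩
  -- One term of the sequence approximates all coefficients of negative index at once, so its decay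
  -- passes to the limit.
  obtain ⟨M, hM⟩ := (s (n₀ N 0)).tendsto_zero N
  refine ⟨min M 0, fun i hi => ?_⟩
  have := sub_mem (hM i (by omega)) (key3 N 0 i _ le_rfl (by omega))
  simpa using this

end

section dvr

variable {R : Type*} [CommRing R] [IsDomain R] [IsDiscreteValuationRing R]
  [IsAdicComplete (maximalIdeal R) R] {π : R}

/-- Coefficientwise quotients still decay: a coefficient divisible by π ^ (n + K) has its quotient
by π ^ n divisible by π ^ K. -/
theorem pow_dvd_iff (hπ : Irreducible π) (n : ℕ) (f : BoundarySeries R) :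
    algebraMap R (BoundarySeries R) π ^ n ∣ f ↔ ∀ i, f.coeff i ∈ maximalIdeal R ^ n := by
  simp only [hπ.maximalIdeal_eq, Ideal.span_singleton_pow, Ideal.mem_span_singleton]
  rw [← map_pow]
  constructor
  · rintro ⟨g, rfl⟩ i
    rw [algebraMap_apply, coeff_const_mul]
    exact dvd_mul_right _ _
  · intro h
    choose c hc using h
    refine ⟨⟨c, fun K => ?_⟩, ?_⟩
    · obtain ⟨M, hM⟩ := f.tendsto_zero (n + K)
      refine ⟨M, fun j hj => ?_⟩
      have := hM j hj
      rw [hπ.maximalIdeal_eq, Ideal.span_singleton_pow, Ideal.mem_span_singleton, pow_add, hc j]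
        at this
      rw [hπ.maximalIdeal_eq, Ideal.span_singleton_pow, Ideal.mem_span_singleton]
      exact (mul_dvd_mul_iff_left (pow_ne_zero _ hπ.ne_zero)).mp this
    · ext j
      rw [algebraMap_apply, coeff_const_mul, hc j]

theorem residue_eq_zero_iff (hπ : Irreducible π) (f : BoundarySeries R) :
    residue f = 0 ↔ algebraMap R (BoundarySeries R) π ∣ f := by
  rw [← pow_one (algebraMap R _ π), pow_dvd_iff hπ, HahnSeries.ext_iff, funext_iff]
  simp

theorem isAdicComplete (hπ : Irreducible π) :
    IsAdicComplete (Ideal.span {algebraMap R (BoundarySeries R) π}) (BoundarySeries R) where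
  haus' f hf := eq_zero_of_mem_small fun N L i _ => by
    have := hf N
    rw [SModEq.zero, smul_eq_mul, Ideal.mul_top, Ideal.span_singleton_pow,
      Ideal.mem_span_singleton] at this
    exact (pow_dvd_iff hπ N f).mp this i
  prec' s hs := by
    have h1 : ∀ {m n}, m ≤ n → ∀ i, (s m - s n).coeff i ∈ maximalIdeal R ^ m := by
      intro m n hmn
      have := hs hmn
      rwa [SModEq.sub_mem, smul_eq_mul, Ideal.mul_top, Ideal.span_singleton_pow,
        Ideal.mem_span_singleton, pow_dvd_iff hπ] at this
    obtain ⟨f, hf⟩ := exists_limit s fun N L => ⟨N, fun n hn i _ => by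
      simpa using neg_mem (h1 hn i)⟩
    refine ⟨f, fun n => ?_⟩
    rw [SModEq.sub_mem, smul_eq_mul, Ideal.mul_top, Ideal.span_singleton_pow,
      Ideal.mem_span_singleton, pow_dvd_iff hπ]
    intro i
    obtain ⟨n₀, hn₀⟩ := hf n (i + 1)
    -- The weak limit is a π-adic limit: for each i, pass through a later term that is weakly close
    -- to f at index i; the first estimate is uniform in i.
    have := add_mem (h1 (le_max_left n n₀) i) (hn₀ _ (le_max_right n n₀) i (by omega))
    simpa using this

end dvr

end BoundarySeries

/-! ### A criterion for complete discrete valuation rings -/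

section DVR

variable {S : Type*} [CommRing S]

/-- An inverse modulo ϖ lifts, because completeness puts ϖ into the Jacobson radical. -/
theorem isUnit_of_not_dvd_of_isField {ϖ : S} [IsAdicComplete (Ideal.span {ϖ}) S]
    (hfield : IsField (S ⧸ Ideal.span {ϖ})) {x : S} (hx : ¬ ϖ ∣ x) : IsUnit x := by
  obtain ⟨y, hy⟩ := hfield.mul_inv_cancel
    (a := Ideal.Quotient.mk (Ideal.span {ϖ}) x) (by
      rwa [Ne, Ideal.Quotient.eq_zero_iff_mem, Ideal.mem_span_singleton])
  obtain ⟨y, rfl⟩ := Ideal.Quotient.mk_surjective y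
  rw [← map_mul, ← map_one (Ideal.Quotient.mk _), Ideal.Quotient.eq] at hy
  have := IsAdicComplete.le_jacobson_bot _ hy
  rw [Ideal.mem_jacobson_bot] at this
  have := this 1
  simp only [mul_one, sub_add_cancel] at this
  exact isUnit_of_mul_isUnit_left this

theorem exists_eq_pow_mul_of_isHausdorff {ϖ : S} [IsHausdorff (Ideal.span {ϖ}) S] {x : S}
    (hx : x ≠ 0) : ∃ (n : ℕ) (y : S), x = ϖ ^ n * y ∧ ¬ ϖ ∣ y := by
  classical
  have hex : ∃ n, ¬ ϖ ^ (n + 1) ∣ x := by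
    by_contra! hall
    refine hx (IsHausdorff.haus (I := Ideal.span {ϖ}) inferInstance _ fun n => ?_)
    rw [SModEq.zero, smul_eq_mul, Ideal.mul_top, Ideal.span_singleton_pow,
      Ideal.mem_span_singleton]
    exact (pow_dvd_pow ϖ n.le_succ).trans (hall n)
  have hd : ϖ ^ Nat.find hex ∣ x := by
    rcases Nat.eq_zero_or_pos (Nat.find hex) with h0 | h0
    · simp [h0]
    · have := Nat.find_min hex (m := Nat.find hex - 1) (by omega)
      push Not at this
      simpa [Nat.sub_add_cancel h0] using this
  obtain ⟨y, hy⟩ := hd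
  refine ⟨_, y, hy, fun ⟨z, hz⟩ => Nat.find_spec hex ⟨z, ?_⟩⟩
  rw [pow_succ, mul_assoc, ← hz, ← hy]

variable {ϖ : S} [IsAdicComplete (Ideal.span {ϖ}) S]

/-- A nonzero element is a power of ϖ times a unit, so a zero divisor would contradict the
regularity of ϖ. -/
theorem isDomain_of_isField_quotient (hfield : IsField (S ⧸ Ideal.span {ϖ}))
    (hreg : ∀ x, ϖ * x = 0 → x = 0) : IsDomain S := by
  have hnt := hfield.nontrivial
  have : Nontrivial S := (Ideal.Quotient.mk (Ideal.span {ϖ})).domain_nontrivial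
  have hreg' : ∀ (n : ℕ) x, ϖ ^ n * x = 0 → x = 0 := by
    intro n
    induction n with
    | zero => simp
    | succ n ih =>
      intro x hx
      exact hreg _ (ih _ (by rwa [pow_succ, mul_assoc] at hx))
  have : NoZeroDivisors S := ⟨by
    intro a b hab
    by_contra! hne
    obtain ⟨n, u, rfl, hu⟩ := exists_eq_pow_mul_of_isHausdorff (ϖ := ϖ) hne.1
    have hu := isUnit_of_not_dvd_of_isField hfield hu
    refine hne.2 (hreg' n b ?_)
    rw [← hu.mul_right_inj, mul_zero, ← hab]
    rw [mul_left_comm, mul_assoc]⟩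
  exact NoZeroDivisors.to_isDomain S

theorem irreducible_of_isField_quotient (hfield : IsField (S ⧸ Ideal.span {ϖ}))
    (hreg : ∀ x, ϖ * x = 0 → x = 0) : Irreducible ϖ := by
  have hD := isDomain_of_isField_quotient hfield hreg
  have hne : ϖ ≠ 0 := by
    rintro rfl
    exact one_ne_zero (hreg 1 (by simp))
  refine Prime.irreducible ((Ideal.span_singleton_prime hne).mp ?_)
  exact ((Ideal.Quotient.maximal_ideal_iff_isField_quotient _).mpr hfield).isPrime

theorem isDiscreteValuationRing_of_isField_quotient [IsDomain S]
    (hfield : IsField (S ⧸ Ideal.span {ϖ})) (hreg : ∀ x, ϖ * x = 0 → x = 0) :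
    IsDiscreteValuationRing S := by
  refine IsDiscreteValuationRing.ofHasUnitMulPowIrreducibleFactorization
    ⟨ϖ, irreducible_of_isField_quotient hfield hreg, fun {x} hx => ?_⟩
  obtain ⟨n, u, rfl, hu⟩ := exists_eq_pow_mul_of_isHausdorff (ϖ := ϖ) hx
  exact ⟨n, (isUnit_of_not_dvd_of_isField hfield hu).unit, rfl⟩

end DVR

/-! ### `R[[T]]{T⁻¹}` is a discrete valuation ring with residue field k((t)) -/

namespace BoundarySeries
open IsLocalRing

variable {R : Type*} [CommRing R] [IsDomain R] [IsDiscreteValuationRing R]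
  [IsAdicComplete (maximalIdeal R) R] {π : R}

theorem ker_residue (hπ : Irreducible π) :
    RingHom.ker (residue (R := R)) = Ideal.span {algebraMap R (BoundarySeries R) π} := by
  ext f
  rw [RingHom.mem_ker, residue_eq_zero_iff hπ, Ideal.mem_span_singleton]

theorem isField_quotient (hπ : Irreducible π) :
    IsField (BoundarySeries R ⧸ Ideal.span {algebraMap R (BoundarySeries R) π}) := by
  rw [← ker_residue hπ]
  exact (RingHom.quotientKerEquivOfSurjective residue_surjective).toMulEquiv.isField
    (Field.toIsField _)

theorem algebraMap_injective : Function.Injective (algebraMap R (BoundarySeries R)) := by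
  intro a b h
  have := congrArg (fun f => coeff f 0) h
  simpa [algebraMap_apply, coeff_const] using this

theorem irreducible_algebraMap (hπ : Irreducible π) :
    Irreducible (algebraMap R (BoundarySeries R) π) := by
  have := isAdicComplete hπ
  refine irreducible_of_isField_quotient (isField_quotient hπ) fun x hx => ?_
  refine (mul_eq_zero.mp hx).resolve_left ?_
  exact (map_ne_zero_iff _ algebraMap_injective).mpr hπ.ne_zero

instance : IsDiscreteValuationRing (BoundarySeries R) := by
  obtain ⟨π, hπ⟩ := IsDiscreteValuationRing.exists_irreducible R
  have := isAdicComplete hπ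
  refine isDiscreteValuationRing_of_isField_quotient (isField_quotient hπ) fun x hx => ?_
  exact (mul_eq_zero.mp hx).resolve_left (irreducible_algebraMap hπ).ne_zero

theorem isUnit_iff_residue_ne_zero {f : BoundarySeries R} : IsUnit f ↔ residue f ≠ 0 := by
  obtain ⟨π, hπ⟩ := IsDiscreteValuationRing.exists_irreducible R
  have := isAdicComplete hπ
  refine ⟨fun h => (h.map residue).ne_zero, fun h => ?_⟩
  rw [Ne, residue_eq_zero_iff hπ] at h
  exact isUnit_of_not_dvd_of_isField (isField_quotient hπ) h

end BoundarySeries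

/-! ### Orders, roots and field endomorphisms of k((t)) -/

namespace LaurentSeries

section fil

variable {k : Type*} [Field k]

/-- The Laurent series of order at least `n`. -/
def fil (k : Type*) [Field k] (n : ℤ) : AddSubgroup (LaurentSeries k) where
  carrier := {f | ∀ i < n, f.coeff i = 0}
  add_mem' hf hg i hi := by rw [HahnSeries.coeff_add, hf i hi, hg i hi, add_zero]
  zero_mem' _ _ := rfl
  neg_mem' hf i hi := by rw [HahnSeries.coeff_neg, hf i hi, neg_zero]

theorem mem_fil_iff_le_order {n : ℤ} {f : LaurentSeries k} (hf : f ≠ 0) :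
    f ∈ fil k n ↔ n ≤ f.order :=
  ⟨fun h => not_lt.mp fun hlt => HahnSeries.coeff_order_eq_zero.not.mpr hf (h _ hlt),
    fun h _ hi => HahnSeries.coeff_eq_zero_of_lt_order (hi.trans_le h)⟩

theorem mul_mem_fil {n m : ℤ} {f g : LaurentSeries k} (hf : f ∈ fil k n) (hg : g ∈ fil k m) :
    f * g ∈ fil k (n + m) := by
  by_cases hf0 : f = 0
  · simp [hf0, zero_mem]
  by_cases hg0 : g = 0
  · simp [hg0, zero_mem]
  rw [mem_fil_iff_le_order hf0] at hf
  rw [mem_fil_iff_le_order hg0] at hg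
  rw [mem_fil_iff_le_order (mul_ne_zero hf0 hg0), HahnSeries.order_mul hf0 hg0]
  exact add_le_add hf hg

theorem eq_zero_of_mem_fil {f : LaurentSeries k} (h : ∀ n : ℕ, f ∈ fil k n) : f = 0 := by
  ext i
  exact h (i + 1).toNat i (by omega)

theorem mem_fil_zero_iff {f : LaurentSeries k} :
    f ∈ fil k 0 ↔ ∃ P : PowerSeries k, HahnSeries.ofPowerSeries ℤ k P = f := by
  constructor
  · intro h
    refine ⟨PowerSeries.mk fun n => f.coeff n, ?_⟩
    ext i
    rw [PowerSeries.coeff_coe]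
    split_ifs with hi
    · rw [h i hi]
    · rw [PowerSeries.coeff_mk, Int.natAbs_of_nonneg (not_lt.mp hi)]
  · rintro ⟨P, rfl⟩ i hi
    rw [PowerSeries.coeff_coe, if_pos hi]

theorem single_ne_zero (n : ℤ) : (HahnSeries.single n (1 : k) : LaurentSeries k) ≠ 0 :=
  HahnSeries.single_ne_zero one_ne_zero

theorem order_inv {f : LaurentSeries k} (hf : f ≠ 0) : f⁻¹.order = -f.order := by
  have := HahnSeries.order_mul hf (inv_ne_zero hf)
  rw [mul_inv_cancel₀ hf, HahnSeries.order_one] at this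
  omega

theorem order_zpow {f : LaurentSeries k} (hf : f ≠ 0) (n : ℤ) : (f ^ n).order = n * f.order := by
  obtain ⟨m, rfl | rfl⟩ := n.eq_nat_or_neg
  · simp
  · rw [zpow_neg, order_inv (zpow_ne_zero _ hf), zpow_natCast, HahnSeries.order_pow]
    simp

/-- A Laurent series of order `n` is `t ^ n` times one of order `0`. -/
theorem exists_eq_single_mul (n : ℤ) (f : LaurentSeries k) :
    ∃ g, f = HahnSeries.single n 1 * g := ⟨HahnSeries.single (-n) 1 * f, by
  rw [← mul_assoc, HahnSeries.single_mul_single]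
  simp⟩

theorem single_mem_fil (n : ℤ) (c : k) : HahnSeries.single n c ∈ fil k n := fun i hi => by
  rw [HahnSeries.coeff_single_of_ne hi.ne]

theorem natCast_ne_zero_of_coprime {p : ℕ} [hp : Fact p.Prime] [CharP k p] {n : ℕ}
    (hn : n.Coprime p) : (n : k) ≠ 0 := by
  rw [Ne, CharP.cast_eq_zero_iff k p]
  intro h
  exact hp.out.one_lt.ne' (Nat.dvd_one.mp (hn.gcd_eq_one ▸ Nat.dvd_gcd h dvd_rfl))

end fil

section roots

variable {k : Type*} [Field k] [IsAlgClosed k]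

theorem exists_pow_eq {n : ℕ} (hn : (n : k) ≠ 0) {f : LaurentSeries k} (hf : f ≠ 0)
    (h0 : f.order = 0) : ∃ g, g ^ n = f := by
  have hn0 : n ≠ 0 := by rintro rfl; simp at hn
  obtain ⟨P, rfl⟩ := mem_fil_zero_iff.mp ((mem_fil_iff_le_order hf).mpr h0.ge)
  have hP : PowerSeries.constantCoeff P ≠ 0 := by
    have := HahnSeries.coeff_order_eq_zero.not.mpr hf
    rwa [h0, PowerSeries.coeff_coe, if_neg (lt_irrefl _), Int.natAbs_zero,
      PowerSeries.coeff_zero_eq_constantCoeff_apply] at this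
  obtain ⟨d, hd⟩ := IsAlgClosed.exists_pow_nat_eq (PowerSeries.constantCoeff P)
    (Nat.pos_of_ne_zero hn0)
  have hd0 : d ≠ 0 := by
    rintro rfl
    rw [zero_pow hn0] at hd
    exact hP hd.symm
  -- Hensel's lemma in k[[t]], starting from an n-th root of the constant term; n is invertible in
  -- k.
  obtain ⟨a, ha, -⟩ := HenselianRing.is_henselian
    (I := Ideal.span {(PowerSeries.X : PowerSeries k)})
    (Polynomial.X ^ n - Polynomial.C P) (Polynomial.monic_X_pow_sub_C P hn0) (PowerSeries.C d) (by
      rw [Ideal.mem_span_singleton, PowerSeries.X_dvd_iff]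
      simp [hd]) (by
      refine IsUnit.map _ ?_
      rw [PowerSeries.isUnit_iff_constantCoeff]
      simp [Polynomial.derivative_X_pow, hn, hd0])
  refine ⟨HahnSeries.ofPowerSeries ℤ k a, ?_⟩
  rw [← map_pow]
  congr 1
  simpa [Polynomial.IsRoot, sub_eq_zero] using ha

/-- Field endomorphisms of `k((t))` preserve the units of `k[[t]]`. -/
theorem order_map_eq_zero (p : ℕ) [hp : Fact p.Prime] [CharP k p]
    (α : LaurentSeries k →+* LaurentSeries k) {f : LaurentSeries k}
    (hf : f ≠ 0) (h0 : f.order = 0) : (α f).order = 0 := by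
  obtain ⟨a, ha⟩ : ∃ a, a = (α f).order := ⟨_, rfl⟩
  rw [← ha]
  -- Series of order 0 have n-th roots for all n prime to p. This n exceeds |a| when a ≠ 0, yet it
  -- has to divide a; so a = 0, with no continuity assumed.
  have hc : (a.natAbs * p + 1).Coprime p := by simp
  obtain ⟨g, rfl⟩ := exists_pow_eq (natCast_ne_zero_of_coprime hc) hf h0
  rw [map_pow, HahnSeries.order_pow, nsmul_eq_mul] at ha
  by_contra hne
  have h1 : (a.natAbs * p + 1) ∣ a.natAbs := by
    rw [← Int.natCast_dvd]
    exact ⟨_, ha⟩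
  have h2 := Nat.le_of_dvd (Int.natAbs_pos.mpr hne) h1
  have h3 := Nat.le_mul_of_pos_right a.natAbs hp.out.pos
  omega

/-- If the constant term vanishes, adding 1 reduces to the case of order 0. -/
theorem map_mem_fil_zero (p : ℕ) [hp : Fact p.Prime] [CharP k p]
    (α : LaurentSeries k →+* LaurentSeries k) {f : LaurentSeries k}
    (hf : f ∈ fil k 0) : α f ∈ fil k 0 := by
  have key : ∀ {g : LaurentSeries k}, g ∈ fil k 0 → g.coeff 0 ≠ 0 → α g ∈ fil k 0 := by
    intro g hg h
    have hg0 : g ≠ 0 := by rintro rfl; simp at h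
    rw [mem_fil_iff_le_order ((map_ne_zero α).mpr hg0)]
    refine (order_map_eq_zero p α hg0 ?_).ge
    exact le_antisymm (HahnSeries.order_le_of_coeff_ne_zero h) ((mem_fil_iff_le_order hg0).mp hg)
  by_cases h : f.coeff 0 = 0
  · have h1 : (1 : LaurentSeries k) ∈ fil k 0 := fun i hi => by
      rw [HahnSeries.coeff_one, if_neg hi.ne]
    have := sub_mem (key (add_mem hf h1) (by simp [h])) h1
    simpa using this
  · exact key hf h

/-- Field endomorphisms of `k((t))` are determined by their values at constants and at `t`, if
the image of `t` has positive order. -/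
theorem ringHom_ext (p : ℕ) [hp : Fact p.Prime] [CharP k p]
    {α β : LaurentSeries k →+* LaurentSeries k}
    (hC : ∀ c, α (HahnSeries.C c) = β (HahnSeries.C c))
    (hT : α (HahnSeries.single 1 1) = β (HahnSeries.single 1 1))
    (h1 : α (HahnSeries.single 1 1) ∈ fil k 1) : α = β := by
  -- Both maps preserve k[[t]]; writing P = t P' + c gains one order of agreement at each step.
  have key : ∀ (n : ℕ) (P : PowerSeries k),
      α (HahnSeries.ofPowerSeries ℤ k P) - β (HahnSeries.ofPowerSeries ℤ k P) ∈ fil k n := by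
    intro n
    induction n with
    | zero =>
      intro P
      have hP := mem_fil_zero_iff.mpr ⟨P, rfl⟩
      exact sub_mem (map_mem_fil_zero p α hP) (map_mem_fil_zero p β hP)
    | succ n ih =>
      intro P
      rw [P.eq_X_mul_shift_add_const, map_add, map_add, map_add, map_mul, map_mul, map_mul,
        HahnSeries.ofPowerSeries_X, HahnSeries.ofPowerSeries_C, hC, ← hT, add_sub_add_right_eq_sub,
        ← mul_sub, Nat.cast_succ, add_comm]
      exact mul_mem_fil h1 (ih _)
  have key2 : ∀ f ∈ fil k 0, α f = β f := by
    intro f hf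
    obtain ⟨P, rfl⟩ := mem_fil_zero_iff.mp hf
    exact sub_eq_zero.mp (eq_zero_of_mem_fil fun n => key n P)
  ext1 f
  obtain ⟨g, hg⟩ := exists_eq_single_mul f.order f
  have h2 : α (HahnSeries.single f.order 1) = β (HahnSeries.single f.order 1) := by
    rw [RatFunc.single_zpow, map_zpow₀, map_zpow₀, hT]
  rw [hg, map_mul, map_mul, h2, key2]
  by_cases hf : f = 0
  · have : g = 0 := by
      rw [hf] at hg
      exact (mul_eq_zero.mp hg.symm).resolve_left (single_ne_zero _)
    rw [this]
    exact zero_mem _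
  · have hg0 : g ≠ 0 := by rintro rfl; simp at hg; exact hf hg
    rw [mem_fil_iff_le_order hg0]
    have := congrArg HahnSeries.order hg
    rw [HahnSeries.order_mul (single_ne_zero _) hg0, HahnSeries.order_single one_ne_zero] at this
    omega

/-- If t is the image of t ^ n times a unit of k[[t]], then 1 is n times the order of the image of
t, and that order is nonnegative. -/
theorem order_map_single_of_surjective (p : ℕ) [hp : Fact p.Prime] [CharP k p]
    {α : LaurentSeries k →+* LaurentSeries k}
    (hα : Function.Surjective α) : (α (HahnSeries.single 1 1)).order = 1 := by
  set τ := α (HahnSeries.single 1 1) with hτ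
  have hτ0 : τ ≠ 0 := (map_ne_zero α).mpr (single_ne_zero 1)
  have hnn : 0 ≤ τ.order := by
    rw [← mem_fil_iff_le_order hτ0]
    refine map_mem_fil_zero p α ?_
    rw [mem_fil_iff_le_order (single_ne_zero 1), HahnSeries.order_single one_ne_zero]
    exact zero_le_one
  obtain ⟨f, hf⟩ := hα (HahnSeries.single 1 1)
  have hf0 : f ≠ 0 := by
    rintro rfl
    rw [map_zero] at hf
    exact single_ne_zero 1 hf.symm
  obtain ⟨g, hg⟩ := exists_eq_single_mul f.order f
  have hg0 : g ≠ 0 := by rintro rfl; simp at hg; exact hf0 hg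
  have hgo : g.order = 0 := by
    have := congrArg HahnSeries.order hg
    rw [HahnSeries.order_mul (single_ne_zero _) hg0, HahnSeries.order_single one_ne_zero] at this
    omega
  have h1 := congrArg HahnSeries.order hf
  rw [hg, map_mul, RatFunc.single_zpow, map_zpow₀, ← hτ,
    HahnSeries.order_mul (zpow_ne_zero _ hτ0) ((map_ne_zero α).mpr hg0),
    order_map_eq_zero p α hg0 hgo, order_zpow hτ0, HahnSeries.order_single one_ne_zero,
    add_zero] at h1
  exact Int.eq_one_of_mul_eq_one_left hnn h1

/-- Surjectivity of substitutions `t ↦ τ` with `τ` of order `1`, twisted by an automorphism of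
`k`. -/
theorem surjective_of_order_eq_one (p : ℕ) [hp : Fact p.Prime] [CharP k p]
    {α : LaurentSeries k →+* LaurentSeries k} {s : k → k}
    (hs : ∀ c, α (HahnSeries.C (s c)) = HahnSeries.C c)
    (h1 : (α (HahnSeries.single 1 1)).order = 1) :
    Function.Surjective α := by
  set τ := α (HahnSeries.single 1 1) with hτ
  have hτ0 : τ ≠ 0 := (map_ne_zero α).mpr (single_ne_zero 1)
  -- Division with remainder by τ, so that iterating `F` gives the expansion of g in powers of τ.
  have hstep : ∀ g : PowerSeries k, ∃ h : PowerSeries k, HahnSeries.ofPowerSeries ℤ k g =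
      HahnSeries.C (PowerSeries.constantCoeff g) + τ * HahnSeries.ofPowerSeries ℤ k h := by
    intro g
    have hm : τ⁻¹ * (HahnSeries.ofPowerSeries ℤ k g - HahnSeries.C (PowerSeries.constantCoeff g))
        ∈ fil k 0 := by
      have : (0 : ℤ) = -1 + 1 := by norm_num
      rw [this]
      refine mul_mem_fil ?_ ?_
      · rw [mem_fil_iff_le_order (inv_ne_zero hτ0), order_inv hτ0, h1]
      · nth_rewrite 1 [g.eq_X_mul_shift_add_const]
        rw [map_add, HahnSeries.ofPowerSeries_C, add_sub_cancel_right, map_mul,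
          HahnSeries.ofPowerSeries_X, ← add_zero (1 : ℤ)]
        exact mul_mem_fil (single_mem_fil _ _) (mem_fil_zero_iff.mpr ⟨_, rfl⟩)
    obtain ⟨h, hh⟩ := mem_fil_zero_iff.mp hm
    exact ⟨h, by rw [hh, mul_inv_cancel_left₀ hτ0, add_sub_cancel]⟩
  choose F hF using hstep
  -- The preimage has as coefficients the digits of the τ-adic expansion of g, pulled back to
  -- constants by s.
  have key : ∀ (n : ℕ) (g : PowerSeries k),
      α (HahnSeries.ofPowerSeries ℤ k (PowerSeries.mk fun i =>
        s (PowerSeries.constantCoeff (F^[i] g)))) - HahnSeries.ofPowerSeries ℤ k g ∈ fil k n := by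
    intro n
    induction n with
    | zero =>
      intro g
      exact sub_mem (map_mem_fil_zero p α (mem_fil_zero_iff.mpr ⟨_, rfl⟩))
        (mem_fil_zero_iff.mpr ⟨_, rfl⟩)
    | succ n ih =>
      intro g
      have e : (PowerSeries.mk fun i => s (PowerSeries.constantCoeff (F^[i] g))) =
          PowerSeries.X * (PowerSeries.mk fun i => s (PowerSeries.constantCoeff (F^[i] (F g)))) +
            PowerSeries.C (s (PowerSeries.constantCoeff g)) := by
        rw [PowerSeries.eq_X_mul_shift_add_const
          (PowerSeries.mk fun i => s (PowerSeries.constantCoeff (F^[i] g)))]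
        simp
      rw [e, hF g, map_add, map_add, map_mul, map_mul, HahnSeries.ofPowerSeries_X,
        HahnSeries.ofPowerSeries_C, hs, ← hτ, add_comm (HahnSeries.C _),
        add_sub_add_right_eq_sub, ← mul_sub, Nat.cast_succ, add_comm]
      exact mul_mem_fil ((mem_fil_iff_le_order hτ0).mpr h1.ge) (ih _)
  have key2 : ∀ g ∈ fil k 0, ∃ f, α f = g := by
    intro g hg
    obtain ⟨P, rfl⟩ := mem_fil_zero_iff.mp hg
    exact ⟨_, sub_eq_zero.mp (eq_zero_of_mem_fil fun n => key n P)⟩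
  intro g
  by_cases hg : g = 0
  · exact ⟨0, by rw [hg, map_zero]⟩
  obtain ⟨f, hf⟩ := key2 (τ ^ (-g.order) * g) (by
    rw [mem_fil_iff_le_order (mul_ne_zero (zpow_ne_zero _ hτ0) hg),
      HahnSeries.order_mul (zpow_ne_zero _ hτ0) hg, order_zpow hτ0, h1]
    simp)
  refine ⟨HahnSeries.single 1 1 ^ g.order * f, ?_⟩
  rw [map_mul, map_zpow₀, ← hτ, hf, ← mul_assoc, ← zpow_add₀ hτ0, add_neg_cancel, zpow_zero,
    one_mul]

end roots

/-! ### Frobenius and p-th powers in k((t)) -/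

section frobenius

variable {k : Type*} [Field k]

/-- The action of a ring homomorphism on coefficients. -/
def mapCoeff (σ : k →+* k) : LaurentSeries k →+* LaurentSeries k where
  toFun f := f.map σ
  map_one' := by ext i; simp [HahnSeries.coeff_one, apply_ite σ]
  map_mul' f g := HahnSeries.map_mul σ.toNonUnitalRingHom
  map_zero' := by ext i; simp
  map_add' f g := by ext i; simp

@[simp] theorem coeff_mapCoeff (σ : k →+* k) (f : LaurentSeries k) (i : ℤ) :
    (mapCoeff σ f).coeff i = σ (f.coeff i) := rfl

instance (p : ℕ) [CharP k p] : CharP (LaurentSeries k) p :=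
  charP_of_injective_ringHom (HahnSeries.C_injective (Γ := ℤ) (R := k)) p

/-- The substitution `t ↦ t ^ p`. -/
noncomputable def expand (k : Type*) [Field k] {p : ℕ}
    (hp : 0 < p) : LaurentSeries k →+* LaurentSeries k :=
  HahnSeries.embDomainRingHom (R := k) (AddMonoidHom.mulLeft (p : ℤ))
    (fun _ _ h => mul_left_cancel₀ (Int.natCast_ne_zero.mpr hp.ne') h)
    (fun _ _ => mul_le_mul_iff_right₀ (Int.natCast_pos.mpr hp))

theorem coeff_expand {p : ℕ} (hp : 0 < p) (f : LaurentSeries k) (i : ℤ) :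
    (expand k hp f).coeff (p * i) = f.coeff i :=
  HahnSeries.embDomain_coeff

theorem coeff_expand_of_not_dvd {p : ℕ} (hp : 0 < p) (f : LaurentSeries k) {i : ℤ}
    (hi : ¬ (p : ℤ) ∣ i) : (expand k hp f).coeff i = 0 :=
  HahnSeries.embDomain_of_notMem_range (by
    rintro ⟨j, hj⟩
    exact hi ⟨j, hj.symm⟩)

/-- Frobenius and the composite of the two substitutions agree on constants and on t, which is
enough by `ringHom_ext`. -/
theorem pow_eq_expand [IsAlgClosed k] (p : ℕ) [hp : Fact p.Prime] [CharP k p]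
    (f : LaurentSeries k) : f ^ p = expand k hp.out.pos (mapCoeff (frobenius k p) f) := by
  have : frobenius (LaurentSeries k) p =
      (expand k hp.out.pos).comp (mapCoeff (frobenius k p)) := by
    refine ringHom_ext p (fun c => ?_) ?_ ?_
    · rw [frobenius_def, ← map_pow, RingHom.comp_apply]
      have : mapCoeff (frobenius k p) (HahnSeries.C c) = HahnSeries.C (c ^ p) := by
        ext i
        rw [coeff_mapCoeff, HahnSeries.C_apply, HahnSeries.C_apply, HahnSeries.coeff_single,
          HahnSeries.coeff_single]
        split_ifs <;> simp [frobenius_def, hp.out.ne_zero]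
      rw [this]
      exact HahnSeries.embDomainRingHom_C.symm
    · have : mapCoeff (frobenius k p) (HahnSeries.single 1 1) = HahnSeries.single 1 1 := by
        ext i
        rw [coeff_mapCoeff, HahnSeries.coeff_single]
        split_ifs <;> simp
      rw [RingHom.comp_apply, this, frobenius_def, HahnSeries.single_pow]
      refine Eq.trans ?_ HahnSeries.embDomain_single.symm
      simp
    · rw [frobenius_def, HahnSeries.single_pow, one_pow, nsmul_one]
      intro i hi
      have := hp.out.pos
      rw [HahnSeries.coeff_single_of_ne (by omega)]
  exact DFunLike.congr_fun this f

variable [IsAlgClosed k] (p : ℕ) [hp : Fact p.Prime] [CharP k p]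

theorem coeff_pow_mul (f : LaurentSeries k) (i : ℤ) : (f ^ p).coeff (p * i) = f.coeff i ^ p := by
  rw [pow_eq_expand, coeff_expand, coeff_mapCoeff, frobenius_def]

theorem coeff_pow_of_not_dvd (f : LaurentSeries k) {i : ℤ} (hi : ¬ (p : ℤ) ∣ i) :
    (f ^ p).coeff i = 0 := by
  rw [pow_eq_expand, coeff_expand_of_not_dvd _ _ hi]

/-- A Laurent series is the sum of a `p`-th power and a series with exponents prime to `p`. -/
theorem exists_eq_pow_add (f : LaurentSeries k) : ∃ g r : LaurentSeries k, f = g ^ p + r ∧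
    (∀ i, (p : ℤ) ∣ i → r.coeff i = 0) ∧ ∀ i, ¬ (p : ℤ) ∣ i → r.coeff i = f.coeff i := by
  have hp0 : (0 : ℤ) < p := by exact_mod_cast hp.out.pos
  choose s hs using fun c : k => IsAlgClosed.exists_pow_nat_eq c hp.out.pos
  have hs0 : s 0 = 0 := by simpa [hp.out.ne_zero] using hs 0
  let g : LaurentSeries k := HahnSeries.ofSuppBddBelow (fun i => s (f.coeff (p * i))) (by
    -- The bound 0 makes i negative, whence p i ≤ i < ord f.
    refine ⟨min f.order 0, fun i hi => ?_⟩
    by_contra hlt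
    refine hi ?_
    dsimp only
    rw [HahnSeries.coeff_eq_zero_of_lt_order, hs0]
    nlinarith [min_le_left f.order 0, min_le_right f.order 0])
  have hg : ∀ i, (g ^ p).coeff (p * i) = f.coeff (p * i) := fun i => by
    rw [coeff_pow_mul]
    exact hs _
  refine ⟨g, f - g ^ p, by ring, ?_, ?_⟩
  · rintro _ ⟨i, rfl⟩
    rw [HahnSeries.coeff_sub, hg, sub_self]
  · intro i hi
    rw [HahnSeries.coeff_sub, coeff_pow_of_not_dvd p g hi, sub_zero]

theorem exists_eq_pow_iff (f : LaurentSeries k) :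
    (∃ g, f = g ^ p) ↔ ∀ i, ¬ (p : ℤ) ∣ i → f.coeff i = 0 := by
  constructor
  · rintro ⟨g, rfl⟩ i hi
    exact coeff_pow_of_not_dvd p g hi
  · intro h
    obtain ⟨g, r, hf, h1, h2⟩ := exists_eq_pow_add p f
    refine ⟨g, ?_⟩
    have : r = 0 := by
      ext i
      by_cases hi : (p : ℤ) ∣ i
      · exact h1 i hi
      · rw [h2 i hi, h i hi, HahnSeries.coeff_zero]
    rw [hf, this, add_zero]

end frobenius

/-! ### Derivatives and logarithmic derivatives -/

section derivative

variable {k : Type*} [Field k]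

theorem coeff_derivative (f : LaurentSeries k) (i : ℤ) :
    (derivative k f).coeff i = (i + 1 : ℤ) * f.coeff (i + 1) := by
  simp [derivative_apply, hasseDeriv_coeff]

theorem coeff_single_one_mul (f : LaurentSeries k) (i : ℤ) :
    (HahnSeries.single 1 1 * f).coeff i = f.coeff (i - 1) := by
  have := HahnSeries.coeff_single_mul_add (r := (1 : k)) (x := f) (a := i - 1) (b := (1 : ℤ))
  rwa [sub_add_cancel, one_mul] at this

/-- The Euler operator θ = t d/dt multiplies the i-th coefficient by i, so the product rule for θ is
just n = i + j in the Cauchy product. -/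
theorem derivative_mul (f g : LaurentSeries k) :
    derivative k (f * g) = derivative k f * g + f * derivative k g := by
  set θ : LaurentSeries k → LaurentSeries k := fun f => HahnSeries.single 1 1 * derivative k f
    with hθ
  have hc : ∀ f i, (θ f).coeff i = (i : k) * f.coeff i := by
    intro f i
    rw [hθ, coeff_single_one_mul, coeff_derivative]
    simp
  have hs : ∀ f, (θ f).support ⊆ f.support := by
    intro f i hi h0
    rw [HahnSeries.mem_support, hc, h0, mul_zero] at hi
    exact hi rfl
  have key : θ (f * g) = θ f * g + f * θ g := by
    ext n
    rw [hc, HahnSeries.coeff_add, HahnSeries.coeff_mul_left' f.isPWO_support (hs f),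
      HahnSeries.coeff_mul_right' g.isPWO_support (hs g), HahnSeries.coeff_mul, Finset.mul_sum,
      ← Finset.sum_add_distrib]
    refine Finset.sum_congr rfl fun x hx => ?_
    obtain ⟨-, -, h⟩ := Finset.mem_antidiagonal.mp hx
    rw [hc, hc, ← h]
    push_cast
    ring
  refine mul_left_cancel₀ (single_ne_zero (k := k) 1) ?_
  rw [mul_add, mul_left_comm _ f, ← mul_assoc _ _ g]
  exact key

variable [IsAlgClosed k] (p : ℕ) [hp : Fact p.Prime] [CharP k p]

theorem derivative_eq_zero_iff (f : LaurentSeries k) :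
    derivative k f = 0 ↔ ∃ g, f = g ^ p := by
  rw [exists_eq_pow_iff, HahnSeries.ext_iff, funext_iff]
  simp only [coeff_derivative, HahnSeries.coeff_zero, mul_eq_zero, CharP.intCast_eq_zero_iff k p]
  constructor
  · intro h i hi
    have := h (i - 1)
    rw [sub_add_cancel] at this
    exact this.resolve_left hi
  · intro h i
    exact or_iff_not_imp_left.mpr (h _)

theorem derivative_pow (g : LaurentSeries k) : derivative k (g ^ p) = 0 :=
  (derivative_eq_zero_iff p _).mpr ⟨g, rfl⟩

/-- The logarithmic derivative is not changed by `p`-th powers. -/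
theorem derivative_mul_pow_div (f : LaurentSeries k) {g : LaurentSeries k} (hg : g ≠ 0) :
    derivative k (f * g ^ p) / (f * g ^ p) = derivative k f / f := by
  rw [derivative_mul, derivative_pow, mul_zero, add_zero,
    mul_div_mul_right _ _ (pow_ne_zero p hg)]

theorem mem_fil_derivative {f : LaurentSeries k} {n : ℤ} (hf : f ∈ fil k n) :
    derivative k f ∈ fil k (n - 1) := fun i hi => by
  rw [coeff_derivative, hf _ (by omega), mul_zero]

/-- The residue of the logarithmic derivative is the order. -/
theorem coeff_derivative_div {f : LaurentSeries k} (hf : f ≠ 0) :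
    (derivative k f / f).coeff (-1) = (f.order : k) := by
  -- The leading terms of f' and of (ord f) t⁻¹ f cancel, so after division by f nothing is left in
  -- degree -1.
  have hd : derivative k f - HahnSeries.single (-1) (f.order : k) * f ∈ fil k f.order := by
    intro i hi
    rw [HahnSeries.coeff_sub, coeff_derivative]
    have := HahnSeries.coeff_single_mul_add (r := (f.order : k)) (x := f) (a := i + 1)
      (b := (-1 : ℤ))
    rw [show i + 1 + -1 = i by ring] at this
    rw [this]
    rcases (show i + 1 ≤ f.order by omega).eq_or_lt with h | h
    · rw [h, sub_self]
    · rw [HahnSeries.coeff_eq_zero_of_lt_order h]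
      simp
  have h2 := mul_mem_fil hd ((mem_fil_iff_le_order (inv_ne_zero hf)).mpr (order_inv hf).ge)
  rw [add_neg_cancel, sub_mul, mul_assoc, mul_inv_cancel₀ hf, mul_one,
    ← div_eq_mul_inv] at h2
  have := h2 (-1) (by norm_num)
  rwa [HahnSeries.coeff_sub, sub_eq_zero, HahnSeries.coeff_single_same] at this

/-- If the order of `f` is prime to `p` then `df` has order one less. -/
theorem order_derivative {f : LaurentSeries k} (hf : ¬ (p : ℤ) ∣ f.order) :
    derivative k f ≠ 0 ∧ (derivative k f).order = f.order - 1 := by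
  -- By convention the zero series has order 0, which p divides.
  have hf0 : f ≠ 0 := by rintro rfl; simp at hf
  have h : (derivative k f).coeff (f.order - 1) ≠ 0 := by
    rw [coeff_derivative, sub_add_cancel]
    refine mul_ne_zero ?_ (HahnSeries.coeff_order_eq_zero.not.mpr hf0)
    rwa [Ne, CharP.intCast_eq_zero_iff k p]
  have hne : derivative k f ≠ 0 := by
    intro h0
    rw [h0] at h
    exact h rfl
  refine ⟨hne, le_antisymm (HahnSeries.order_le_of_coeff_ne_zero h) ?_⟩
  rw [← mem_fil_iff_le_order hne]
  exact mem_fil_derivative ((mem_fil_iff_le_order hf0).mpr le_rfl)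

theorem order_not_dvd {r : LaurentSeries k} (hr : r ≠ 0)
    (h : ∀ i, (p : ℤ) ∣ i → r.coeff i = 0) : ¬ (p : ℤ) ∣ r.order := fun hd =>
  HahnSeries.coeff_order_eq_zero.not.mpr hr (h _ hd)

/-- A Laurent series whose order is prime to `p` is a power of one of order `1`. -/
theorem exists_zpow_eq {f : LaurentSeries k} (hf : ¬ (p : ℤ) ∣ f.order) :
    ∃ g, g ≠ 0 ∧ g.order = 1 ∧ g ^ f.order = f := by
  have hf0 : f ≠ 0 := by rintro rfl; simp at hf
  obtain ⟨h, hh⟩ := exists_eq_single_mul f.order f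
  have hh0 : h ≠ 0 := by rintro rfl; simp at hh; exact hf0 hh
  have hho : h.order = 0 := by
    have := congrArg HahnSeries.order hh
    rw [HahnSeries.order_mul (single_ne_zero _) hh0, HahnSeries.order_single one_ne_zero] at this
    omega
  have hn : ((f.order.natAbs : ℕ) : k) ≠ 0 := by
    rwa [Ne, CharP.cast_eq_zero_iff k p, ← Int.natCast_dvd]
  have : ∃ g, g ^ f.order = h := by
    rcases f.order.natAbs_eq with h1 | h1
    · obtain ⟨g, hg⟩ := exists_pow_eq hn hh0 hho
      exact ⟨g, by rw [h1, zpow_natCast, hg]⟩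
    · obtain ⟨g, hg⟩ := exists_pow_eq hn (inv_ne_zero hh0) (by rw [order_inv hh0, hho, neg_zero])
      exact ⟨g, by rw [h1, zpow_neg, zpow_natCast, hg, inv_inv]⟩
  obtain ⟨g, hg⟩ := this
  have hm : f.order ≠ 0 := by
    intro h0
    rw [h0] at hf
    exact hf (dvd_zero _)
  have hg0 : g ≠ 0 := by
    rintro rfl
    rw [zero_zpow _ hm] at hg
    exact hh0 hg.symm
  have hgo : g.order = 0 := by
    have := order_zpow hg0 f.order
    rw [hg, hho] at this
    exact (mul_eq_zero.mp this.symm).resolve_left hm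
  refine ⟨HahnSeries.single 1 1 * g, mul_ne_zero (single_ne_zero _) hg0, ?_, ?_⟩
  · rw [HahnSeries.order_mul (single_ne_zero _) hg0, hgo, HahnSeries.order_single one_ne_zero,
      add_zero]
  · rw [mul_zpow, ← RatFunc.single_zpow, hg, ← hh]

end derivative

end LaurentSeries

/-! ### The degree of k((t)) over its p-th powers -/

section

section fields

/-- In a purely inseparable extension of degree `p`, all `p`-th powers lie in the base field. -/
theorem pow_mem_range_of_isPurelyInseparable {F E : Type*} [Field F] [Field E] [Algebra F E]
    (p : ℕ) [hp : Fact p.Prime] [ExpChar F p] [IsPurelyInseparable F E]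
    (hdeg : Module.finrank F E = p) (x : E) : ∃ a : F, algebraMap F E a = x ^ p := by
  have hfin : FiniteDimensional F E := Module.finite_of_finrank_pos (hdeg ▸ hp.out.pos)
  obtain ⟨n, y, hy⟩ := IsPurelyInseparable.minpoly_eq_X_pow_sub_C F p x
  have h1 : (minpoly F x).natDegree ∣ Module.finrank F E :=
    minpoly.degree_dvd (IsPurelyInseparable.isIntegral' F x)
  have h2 : (minpoly F x).natDegree = p ^ n := by
    rw [hy, Polynomial.natDegree_X_pow_sub_C]
  have h3 : x ^ p ^ n = algebraMap F E y := by
    have := minpoly.aeval F x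
    rw [hy] at this
    simpa [sub_eq_zero] using this
  rw [h2, hdeg] at h1
  have hn : n ≤ 1 := (Nat.pow_dvd_pow_iff_le_right hp.out.one_lt).mp (by simpa using h1)
  interval_cases n
  · exact ⟨y ^ p, by rw [map_pow, ← h3, pow_zero, pow_one]⟩
  · exact ⟨y, by rw [← h3, pow_one]⟩

/-- K has degree at most p over F, and E already has degree p, so the tower law leaves degree 1 for
K over E. This yields surjectivity of the Frobenius residue. -/
theorem surjective_of_span_eq_top {F E K : Type*} [Field F] [Field E] [Field K] [Algebra F E]
    {p : ℕ} (hp : 0 < p) (hdeg : Module.finrank F E = p) (g : E →+* K) (t : Fin p → K)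
    (ht : ∀ x : K, ∃ c : Fin p → F, x = ∑ i, g (algebraMap F E (c i)) * t i) :
    Function.Surjective g := by
  let _ := g.toAlgebra
  let _ := (g.comp (algebraMap F E)).toAlgebra
  have : IsScalarTower F E K := IsScalarTower.of_algebraMap_eq fun _ => rfl
  have hspan : Submodule.span F (Set.range t) = ⊤ := by
    refine eq_top_iff.mpr fun x _ => ?_
    obtain ⟨c, rfl⟩ := ht x
    refine Submodule.sum_mem _ fun i _ => ?_
    have : g (algebraMap F E (c i)) * t i = c i • t i := (Algebra.smul_def (c i) (t i)).symm
    rw [this]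
    exact Submodule.smul_mem _ _ (Submodule.subset_span ⟨i, rfl⟩)
  have h1 : Module.finrank F K ≤ p := by
    have := finrank_range_le_card (R := F) t
    rw [Set.finrank, hspan, finrank_top, Fintype.card_fin] at this
    exact this
  have hfin : Module.Finite F K :=
    Module.finite_def.mpr (hspan ▸ Submodule.fg_span (Set.finite_range t))
  have hfin2 : Module.Finite E K := Module.Finite.of_restrictScalars_finite F E K
  have h2 := Module.finrank_mul_finrank F E K
  have h3 : 0 < Module.finrank E K := Module.finrank_pos
  rw [hdeg] at h2
  have h4 : Module.finrank E K = 1 := by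
    by_contra hne
    have : 2 ≤ Module.finrank E K := by omega
    nlinarith
  intro x
  obtain ⟨c, hc⟩ := (finrank_eq_one_iff_of_nonzero' (1 : K) one_ne_zero).mp h4 x
  exact ⟨c, by rw [← hc, Algebra.smul_def, mul_one]; rfl⟩

/-- Exponents are sorted by their class i modulo p; the i-th part is t ^ i times the p-th power part
of t ^ (-i) f. -/
theorem LaurentSeries.exists_eq_sum_pow {k : Type*} [Field k] [IsAlgClosed k] (p : ℕ)
    [hp : Fact p.Prime] [CharP k p] (f : LaurentSeries k) :
    ∃ c : Fin p → LaurentSeries k, f = ∑ i, c i ^ p * HahnSeries.single ((i : ℕ) : ℤ) 1 := by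
  choose g r hgr h1 h2 using fun i : Fin p =>
    exists_eq_pow_add p (HahnSeries.single (-((i : ℕ) : ℤ)) 1 * f)
  refine ⟨g, ?_⟩
  ext n
  have hp0 : (0 : ℤ) < p := by exact_mod_cast hp.out.pos
  have hs : ∀ i : Fin p, (g i ^ p * HahnSeries.single ((i : ℕ) : ℤ) 1).coeff n =
      (g i ^ p).coeff (n - i) := fun i => by
    have := HahnSeries.coeff_mul_single_add (r := (1 : k)) (x := g i ^ p) (a := n - i)
      (b := ((i : ℕ) : ℤ))
    rwa [sub_add_cancel, mul_one] at this
  have hs' : ∀ i : Fin p, (HahnSeries.single (-((i : ℕ) : ℤ)) 1 * f).coeff (n - i) =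
      f.coeff n := fun i => by
    have := HahnSeries.coeff_single_mul_add (r := (1 : k)) (x := f) (a := n)
      (b := -((i : ℕ) : ℤ))
    rwa [one_mul] at this
  obtain ⟨m, hm⟩ : ∃ m : ℕ, (m : ℤ) = n % p :=
    ⟨(n % p).toNat, Int.toNat_of_nonneg (Int.emod_nonneg _ hp0.ne')⟩
  have hmp : m < p := by
    have := Int.emod_lt_of_pos n hp0
    omega
  rw [HahnSeries.coeff_sum, Finset.sum_eq_single ⟨m, hmp⟩]
  · rw [hs, ← hs' ⟨m, hmp⟩, hgr, HahnSeries.coeff_add, h1, add_zero]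
    rw [hm]
    exact Int.dvd_self_sub_emod
  · intro i _ hi
    rw [hs]
    refine coeff_pow_of_not_dvd p _ fun hd => hi ?_
    have h3 : (p : ℤ) ∣ n - m := hm ▸ Int.dvd_self_sub_emod
    have h4 : ((i : ℕ) : ℤ) - m = 0 := by
      refine Int.eq_zero_of_abs_lt_dvd (m := p) ?_ ?_
      · simpa using dvd_sub h3 hd
      · have := i.2
        rw [abs_lt]
        omega
    exact Fin.ext (by simp only; omega)
  · simp

end fields

open BoundarySeries IsLocalRing

/-! ### The weak topology on finite free algebras -/

section basis

variable {R : Type*} [CommRing R] [IsLocalRing R] [IsAdicComplete (maximalIdeal R) R]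
  {B : Type*} [CommRing B] [Algebra R B] [Algebra (BoundarySeries R) B]
  [IsScalarTower R (BoundarySeries R) B] {ι : Type*} [Fintype ι]
  (v : Module.Basis ι (BoundarySeries R) B)

/-- The elements all of whose coordinates have coefficients of index `< L` in `𝔪 ^ N`. -/
def basisSmall (N : ℕ) (L : ℤ) : Submodule R B where
  carrier := {x | ∀ i, v.repr x i ∈ small N L}
  add_mem' hx hy i := by
    rw [map_add]
    exact add_mem (hx i) (hy i)
  zero_mem' i := by
    rw [map_zero]
    exact zero_mem _
  smul_mem' r x hx i := by
    rw [← algebraMap_smul (BoundarySeries R) r x, map_smul, Finsupp.smul_apply, smul_eq_mul,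
      ← Algebra.smul_def]
    exact Submodule.smul_mem _ _ (hx i)

theorem mem_basisSmall {N : ℕ} {L : ℤ} {x : B} :
    x ∈ basisSmall v N L ↔ ∀ i, v.repr x i ∈ small N L := Iff.rfl

theorem basisSmall_anti {N : ℕ} {L L' : ℤ} (h : L ≤ L') : basisSmall v N L' ≤ basisSmall v N L :=
  fun _ hx i => small_anti h (hx i)

theorem exists_mem_basisSmall (x : B) (N : ℕ) : ∃ L, x ∈ basisSmall v N L := by
  choose L hL using fun i => exists_mem_small (v.repr x i) N
  obtain ⟨M, hM⟩ := (Set.finite_range L).bddBelow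
  exact ⟨M, fun i => small_anti (hM ⟨i, rfl⟩) (hL i)⟩

theorem smul_mem_basisSmall {N : ℕ} {L M : ℤ} {a : BoundarySeries R} {x : B}
    (ha : a ∈ small N L) (hx : x ∈ basisSmall v N M) : a • x ∈ basisSmall v N (L + M) := fun i => by
  rw [map_smul, Finsupp.smul_apply, smul_eq_mul]
  exact mul_mem_small ha (hx i)

/-- The defect H, possibly negative, is a common lower bound for the finitely many structure
constants v i * v j. -/
theorem exists_mul_mem_basisSmall (N : ℕ) : ∃ H : ℤ, ∀ (L M : ℤ) (x y : B),
    x ∈ basisSmall v N L → y ∈ basisSmall v N M → x * y ∈ basisSmall v N (L + M + H) := by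
  choose L hL using fun ij : ι × ι => exists_mem_basisSmall v (v ij.1 * v ij.2) N
  obtain ⟨H, hH⟩ := (Set.finite_range L).bddBelow
  refine ⟨H, fun L' M' x y hx hy => ?_⟩
  rw [← v.sum_repr x, ← v.sum_repr y, Finset.sum_mul_sum]
  refine sum_mem fun i _ => sum_mem fun j _ => ?_
  rw [smul_mul_smul_comm]
  exact smul_mem_basisSmall v (mul_mem_small (hx i) (hy j))
    (basisSmall_anti v (hH ⟨(i, j), rfl⟩) (hL (i, j)))

theorem eq_zero_of_mem_basisSmall {x : B} (h : ∀ N L, x ∈ basisSmall v N L) : x = 0 := by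
  refine v.repr.map_eq_zero_iff.mp (Finsupp.ext fun i => ?_)
  exact eq_zero_of_mem_small fun N L => h N L i

theorem exists_limit_of_basis (s : ℕ → B)
    (hs : ∀ N L, ∃ n₀, ∀ n ≥ n₀, s n - s n₀ ∈ basisSmall v N L) :
    ∃ x, ∀ N L, ∃ n₀, ∀ n ≥ n₀, s n - x ∈ basisSmall v N L := by
  choose f hf using fun i => exists_limit (fun n => v.repr (s n) i) fun N L => by
    obtain ⟨n₀, h⟩ := hs N L
    refine ⟨n₀, fun n hn => ?_⟩
    have := h n hn i
    rwa [map_sub, Finsupp.sub_apply] at this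
  refine ⟨v.equivFun.symm f, fun N L => ?_⟩
  choose n₀ hn₀ using fun i => hf i N L
  obtain ⟨M, hM⟩ := (Set.finite_range n₀).bddAbove
  refine ⟨M, fun n hn i => ?_⟩
  rw [map_sub, Finsupp.sub_apply, ← v.equivFun_apply (v.equivFun.symm f),
    LinearEquiv.apply_symm_apply]
  exact hn₀ i n ((hM ⟨i, rfl⟩).trans hn)

theorem dvd_iff_forall_repr (a : BoundarySeries R) (x : B) :
    algebraMap (BoundarySeries R) B a ∣ x ↔ ∀ i, a ∣ v.repr x i := by
  constructor
  · rintro ⟨y, rfl⟩ i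
    rw [← Algebra.smul_def, map_smul, Finsupp.smul_apply, smul_eq_mul]
    exact dvd_mul_right _ _
  · intro h
    choose c hc using h
    refine ⟨∑ i, c i • v i, ?_⟩
    rw [← Algebra.smul_def, Finset.smul_sum]
    nth_rewrite 1 [← v.sum_repr x]
    exact Finset.sum_congr rfl fun i _ => by rw [hc i, mul_smul]

theorem isAdicComplete_of_basis (v : Module.Basis ι (BoundarySeries R) B) {ϖ : BoundarySeries R}
    [hA : IsAdicComplete (Ideal.span {ϖ}) (BoundarySeries R)] :
    IsAdicComplete (Ideal.span {algebraMap (BoundarySeries R) B ϖ}) B where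
  haus' x hx := by
    refine v.repr.map_eq_zero_iff.mp (Finsupp.ext fun i => ?_)
    refine IsHausdorff.haus (I := Ideal.span {ϖ}) inferInstance _ fun N => ?_
    have := hx N
    rw [SModEq.zero, smul_eq_mul, Ideal.mul_top, Ideal.span_singleton_pow,
      Ideal.mem_span_singleton, ← map_pow, dvd_iff_forall_repr v] at this
    rw [SModEq.zero, smul_eq_mul, Ideal.mul_top, Ideal.span_singleton_pow,
      Ideal.mem_span_singleton]
    exact this i
  prec' s hs := by
    have h1 : ∀ {m n}, m ≤ n → ∀ i, ϖ ^ m ∣ v.repr (s m) i - v.repr (s n) i := by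
      intro m n hmn i
      have := hs hmn
      rw [SModEq.sub_mem, smul_eq_mul, Ideal.mul_top, Ideal.span_singleton_pow,
        Ideal.mem_span_singleton, ← map_pow, dvd_iff_forall_repr v] at this
      simpa using this i
    choose f hf using fun i => IsPrecomplete.prec (I := Ideal.span {ϖ}) inferInstance
      (f := fun n => v.repr (s n) i) fun {m n} hmn => by
        rw [SModEq.sub_mem, smul_eq_mul, Ideal.mul_top, Ideal.span_singleton_pow,
          Ideal.mem_span_singleton]
        exact h1 hmn i
    refine ⟨v.equivFun.symm f, fun n => ?_⟩
    rw [SModEq.sub_mem, smul_eq_mul, Ideal.mul_top, Ideal.span_singleton_pow,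
      Ideal.mem_span_singleton, ← map_pow, dvd_iff_forall_repr v]
    intro i
    rw [map_sub, Finsupp.sub_apply, ← v.equivFun_apply (v.equivFun.symm f),
      LinearEquiv.apply_symm_apply]
    have := hf i n
    rwa [SModEq.sub_mem, smul_eq_mul, Ideal.mul_top, Ideal.span_singleton_pow,
      Ideal.mem_span_singleton] at this

end basis

end

/-! ### The special fibre and the Frobenius residue -/

section

open BoundarySeries IsLocalRing

namespace SpecialFiber

variable {R S : Type*} [CommRing R] [IsDomain R] [IsDiscreteValuationRing R] [CommRing S]
  [Algebra R S] {π : R}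

theorem map_maximalIdeal (hπ : Irreducible π) :
    (maximalIdeal R).map (algebraMap R S) = Ideal.span {algebraMap R S π} := by
  rw [hπ.maximalIdeal_eq, Ideal.map_span, Set.image_singleton]

theorem mk_surjective : Function.Surjective (mk R (S := S)) := Ideal.Quotient.mk_surjective

theorem mk_eq_zero_iff (hπ : Irreducible π) {x : S} : mk R x = 0 ↔ algebraMap R S π ∣ x := by
  rw [← Ideal.mem_span_singleton, ← map_maximalIdeal hπ]
  exact Ideal.Quotient.eq_zero_iff_mem

theorem mk_eq_mk_iff (hπ : Irreducible π) {x y : S} :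
    mk R x = mk R y ↔ algebraMap R S π ∣ x - y := by
  rw [← mk_eq_zero_iff hπ, map_sub, sub_eq_zero]

theorem isField_quotient (hπ : Irreducible π) (h : IsField (SpecialFiber R S)) :
    IsField (S ⧸ Ideal.span {algebraMap R S π}) := by
  rw [← map_maximalIdeal hπ]
  exact h

/-- Ring homomorphisms out of the special fibre. -/
def lift {T : Type*} [CommRing T] (hπ : Irreducible π) (φ : S →+* T)
    (h : φ (algebraMap R S π) = 0) : SpecialFiber R S →+* T :=
  Ideal.Quotient.lift _ φ fun x hx => by
    rw [map_maximalIdeal hπ, Ideal.mem_span_singleton] at hx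
    obtain ⟨y, rfl⟩ := hx
    rw [map_mul, h, zero_mul]

theorem algebraMap_mk {A B : Type*} [CommRing A] [CommRing B] [Algebra R A]
    [Algebra R B] [Algebra A B] [IsScalarTower R A B] (a : A) :
    algebraMap (SpecialFiber R A) (SpecialFiber R B) (mk R a) = mk R (algebraMap A B a) := rfl

end SpecialFiber

section

variable {R : Type*} [CommRing R] [IsDomain R] [IsDiscreteValuationRing R]
  [IsAdicComplete (maximalIdeal R) R]
  {B : Type*} [CommRing B] [Algebra R B] [Algebra (BoundarySeries R) B]
  [IsScalarTower R (BoundarySeries R) B]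

/-- A nonzero series is a power of π times a unit, so any torsion is π-torsion, which flatness over
R excludes. -/
theorem isTorsionFree_of_flat [Module.Flat R B] : Module.IsTorsionFree (BoundarySeries R) B := by
  obtain ⟨π, hπ⟩ := IsDiscreteValuationRing.exists_irreducible R
  have := isAdicComplete hπ
  refine Module.isTorsionFree_iff_smul_eq_zero.mpr fun a x hax =>
    or_iff_not_imp_left.mpr fun ha => ?_
  obtain ⟨n, u, rfl, hu⟩ := exists_eq_pow_mul_of_isHausdorff (ϖ := algebraMap R _ π) ha
  have hu := isUnit_of_not_dvd_of_isField (BoundarySeries.isField_quotient hπ) hu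
  rw [mul_comm, mul_smul] at hax
  have h1 := hu.smul_eq_zero.mp hax
  rw [← map_pow, algebraMap_smul] at h1
  exact (smul_eq_zero.mp h1).resolve_left (pow_ne_zero _ hπ.ne_zero)

/-- `Φ b` is the reduction of `b ^ p`, viewed in the residue field `k((t))` of `R[[T]]{T⁻¹}`. -/
structure IsFrobeniusResidue (π : R) (p : ℕ) (Φ : B →+* LaurentSeries (ResidueField R)) :
    Prop where
  surjective : Function.Surjective Φ
  eq_zero_iff (b : B) : Φ b = 0 ↔ algebraMap R B π ∣ b
  map_algebraMap (a : BoundarySeries R) : Φ (algebraMap _ B a) = residue a ^ p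

variable {p : ℕ} [hp : Fact p.Prime] [IsAlgClosed (ResidueField R)] [CharP (ResidueField R) p]
  {π : R}

/-- The p-th power map on the special fibre of B is a ring homomorphism in characteristic p and
lands in the special fibre of A. It is injective since the fibre is a field, and onto by comparing
degrees: 1, t, …, t ^ (p - 1) span k((t)) over its p-th powers. -/
theorem exists_isFrobeniusResidue (hπ : Irreducible π)
    (hfield : IsField (SpecialFiber R B))
    (hinsep : IsPurelyInseparable (SpecialFiber R (BoundarySeries R)) (SpecialFiber R B))
    (hdeg : Module.finrank (SpecialFiber R (BoundarySeries R)) (SpecialFiber R B) = p) :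
    ∃ Φ : B →+* LaurentSeries (ResidueField R), IsFrobeniusResidue π p Φ := by
  have hA : IsField (SpecialFiber R (BoundarySeries R)) := by
    have := BoundarySeries.isField_quotient hπ
    rwa [← SpecialFiber.map_maximalIdeal hπ] at this
  let _ : Field (SpecialFiber R (BoundarySeries R)) := hA.toField
  let _ : Field (SpecialFiber R B) := hfield.toField
  let ψ : SpecialFiber R (BoundarySeries R) →+* LaurentSeries (ResidueField R) :=
    SpecialFiber.lift hπ residue ((residue_eq_zero_iff hπ _).mpr dvd_rfl)
  have hψ : ∀ a, ψ (SpecialFiber.mk R a) = residue a := fun a => rfl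
  have hchar : CharP (SpecialFiber R (BoundarySeries R)) p :=
    (RingHom.charP_iff ψ ψ.injective p).mpr inferInstance
  have hcharB : CharP (SpecialFiber R B) p :=
    charP_of_injective_algebraMap
      (algebraMap (SpecialFiber R (BoundarySeries R)) (SpecialFiber R B)).injective p
  have : ExpChar (SpecialFiber R (BoundarySeries R)) p := ExpChar.prime hp.out
  choose r hr using pow_mem_range_of_isPurelyInseparable p hdeg
  let Φ' : SpecialFiber R B →+* SpecialFiber R (BoundarySeries R) :=
    { toFun := r
      map_one' := (algebraMap _ (SpecialFiber R B)).injective (by rw [hr, one_pow, map_one])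
      map_mul' := fun x y => (algebraMap _ (SpecialFiber R B)).injective (by
        rw [map_mul, hr, hr, hr, mul_pow])
      map_zero' := (algebraMap _ (SpecialFiber R B)).injective (by
        rw [hr, map_zero, zero_pow hp.out.ne_zero])
      map_add' := fun x y => (algebraMap _ (SpecialFiber R B)).injective (by
        rw [map_add, hr, hr, hr, add_pow_char]) }
  have hΦ' : ∀ a, Φ' (algebraMap _ _ a) = a ^ p := fun a =>
    (algebraMap _ (SpecialFiber R B)).injective ((hr _).trans (map_pow _ _ _).symm)
  refine ⟨(ψ.comp Φ').comp (SpecialFiber.mk R), ?_, fun b => ?_, fun a => ?_⟩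
  · rw [RingHom.coe_comp]
    refine Function.Surjective.comp ?_ SpecialFiber.mk_surjective
    refine surjective_of_span_eq_top hp.out.pos hdeg (ψ.comp Φ')
      (fun i : Fin p => HahnSeries.single ((i : ℕ) : ℤ) 1) fun f => ?_
    obtain ⟨c, hc⟩ := LaurentSeries.exists_eq_sum_pow p f
    choose a ha using fun i => residue_surjective (c i)
    refine ⟨fun i => SpecialFiber.mk R (a i), hc.trans (Finset.sum_congr rfl fun i _ => ?_)⟩
    rw [RingHom.comp_apply, hΦ', map_pow, hψ, ha]
  · rw [RingHom.comp_apply, map_eq_zero, SpecialFiber.mk_eq_zero_iff hπ]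
  · rw [RingHom.comp_apply, RingHom.comp_apply, ← SpecialFiber.algebraMap_mk, hΦ', map_pow, hψ]

namespace IsFrobeniusResidue

variable {Φ : B →+* LaurentSeries (ResidueField R)} (hΦ : IsFrobeniusResidue π p Φ)

theorem eq_iff (hΦ : IsFrobeniusResidue π p Φ) {x y : B} :
    Φ x = Φ y ↔ algebraMap R B π ∣ x - y := by
  rw [← hΦ.eq_zero_iff, map_sub, sub_eq_zero]

theorem dvd_pow_sub (hΦ : IsFrobeniusResidue π p Φ) {b : B} {a : BoundarySeries R} :
    algebraMap R B π ∣ b ^ p - algebraMap _ B a ↔ Φ b = residue a := by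
  rw [← hΦ.eq_iff, map_pow, hΦ.map_algebraMap]
  exact frobenius_inj (LaurentSeries (ResidueField R)) p |>.eq_iff

/-- Automorphisms act trivially on the special fibre. -/
theorem map_algEquiv (hΦ : IsFrobeniusResidue π p Φ) (σ : B ≃ₐ[BoundarySeries R] B) (b : B) :
    Φ (σ b) = Φ b := by
  obtain ⟨a, ha⟩ := residue_surjective (Φ b)
  -- The congruence b ^ p ≡ a modulo π is preserved by σ, which fixes a and π, and it determines Φ
  -- b.
  have h1 := map_dvd σ (hΦ.dvd_pow_sub.mpr ha.symm)
  rw [map_sub, map_pow, σ.commutes, IsScalarTower.algebraMap_apply R (BoundarySeries R) B,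
    σ.commutes, ← IsScalarTower.algebraMap_apply, hΦ.dvd_pow_sub] at h1
  rw [h1, ha]

theorem map_const (hΦ : IsFrobeniusResidue π p Φ) (r : R) :
    Φ (algebraMap R B r) = HahnSeries.C (IsLocalRing.residue R r ^ p) := by
  rw [IsScalarTower.algebraMap_apply R (BoundarySeries R) B, hΦ.map_algebraMap, map_pow]
  congr 1
  ext i
  rw [residue_coeff, BoundarySeries.algebraMap_apply, coeff_const, HahnSeries.C_apply,
    HahnSeries.coeff_single]
  split_ifs <;> simp

/-- The special fibre of `B` is identified with `k((t))` through `Φ`. -/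
noncomputable def specialFiberEquiv (hΦ : IsFrobeniusResidue π p Φ) (hπ : Irreducible π) :
    SpecialFiber R B ≃+* LaurentSeries (ResidueField R) :=
  RingEquiv.ofBijective
    (SpecialFiber.lift hπ Φ ((hΦ.eq_zero_iff _).mpr dvd_rfl)) (by
    constructor
    · rw [injective_iff_map_eq_zero]
      intro x hx
      obtain ⟨b, rfl⟩ := SpecialFiber.mk_surjective (R := R) x
      exact (SpecialFiber.mk_eq_zero_iff hπ).mpr ((hΦ.eq_zero_iff b).mp hx)
    · intro f
      obtain ⟨b, hb⟩ := hΦ.surjective f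
      exact ⟨SpecialFiber.mk R b, hb⟩)

theorem specialFiberEquiv_mk (hΦ : IsFrobeniusResidue π p Φ) (hπ : Irreducible π) (b : B) :
    hΦ.specialFiberEquiv hπ (SpecialFiber.mk R b) = Φ b := rfl

/-- On constants Φ is the Frobenius of k, so it is not k-linear. Since k is perfect, the twist can
be undone on coefficients. -/
theorem exists_isResidueParameter (hΦ : IsFrobeniusResidue π p Φ) (hπ : Irreducible π) :
    ∃ z : SpecialFiber R B, IsResidueParameter R z := by
  have hbij : Function.Bijective
      (LaurentSeries.mapCoeff (frobenius (ResidueField R) p)) := by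
    refine ⟨RingHom.injective _, fun f => ?_⟩
    choose s hs using fun c : ResidueField R => IsAlgClosed.exists_pow_nat_eq c hp.out.pos
    have hs0 : s 0 = 0 := by simpa [hp.out.ne_zero] using hs 0
    refine ⟨f.map (⟨s, hs0⟩ : ZeroHom _ _), ?_⟩
    ext i
    exact hs _
  let e := (RingEquiv.ofBijective _ hbij).trans (hΦ.specialFiberEquiv hπ).symm
  refine ⟨_, e, rfl, fun r => ?_⟩
  apply (hΦ.specialFiberEquiv hπ).injective
  rw [specialFiberEquiv_mk, hΦ.map_const]
  refine ((hΦ.specialFiberEquiv hπ).apply_symm_apply _).trans ?_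
  change LaurentSeries.mapCoeff _ _ = _
  ext i
  rw [LaurentSeries.coeff_mapCoeff, HahnSeries.C_apply, HahnSeries.C_apply,
    HahnSeries.coeff_single, HahnSeries.coeff_single]
  split_ifs <;> simp [frobenius_def, hp.out.ne_zero]

theorem order_eq_one (hΦ : IsFrobeniusResidue π p Φ) (hπ : Irreducible π) {Z : B}
    (hZ : IsResidueParameter R (SpecialFiber.mk R Z)) : (Φ Z).order = 1 := by
  obtain ⟨e, he, -⟩ := hZ
  have := LaurentSeries.order_map_single_of_surjective p
    (α := (e.trans (hΦ.specialFiberEquiv hπ)).toRingHom) (RingEquiv.surjective _)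
  rw [← this, ← hΦ.specialFiberEquiv_mk hπ, ← he]
  rfl

end IsFrobeniusResidue

end

end

/-! ### Laurent polynomials and substitution of a unit for T -/

section

open BoundarySeries IsLocalRing

namespace BoundarySeries

variable {R : Type*} [CommRing R] [IsLocalRing R] [IsAdicComplete (maximalIdeal R) R]

theorem coeff_T_mul (f : BoundarySeries R) (i : ℤ) : (T * f).coeff i = f.coeff (i - 1) := by
  rw [← sub_eq_zero]
  refine IsHausdorff.haus (I := maximalIdeal R) inferInstance _ fun N => ?_
  have hT : modPow N (T : BoundarySeries R) = HahnSeries.single 1 1 := by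
    ext j
    rw [modPow_coeff, HahnSeries.coeff_single, T]
    dsimp only
    split_ifs <;> simp
  rw [SModEq.zero, smul_eq_mul, Ideal.mul_top, ← Ideal.Quotient.eq, ← modPow_coeff, modPow_mul, hT]
  have := HahnSeries.coeff_single_mul_add (r := (1 : R ⧸ maximalIdeal R ^ N)) (x := modPow N f)
    (a := i - 1) (b := (1 : ℤ))
  rwa [sub_add_cancel, one_mul] at this

/-- The power `T ^ n`, `n ∈ ℤ`. -/
def monomial (n : ℤ) : BoundarySeries R where
  coeff i := if i = n then 1 else 0
  tendsto_zero _ := ⟨n, fun i hi => by rw [if_neg hi.ne]; exact zero_mem _⟩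

theorem coeff_monomial (n i : ℤ) :
    (monomial n : BoundarySeries R).coeff i = if i = n then 1 else 0 := rfl

theorem T_mul_monomial (n : ℤ) : (T * monomial n : BoundarySeries R) = monomial (n + 1) := by
  ext i
  rw [coeff_T_mul, coeff_monomial, coeff_monomial]
  simp only [sub_eq_iff_eq_add]

/-- The variable as a unit. -/
noncomputable def unitT (R : Type*) [CommRing R] [IsLocalRing R]
    [IsAdicComplete (maximalIdeal R) R] :
    (BoundarySeries R)ˣ :=
  Units.mkOfMulEqOne T (monomial (-1)) (by rw [T_mul_monomial]; rfl)

theorem unitT_zpow (n : ℤ) : ((unitT R ^ n : (BoundarySeries R)ˣ) : BoundarySeries R) =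
    monomial n := by
  have h : ∀ n : ℤ, ((unitT R ^ n : (BoundarySeries R)ˣ) : BoundarySeries R) = monomial n ↔
      ((unitT R ^ (n + 1) : (BoundarySeries R)ˣ) : BoundarySeries R) = monomial (n + 1) := by
    intro n
    rw [zpow_add_one, mul_comm, Units.val_mul, ← T_mul_monomial]
    exact ((unitT R).mul_right_inj).symm
  induction n using Int.induction_on with
  | zero => rfl
  | succ i ih => exact (h _).mp ih
  | pred i ih => exact (h _).mpr (by rwa [sub_add_cancel])

/-- Truncations of a series, as Laurent polynomials. -/
noncomputable def trunc (n : ℕ) (f : BoundarySeries R) : AddMonoidAlgebra R ℤ :=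
  ⟨∑ i ∈ Finset.Icc (-(n : ℤ)) n, Finsupp.single i (f.coeff i)⟩

theorem coeff_trunc (n : ℕ) (f : BoundarySeries R) (i : ℤ) :
    (trunc n f).coeff i = if i ∈ Finset.Icc (-(n : ℤ)) n then f.coeff i else 0 := by
  rw [trunc]
  simp only [Finsupp.coe_finsetSum, Finset.sum_apply, Finsupp.single_apply, Finset.sum_ite_eq']

theorem trunc_add (n : ℕ) (f g : BoundarySeries R) : trunc n (f + g) = trunc n f + trunc n g := by
  ext i
  rw [coeff_trunc, AddMonoidAlgebra.coeff_add, Finsupp.add_apply, coeff_trunc, coeff_trunc]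
  split_ifs <;> simp

theorem trunc_const (n : ℕ) (r : R) : trunc n (const r) = AddMonoidAlgebra.single 0 r := by
  ext i
  rw [coeff_trunc, coeff_const, AddMonoidAlgebra.coeff_single, Finsupp.single_apply]
  by_cases h : i = 0
  · rw [if_pos h, if_pos h.symm, if_pos (by rw [h]; simp)]
  · rw [if_neg h, if_neg (Ne.symm h), ite_self]

theorem trunc_T {n : ℕ} (hn : 1 ≤ n) : trunc n (T : BoundarySeries R) =
    AddMonoidAlgebra.single 1 1 := by
  ext i
  rw [coeff_trunc, AddMonoidAlgebra.coeff_single, Finsupp.single_apply, T]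
  dsimp only
  by_cases h : i = 1
  · rw [if_pos h, if_pos h.symm, if_pos (by rw [h, Finset.mem_Icc]; omega)]
  · rw [if_neg h, if_neg (Ne.symm h), ite_self]

end BoundarySeries

/-- Evaluation of Laurent polynomials at a unit. -/
noncomputable def laurentEval (R : Type*) {S : Type*} [CommRing R] [CommRing S] [Algebra R S]
    (u : Sˣ) : AddMonoidAlgebra R ℤ →ₐ[R] S :=
  AddMonoidAlgebra.lift R S ℤ ((Units.coeHom S).comp (zpowersHom Sˣ u))

theorem laurentEval_apply {R S : Type*} [CommRing R] [CommRing S] [Algebra R S] (u : Sˣ)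
    (P : AddMonoidAlgebra R ℤ) :
    laurentEval R u P = P.coeff.sum fun i r => r • ((u ^ i : Sˣ) : S) := by
  rw [laurentEval, AddMonoidAlgebra.lift_apply]
  rfl

theorem laurentEval_single {R S : Type*} [CommRing R] [CommRing S] [Algebra R S] (u : Sˣ)
    (i : ℤ) (r : R) :
    laurentEval R u (AddMonoidAlgebra.single i r) = r • ((u ^ i : Sˣ) : S) := by
  rw [laurentEval_apply, AddMonoidAlgebra.coeff_single]
  exact Finsupp.sum_single_index (zero_smul _ _)

theorem coeff_laurentEval_unitT {R : Type*} [CommRing R] [IsLocalRing R]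
    [IsAdicComplete (maximalIdeal R) R] (P : AddMonoidAlgebra R ℤ) (i : ℤ) :
    (laurentEval R (unitT R) P).coeff i = P.coeff i := by
  rw [laurentEval_apply, Finsupp.sum, BoundarySeries.coeff_sum]
  simp only [coeff_smul, unitT_zpow, coeff_monomial, mul_ite, mul_one, mul_zero]
  rw [Finset.sum_ite_eq]
  split_ifs with h
  · rfl
  · exact (Finsupp.notMem_support_iff.mp h).symm

section tendsto

variable {R : Type*} [CommRing R] [IsLocalRing R] [IsAdicComplete (maximalIdeal R) R]
  {B : Type*} [CommRing B] [Algebra R B] [Algebra (BoundarySeries R) B]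
  [IsScalarTower R (BoundarySeries R) B] {ι : Type*} [Fintype ι]
  (v : Module.Basis ι (BoundarySeries R) B)

/-- Weak convergence of sequences in a finite free algebra. -/
def WeakTendsto (s : ℕ → B) (x : B) : Prop :=
  ∀ N L, ∃ n₀, ∀ n ≥ n₀, s n - x ∈ basisSmall v N L

variable {v}

theorem WeakTendsto.unique {s : ℕ → B} {x y : B} (hx : WeakTendsto v s x)
    (hy : WeakTendsto v s y) : x = y := by
  refine sub_eq_zero.mp (eq_zero_of_mem_basisSmall v fun N L => ?_)
  obtain ⟨n₀, h₀⟩ := hx N L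
  obtain ⟨n₁, h₁⟩ := hy N L
  have := sub_mem (h₁ _ (le_max_right n₀ n₁)) (h₀ _ (le_max_left n₀ n₁))
  simpa using this

theorem WeakTendsto.of_eventually_eq {s : ℕ → B} {x : B} (n₀ : ℕ) (h : ∀ n ≥ n₀, s n = x) :
    WeakTendsto v s x := fun N L => ⟨n₀, fun n hn => by
  rw [h n hn, sub_self]
  exact zero_mem _⟩

theorem WeakTendsto.add {s s' : ℕ → B} {x y : B} (hx : WeakTendsto v s x)
    (hy : WeakTendsto v s' y) : WeakTendsto v (fun n => s n + s' n) (x + y) := fun N L => by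
  obtain ⟨n₀, h₀⟩ := hx N L
  obtain ⟨n₁, h₁⟩ := hy N L
  refine ⟨max n₀ n₁, fun n hn => ?_⟩
  rw [add_sub_add_comm]
  exact add_mem (h₀ n (le_of_max_le_left hn)) (h₁ n (le_of_max_le_right hn))

theorem WeakTendsto.sub {s s' : ℕ → B} {x y : B} (hx : WeakTendsto v s x)
    (hy : WeakTendsto v s' y) : WeakTendsto v (fun n => s n - s' n) (x - y) := fun N L => by
  obtain ⟨n₀, h₀⟩ := hx N L
  obtain ⟨n₁, h₁⟩ := hy N L
  refine ⟨max n₀ n₁, fun n hn => ?_⟩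
  rw [sub_sub_sub_comm]
  exact sub_mem (h₀ n (le_of_max_le_left hn)) (h₁ n (le_of_max_le_right hn))

theorem WeakTendsto.mul {s s' : ℕ → B} {x y : B} (hx : WeakTendsto v s x)
    (hy : WeakTendsto v s' y) : WeakTendsto v (fun n => s n * s' n) (x * y) := fun N L => by
  obtain ⟨H, hH⟩ := exists_mul_mem_basisSmall v N
  obtain ⟨X, hX⟩ := exists_mem_basisSmall v x N
  obtain ⟨Y, hY⟩ := exists_mem_basisSmall v y N
  -- M is large enough to absorb the defect H and the lower bounds X, Y of the two limits.
  obtain ⟨M, hM1, hM2, hM3, hM4⟩ :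
      ∃ M : ℤ, L ≤ M + M + H ∧ L ≤ X + M + H ∧ L ≤ M + Y + H ∧ 0 ≤ M := by
    refine ⟨max (max (L - H - X) (L - H - Y)) (max 0 (L - H)), ?_, ?_, ?_, ?_⟩ <;> omega
  obtain ⟨n₀, h₀⟩ := hx N M
  obtain ⟨n₁, h₁⟩ := hy N M
  refine ⟨max n₀ n₁, fun n hn => ?_⟩
  have h2 := h₀ n (le_of_max_le_left hn)
  have h3 := h₁ n (le_of_max_le_right hn)
  have e : s n * s' n - x * y = (s n - x) * (s' n - y) + x * (s' n - y) + (s n - x) * y := by ring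
  rw [e]
  exact add_mem (add_mem (basisSmall_anti v hM1 (hH _ _ _ _ h2 h3))
    (basisSmall_anti v hM2 (hH _ _ _ _ hX h3))) (basisSmall_anti v hM3 (hH _ _ _ _ h2 hY))

variable (v)

theorem smul_mem_basisSmall_of_mem_pow {N : ℕ} {r : R} (hr : r ∈ maximalIdeal R ^ N) (L : ℤ)
    (x : B) : r • x ∈ basisSmall v N L := fun i j _ => by
  rw [← algebraMap_smul (BoundarySeries R) r x, map_smul, Finsupp.smul_apply, smul_eq_mul,
    ← Algebra.smul_def, coeff_smul]
  exact Ideal.mul_mem_right _ _ hr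

theorem mem_basisSmall_singleton {N : ℕ} {L : ℤ} {f : BoundarySeries R} :
    f ∈ basisSmall (Module.Basis.singleton Unit (BoundarySeries R)) N L ↔ f ∈ small N L := by
  simp [mem_basisSmall]

theorem weakTendsto_trunc (f : BoundarySeries R) :
    WeakTendsto (Module.Basis.singleton Unit (BoundarySeries R))
      (fun n => laurentEval R (unitT R) (trunc n f)) f := fun N L => by
  obtain ⟨M, hM⟩ := f.tendsto_zero N
  refine ⟨max L.toNat (-M).toNat, fun n hn => ?_⟩
  rw [mem_basisSmall_singleton]
  intro i hi
  rw [coeff_sub, coeff_laurentEval_unitT, coeff_trunc]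
  split_ifs with h
  · rw [sub_self]
    exact zero_mem _
  · rw [zero_sub, neg_mem_iff]
    refine hM i ?_
    rw [Finset.mem_Icc] at h
    have h1 : (L.toNat : ℤ) ≤ n := by exact_mod_cast le_of_max_le_left hn
    have h2 : ((-M).toNat : ℤ) ≤ n := by exact_mod_cast le_of_max_le_right hn
    omega

variable (Z : Bˣ)

/-- The point is that L' does not depend on P. Low terms, including those with negative powers of Z,
are small through their coefficients; high terms are small through Z ^ i. -/
theorem exists_laurentEval_mem_basisSmall
    (hZ : ∀ N L, ∃ i₀ : ℕ, ∀ i ≥ i₀, (Z : B) ^ i ∈ basisSmall v N L) (N : ℕ) (L : ℤ) :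
    ∃ L' : ℤ, ∀ P : AddMonoidAlgebra R ℤ, (∀ i < L', P.coeff i ∈ maximalIdeal R ^ N) →
      laurentEval R Z P ∈ basisSmall v N L := by
  obtain ⟨i₀, h₀⟩ := hZ N L
  refine ⟨i₀, fun P hP => ?_⟩
  rw [laurentEval_apply]
  refine sum_mem fun i _ => ?_
  by_cases hi : i < i₀
  · exact smul_mem_basisSmall_of_mem_pow v (hP i hi) L _
  · refine Submodule.smul_mem _ _ ?_
    obtain ⟨j, rfl⟩ : ∃ j : ℕ, i = j := ⟨i.toNat, by omega⟩
    rw [zpow_natCast, Units.val_pow_eq_pow_val]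
    exact h₀ j (by omega)

theorem weakTendsto_laurentEval
    (hZ : ∀ N L, ∃ i₀ : ℕ, ∀ i ≥ i₀, (Z : B) ^ i ∈ basisSmall v N L)
    {P : ℕ → AddMonoidAlgebra R ℤ}
    (hP : WeakTendsto (Module.Basis.singleton Unit (BoundarySeries R))
      (fun n => laurentEval R (unitT R) (P n)) 0) :
    WeakTendsto v (fun n => laurentEval R Z (P n)) 0 := fun N L => by
  obtain ⟨L', h⟩ := exists_laurentEval_mem_basisSmall v Z hZ N L
  obtain ⟨n₀, h₀⟩ := hP N L'
  refine ⟨n₀, fun n hn => ?_⟩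
  have := h₀ n hn
  rw [sub_zero, mem_basisSmall_singleton] at this
  rw [sub_zero]
  exact h _ fun i hi => by
    rw [← coeff_laurentEval_unitT]
    exact this i hi

theorem exists_weakTendsto
    (hZ : ∀ N L, ∃ i₀ : ℕ, ∀ i ≥ i₀, (Z : B) ^ i ∈ basisSmall v N L) (f : BoundarySeries R) :
    ∃ x, WeakTendsto v (fun n => laurentEval R Z (trunc n f)) x := by
  refine exists_limit_of_basis v _ fun N L => ?_
  obtain ⟨L', h⟩ := exists_laurentEval_mem_basisSmall v Z hZ N L
  obtain ⟨n₀, h₀⟩ := weakTendsto_trunc f N L'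
  refine ⟨n₀, fun n hn => ?_⟩
  rw [← map_sub]
  refine h _ fun i hi => ?_
  have h1 := (mem_basisSmall_singleton.mp (h₀ n hn)) i hi
  have h2 := (mem_basisSmall_singleton.mp (h₀ n₀ le_rfl)) i hi
  have := sub_mem h1 h2
  simpa [coeff_laurentEval_unitT] using this

/-- Substitution of a unit `Z` whose powers tend to zero. -/
theorem exists_algHom
    (hZ : ∀ N L, ∃ i₀ : ℕ, ∀ i ≥ i₀, (Z : B) ^ i ∈ basisSmall v N L) :
    ∃ ψ : BoundarySeries R →ₐ[R] B, ψ T = Z := by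
  choose ψ hψ using exists_weakTendsto v Z hZ
  have hc : ∀ r, ψ (algebraMap R _ r) = algebraMap R B r := fun r =>
    (hψ _).unique (.of_eventually_eq 0 fun n _ => by
      rw [BoundarySeries.algebraMap_apply, trunc_const, laurentEval_single, zpow_zero,
        Units.val_one, Algebra.algebraMap_eq_smul_one])
  refine ⟨AlgHom.mk ⟨⟨⟨ψ, ?_⟩, fun f g => ?_⟩, ?_, fun f g => ?_⟩ hc, ?_⟩
  · simpa using hc 1
  · have h1 := (hψ f).mul (hψ g)
    -- The failure of truncation to be multiplicative tends to 0 when evaluated at T, hence also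
    -- when evaluated at Z.
    have h2 : WeakTendsto v (fun n => laurentEval R Z (trunc n f * trunc n g - trunc n (f * g)))
        0 := by
      refine weakTendsto_laurentEval v Z hZ ?_
      have := ((weakTendsto_trunc f).mul (weakTendsto_trunc g)).sub (weakTendsto_trunc (f * g))
      rw [sub_self] at this
      simpa only [map_sub, map_mul] using this
    have h3 := h1.sub h2
    rw [sub_zero] at h3
    refine (hψ _).unique ?_
    simpa only [map_sub, map_mul, sub_sub_cancel] using h3
  · simpa using hc 0
  · refine (hψ _).unique ?_
    have := (hψ f).add (hψ g)
    simpa only [← map_add, ← trunc_add] using this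
  · exact (hψ _).unique (.of_eventually_eq 1 fun n hn => by
      rw [trunc_T hn, laurentEval_single, zpow_one, one_smul])

end tendsto

end

/-! ### Elements whose Frobenius residue has order 1 are parameters -/

section

open BoundarySeries IsLocalRing

namespace BoundarySeries

variable {R : Type*} [CommRing R] [IsDomain R] [IsDiscreteValuationRing R]
  [IsAdicComplete (maximalIdeal R) R]

/-- A series whose reduction has order at least `L` is congruent to one without terms of
index `< L`. -/
theorem exists_small_of_residue_mem_fil {a : BoundarySeries R} {L : ℤ}
    (ha : residue a ∈ LaurentSeries.fil (ResidueField R) L) :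
    ∃ a₀ : BoundarySeries R, (∀ N, a₀ ∈ small N L) ∧ residue a₀ = residue a := by
  refine ⟨⟨fun i => if i < L then 0 else a.coeff i, fun N => ?_⟩, fun N i hi => ?_, ?_⟩
  · obtain ⟨M, hM⟩ := a.tendsto_zero N
    refine ⟨M, fun i hi => ?_⟩
    split_ifs
    · exact zero_mem _
    · exact hM i hi
  · simp only [if_pos hi]
    exact zero_mem _
  · ext i
    rw [residue_coeff]
    dsimp only
    split_ifs with h
    · rw [map_zero, ha i h]
    · rw [residue_coeff]

end BoundarySeries

namespace IsFrobeniusResidue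

variable {R : Type*} [CommRing R] [IsDomain R] [IsDiscreteValuationRing R]
  [IsAdicComplete (maximalIdeal R) R]
  {B : Type*} [CommRing B] [Algebra R B] [Algebra (BoundarySeries R) B]
  [IsScalarTower R (BoundarySeries R) B]
  {p : ℕ} [hp : Fact p.Prime] [IsAlgClosed (ResidueField R)] [CharP (ResidueField R) p]
  {π : R} {Φ : B →+* LaurentSeries (ResidueField R)}

theorem isUnit_iff (hΦ : IsFrobeniusResidue π p Φ) (hπ : Irreducible π)
    [IsAdicComplete (Ideal.span {algebraMap R B π}) B] {b : B} : IsUnit b ↔ Φ b ≠ 0 := by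
  refine ⟨fun h => (h.map Φ).ne_zero, fun h => ?_⟩
  rw [Ne, hΦ.eq_zero_iff] at h
  refine isUnit_of_not_dvd_of_isField (SpecialFiber.isField_quotient hπ ?_) h
  exact (hΦ.specialFiberEquiv hπ).toMulEquiv.isField (Field.toIsField _)

/-- Lifting Φ Z to a series U without terms of index < 1, one has Z ^ p = U + π V. In the binomial
expansion of Z ^ (p q + r), the terms with π ^ j, j ≥ N, are small 𝔪-adically. The others contain a
high power of U times one of the finitely many elements Z ^ r V ^ j with j < N, r < p. -/
theorem pow_mem_basisSmall (hΦ : IsFrobeniusResidue π p Φ) (hπ : Irreducible π) {ι : Type*}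
    [Fintype ι] (v : Module.Basis ι (BoundarySeries R) B) {Z : B} (hZ : (Φ Z).order = 1)
    (N : ℕ) (L : ℤ) : ∃ i₀ : ℕ, ∀ i ≥ i₀, Z ^ i ∈ basisSmall v N L := by
  have hZ0 : Φ Z ≠ 0 := by
    intro h
    rw [h, HahnSeries.order_zero] at hZ
    exact zero_ne_one hZ
  obtain ⟨a, ha⟩ := residue_surjective (Φ Z)
  obtain ⟨U, hU, hUa⟩ := exists_small_of_residue_mem_fil (a := a) (L := 1) (by
    rw [ha, LaurentSeries.mem_fil_iff_le_order hZ0, hZ])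
  obtain ⟨V, hV⟩ := hΦ.dvd_pow_sub.mpr (ha.symm.trans hUa.symm)
  rw [sub_eq_iff_eq_add'] at hV
  choose l hl using fun jr : Fin N × Fin p =>
    exists_mem_basisSmall v (Z ^ (jr.2 : ℕ) * V ^ (jr.1 : ℕ)) N
  obtain ⟨M, hM⟩ := (Set.finite_range l).bddBelow
  -- With q ≥ L + N - M and j < N, the exponent i = q - j of U satisfies i + M ≥ L.
  refine ⟨p * (L + N - M).toNat, fun n hn => ?_⟩
  obtain ⟨q, r, hr, rfl⟩ : ∃ q r, r < p ∧ n = p * q + r :=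
    ⟨n / p, n % p, Nat.mod_lt _ hp.out.pos, (Nat.div_add_mod n p).symm⟩
  have hq : (L + N - M).toNat ≤ q := by
    by_contra h
    have h1 : q + 1 ≤ (L + N - M).toNat := by omega
    have := Nat.mul_le_mul_left p h1
    rw [mul_add] at this
    omega
  rw [pow_add, pow_mul, hV, add_pow, Finset.sum_mul]
  refine sum_mem fun i hi => ?_
  rw [Finset.mem_range] at hi
  obtain ⟨j, rfl⟩ : ∃ j, q = i + j := ⟨q - i, by omega⟩
  rw [Nat.add_sub_cancel_left]
  have e : algebraMap (BoundarySeries R) B U ^ i * (algebraMap R B π * V) ^ j *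
      ((i + j).choose i : B) * Z ^ r = ((i + j).choose i) • (U ^ i • (π ^ j •
        (Z ^ r * V ^ j))) := by
    rw [nsmul_eq_mul, Algebra.smul_def, Algebra.smul_def, map_pow, map_pow]
    ring
  rw [e]
  refine nsmul_mem ?_ _
  by_cases hj : j < N
  · have h1 := smul_mem_basisSmall v (pow_mem_small (hU N) i)
      (Submodule.smul_mem _ (π ^ j) (hl (⟨j, hj⟩, ⟨r, hr⟩)))
    have h2 := hM ⟨(⟨j, hj⟩, ⟨r, hr⟩), rfl⟩
    refine basisSmall_anti v ?_ h1
    omega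
  · rw [smul_comm]
    refine smul_mem_basisSmall_of_mem_pow v (Ideal.pow_le_pow_right (not_lt.mp hj) ?_) _ _
    refine Ideal.pow_mem_pow ?_ _
    rw [hπ.maximalIdeal_eq]
    exact Ideal.mem_span_singleton_self π

/-- Elements of `B` whose reduction is a uniformizer of the residue field are parameters. -/
theorem isParameter (hΦ : IsFrobeniusResidue π p Φ) (hπ : Irreducible π) [IsDomain B]
    [IsAdicComplete (Ideal.span {algebraMap R B π}) B] (hπB : algebraMap R B π ≠ 0) {ι : Type*}
    [Fintype ι] (v : Module.Basis ι (BoundarySeries R) B) {Z : B} (hZ : (Φ Z).order = 1) :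
    IsParameter R Z := by
  have hZ0 : Φ Z ≠ 0 := by
    intro h
    rw [h, HahnSeries.order_zero] at hZ
    exact zero_ne_one hZ
  obtain ⟨ψ, hψ⟩ := exists_algHom v ((hΦ.isUnit_iff hπ).mpr hZ0).unit
    (fun N L => hΦ.pow_mem_basisSmall hπ v hZ N L)
  rw [IsUnit.unit_spec] at hψ
  -- The reduction of ψ modulo π, read as an endomorphism of k((t)) through Φ.
  let α : LaurentSeries (ResidueField R) →+* LaurentSeries (ResidueField R) :=
    RingHom.liftOfSurjective (BoundarySeries.residue (R := R)) BoundarySeries.residue_surjective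
      ⟨Φ.comp ψ.toRingHom, fun f hf => by
        rw [RingHom.mem_ker, residue_eq_zero_iff hπ] at hf
        obtain ⟨g, rfl⟩ := hf
        rw [RingHom.mem_ker, map_mul]
        have : (Φ.comp ψ.toRingHom) (algebraMap R (BoundarySeries R) π) = 0 := by
          refine (congrArg Φ (ψ.commutes π)).trans ?_
          exact (hΦ.eq_zero_iff _).mpr dvd_rfl
        rw [this, zero_mul]⟩
  have hα : ∀ f, α (residue f) = Φ (ψ f) := fun f =>
    RingHom.liftOfRightInverse_comp_apply _ _ _ _ f
  have hαT : α (HahnSeries.single 1 1) = Φ Z := by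
    have : residue (T : BoundarySeries R) = HahnSeries.single 1 1 := by
      ext i
      rw [residue_coeff, HahnSeries.coeff_single, T]
      dsimp only
      split_ifs <;> simp
    rw [← this, hα, hψ]
  -- α raises constants to the p-th power, so constants are hit through p-th roots in k.
  choose s hs using fun c : ResidueField R => IsAlgClosed.exists_pow_nat_eq c hp.out.pos
  have hαC : ∀ c, α (HahnSeries.C (s c)) = HahnSeries.C c := by
    intro c
    obtain ⟨r, hr⟩ := IsLocalRing.residue_surjective (s c)
    have : residue (algebraMap R (BoundarySeries R) r) = HahnSeries.C (s c) := by
      ext i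
      rw [residue_coeff, BoundarySeries.algebraMap_apply, coeff_const, HahnSeries.C_apply,
        HahnSeries.coeff_single, ← hr]
      split_ifs <;> simp
    rw [← this, hα, ψ.commutes, hΦ.map_const, hr, hs]
  have hsurj := LaurentSeries.surjective_of_order_eq_one p hαC (by rw [hαT, hZ])
  have hcomp : ∀ g, ∃ f, Φ (ψ f) = g := by
    intro g
    obtain ⟨f, hf⟩ := hsurj g
    obtain ⟨f, rfl⟩ := residue_surjective f
    exact ⟨f, by rw [← hα, hf]⟩
  have := BoundarySeries.isAdicComplete hπ
  have hbij : Function.Bijective ψ := by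
    constructor
    · rw [injective_iff_map_eq_zero]
      intro f hf
      by_contra hne
      obtain ⟨n, u, rfl, hu⟩ := exists_eq_pow_mul_of_isHausdorff (ϖ := algebraMap R _ π) hne
      have hu := isUnit_of_not_dvd_of_isField (BoundarySeries.isField_quotient hπ) hu
      rw [map_mul, map_pow, ψ.commutes] at hf
      exact mul_ne_zero (pow_ne_zero _ hπB) (hu.map ψ).ne_zero hf
    -- Surjectivity modulo π lifts, since the source is π-adically complete and the target is
    -- separated.
    · have hmap : (Ideal.span {algebraMap R (BoundarySeries R) π}).map ψ.toRingHom =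
          Ideal.span {algebraMap R B π} := by
        rw [Ideal.map_span, Set.image_singleton]
        congr 2
        exact ψ.commutes π
      have : IsHausdorff ((Ideal.span {algebraMap R (BoundarySeries R) π}).map ψ.toRingHom) B := by
        rw [hmap]
        infer_instance
      refine surjective_of_mk_map_comp_surjective
        (I := Ideal.span {algebraMap R (BoundarySeries R) π}) ψ.toRingHom fun y => ?_
      obtain ⟨b, rfl⟩ := Ideal.Quotient.mk_surjective y
      obtain ⟨f, hf⟩ := hcomp (Φ b)
      refine ⟨f, ?_⟩
      rw [RingHom.comp_apply, Ideal.Quotient.eq, hmap, Ideal.mem_span_singleton]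
      exact hΦ.eq_iff.mp hf
  exact ⟨AlgEquiv.ofBijective ψ hbij, hψ⟩

end IsFrobeniusResidue

end

/-! ### Roots of units prime to p, and the action of G on them -/

section

open BoundarySeries IsLocalRing

section zeta

variable {R : Type*} [CommRing R] {p : ℕ} [hp : Fact p.Prime] {ζ : R}

/-- The character `a ↦ ζ ^ a` of `ℤ / p`, for `ζ ^ p = 1`. -/
def rootHom (hζ : ζ ^ p = 1) : Multiplicative (ZMod p) →* R where
  toFun a := ζ ^ a.toAdd.val
  map_one' := by simp
  map_mul' a b := by
    rw [toAdd_mul, ZMod.val_add, ← pow_add, ← pow_mod_orderOf, ← pow_mod_orderOf _ (_ + _)]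
    congr 1
    exact Nat.mod_mod_of_dvd _ (orderOf_dvd_of_pow_eq_one hζ)

theorem rootHom_apply (hζ : ζ ^ p = 1) (a : Multiplicative (ZMod p)) :
    rootHom hζ a = ζ ^ a.toAdd.val := rfl

theorem rootHom_injective (hζ : IsPrimitiveRoot ζ p) : Function.Injective (rootHom hζ.pow_eq_one) :=
  fun a b h => by
    have := hζ.pow_inj (ZMod.val_lt a.toAdd) (ZMod.val_lt b.toAdd) h
    exact Multiplicative.toAdd.injective (ZMod.val_injective p this)

end zeta

namespace IsFrobeniusResidue

variable {R : Type*} [CommRing R] [IsDomain R] [IsDiscreteValuationRing R]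
  [IsAdicComplete (maximalIdeal R) R]
  {B : Type*} [CommRing B] [Algebra R B] [Algebra (BoundarySeries R) B]
  [IsScalarTower R (BoundarySeries R) B]
  {p : ℕ} [hp : Fact p.Prime] [IsAlgClosed (ResidueField R)] [CharP (ResidueField R) p]
  {π : R} {Φ : B →+* LaurentSeries (ResidueField R)}
  [IsAdicComplete (Ideal.span {algebraMap R B π}) B]

/-- Hensel's lemma in B: the derivative n z ^ (n - 1) is a unit because n is prime to p. -/
theorem exists_pow_eq (hΦ : IsFrobeniusResidue π p Φ) (hπ : Irreducible π) {n : ℕ}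
    (hn : (n : ResidueField R) ≠ 0) {z y : B} (hz : Φ z ≠ 0) (h : Φ z ^ n = Φ y) :
    ∃ Z, Z ^ n = y ∧ Φ Z = Φ z := by
  have hn0 : n ≠ 0 := by rintro rfl; simp at hn
  have hnK : (n : LaurentSeries (ResidueField R)) ≠ 0 := by
    rwa [Ne, CharP.cast_eq_zero_iff _ p, ← CharP.cast_eq_zero_iff (ResidueField R) p]
  obtain ⟨Z, hZ, hZz⟩ := HenselianRing.is_henselian (I := Ideal.span {algebraMap R B π})
    (Polynomial.X ^ n - Polynomial.C y) (Polynomial.monic_X_pow_sub_C y hn0) z (by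
      rw [Ideal.mem_span_singleton, ← hΦ.eq_zero_iff]
      simp [h]) (by
      refine IsUnit.map _ ((hΦ.isUnit_iff hπ).mpr ?_)
      simp [Polynomial.derivative_X_pow, hnK, hz])
  refine ⟨Z, by simpa [Polynomial.IsRoot, sub_eq_zero] using hZ, ?_⟩
  rwa [hΦ.eq_iff, ← Ideal.mem_span_singleton]

theorem exists_zpow_eq (hΦ : IsFrobeniusResidue π p Φ) (hπ : Irreducible π) {y : B}
    (hy : ¬ (p : ℤ) ∣ (Φ y).order) :
    ∃ Z : Bˣ, ((Z ^ (Φ y).order : Bˣ) : B) = y ∧ (Φ (Z : B)).order = 1 := by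
  obtain ⟨g, hg0, hg1, hg⟩ := LaurentSeries.exists_zpow_eq p hy
  obtain ⟨z, rfl⟩ := hΦ.surjective g
  set m := (Φ y).order with hm
  have hn : ((m.natAbs : ℕ) : ResidueField R) ≠ 0 := by
    rwa [Ne, CharP.cast_eq_zero_iff _ p, ← Int.natCast_dvd]
  have hm0 : m ≠ 0 := by
    intro h0
    rw [h0] at hy
    exact hy (dvd_zero _)
  have hy0 : Φ y ≠ 0 := by
    rw [← hg]
    exact zpow_ne_zero _ hg0
  obtain ⟨u, rfl⟩ := (hΦ.isUnit_iff hπ).mpr hy0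
  have key : ∀ w : Bˣ, Φ z ^ m.natAbs = Φ (w : B) →
      ∃ Z : Bˣ, Z ^ m.natAbs = w ∧ (Φ (Z : B)).order = 1 := by
    intro w hw
    obtain ⟨Z, hZ, hZz⟩ := hΦ.exists_pow_eq hπ hn hg0 hw
    obtain ⟨Z, rfl⟩ := (hΦ.isUnit_iff hπ (b := Z)).mpr (by rwa [hZz])
    exact ⟨Z, Units.ext hZ, by rw [hZz, hg1]⟩
  rcases m.natAbs_eq with h1 | h1
  · obtain ⟨Z, hZ, hZ1⟩ := key u (by rw [← zpow_natCast, ← h1, hg])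
    refine ⟨Z, ?_, hZ1⟩
    rw [h1, zpow_natCast, hZ]
  · have hu : Φ ((u⁻¹ : Bˣ) : B) = (Φ u)⁻¹ :=
      eq_inv_of_mul_eq_one_left (by rw [← map_mul, Units.inv_mul, map_one])
    obtain ⟨Z, hZ, hZ1⟩ := key u⁻¹ (by
      rw [hu, ← hg, ← zpow_neg, ← zpow_natCast]; congr 1; omega)
    refine ⟨Z, ?_, hZ1⟩
    rw [h1, zpow_neg, zpow_natCast, hZ, inv_inv]

/-- If ρ ≠ 1, the geometric sum of the powers of ρ vanishes; but its reduction is |m|, which is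
nonzero in k. -/
theorem eq_one_of_zpow_eq_one [IsDomain B] (Φ : B →+* LaurentSeries (ResidueField R)) {m : ℤ}
    (hm : ¬ (p : ℤ) ∣ m) {ρ : Bˣ} (hρ : ρ ^ m = 1) (h1 : Φ (ρ : B) = 1) : ρ = 1 := by
  have h2 : ρ ^ m.natAbs = 1 := pow_natAbs_eq_one.mpr hρ
  have h3 : ((ρ : B) ^ m.natAbs) = 1 := by rw [← Units.val_pow_eq_pow_val, h2, Units.val_one]
  have h4 := geom_sum_mul (ρ : B) m.natAbs
  rw [h3, sub_self, mul_eq_zero, sub_eq_zero] at h4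
  refine Units.ext (h4.resolve_left fun h5 => hm ?_)
  have h6 := congrArg Φ h5
  rw [map_sum, map_zero] at h6
  simp only [map_pow, h1, one_pow, Finset.sum_const, Finset.card_range, nsmul_one] at h6
  rw [CharP.cast_eq_zero_iff _ p] at h6
  rwa [Int.natCast_dvd]

theorem isPrincipalRoot_iff (hΦ : IsFrobeniusResidue π p Φ) (hπ : Irreducible π) {m : ℤ} {x : B}
    {ρ : Bˣ} : IsPrincipalRoot R m x ρ ↔ ((ρ ^ m : Bˣ) : B) = x ∧ Φ (ρ : B) = 1 := by
  rw [IsPrincipalRoot, ← map_one (SpecialFiber.mk R), SpecialFiber.mk_eq_mk_iff hπ, ← hΦ.eq_iff,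
    map_one]

theorem isPrincipalRoot_iff_eq [IsDomain B] (hΦ : IsFrobeniusResidue π p Φ) (hπ : Irreducible π)
    {m : ℤ} (hm : ¬ (p : ℤ) ∣ m) {x : B} {ρ : Bˣ} (hρ : IsPrincipalRoot R m x ρ) (ρ' : Bˣ) :
    IsPrincipalRoot R m x ρ' ↔ ρ' = ρ := by
  refine ⟨fun h => ?_, fun h => h ▸ hρ⟩
  rw [hΦ.isPrincipalRoot_iff hπ] at h hρ
  rw [← div_eq_one]
  refine eq_one_of_zpow_eq_one Φ hm ?_ ?_
  · rw [div_zpow, div_eq_one]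
    exact Units.ext (h.1.trans hρ.1.symm)
  · have := congrArg Φ (congrArg Units.val (div_mul_cancel ρ' ρ))
    rwa [Units.val_mul, map_mul, hρ.2, mul_one, h.2] at this

/-- In characteristic p the only p-th root of unity is 1. -/
theorem map_root (Φ : B →+* LaurentSeries (ResidueField R)) {ζ : R} (hζ : ζ ^ p = 1) (n : ℕ) :
    Φ (algebraMap R B (ζ ^ n)) = 1 := by
  have h1 : Φ (algebraMap R B ζ) = 1 := by
    refine frobenius_inj (LaurentSeries (ResidueField R)) p ?_
    rw [frobenius_def, frobenius_def, ← map_pow, ← map_pow, hζ, map_one, map_one, one_pow]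
  rw [map_pow, map_pow, h1, one_pow]

/-- The action of an automorphism on an `m`-th root `Z` of an element on which it acts by
`ζ ^ a x`. -/
theorem exists_action_eq [IsDomain B] (hΦ : IsFrobeniusResidue π p Φ) (hπ : Irreducible π) {ζ : R}
    (hζ : ζ ^ p = 1) {m : ℤ} (hm : ¬ (p : ℤ) ∣ m) (σ : B ≃ₐ[BoundarySeries R] B) (Z : Bˣ)
    (a : ZMod p) (x : B)
    (h : σ ((Z ^ m : Bˣ) : B) = algebraMap R B (ζ ^ a.val) * ((Z ^ m : Bˣ) : B) * x) :
    ∃ ρ : Bˣ, (∀ ρ' : Bˣ, IsPrincipalRoot R m x ρ' ↔ ρ' = ρ) ∧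
      σ (Z : B) = algebraMap R B (ζ ^ ((m : ZMod p)⁻¹ * a).val) * Z * ρ := by
  let χ : Multiplicative (ZMod p) →* Bˣ :=
    MonoidHom.toHomUnits ((algebraMap R B : R →* B).comp (rootHom hζ))
  have hχ : ∀ b : ZMod p, ((χ (.ofAdd b) : Bˣ) : B) = algebraMap R B (ζ ^ b.val) := fun b => rfl
  have hm0 : (m : ZMod p) ≠ 0 := by rwa [Ne, ZMod.intCast_zmod_eq_zero_iff_dvd]
  have hχm : χ (.ofAdd ((m : ZMod p)⁻¹ * a)) ^ m = χ (.ofAdd a) := by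
    rw [← map_zpow, ← ofAdd_zsmul, zsmul_eq_mul, mul_inv_cancel_left₀ hm0]
  set W : Bˣ := Units.map (σ : B →* B) Z with hW
  have hWZ : (W : B) = σ Z := rfl
  have hWm : ((W ^ m : Bˣ) : B) = σ ((Z ^ m : Bˣ) : B) := by
    rw [hW, ← map_zpow]
    rfl
  set η := χ (.ofAdd ((m : ZMod p)⁻¹ * a)) with hη
  -- Here η is the power of ζ with η ^ m = ζ ^ a. The quotient of σ Z by η Z has m-th power x, and
  -- it reduces to 1 because σ acts trivially on the special fibre and ζ reduces to 1.
  refine ⟨W / (η * Z), ?_, ?_⟩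
  · refine hΦ.isPrincipalRoot_iff_eq hπ hm ((hΦ.isPrincipalRoot_iff hπ).mpr ⟨?_, ?_⟩)
    · have e : ((W / (η * Z)) ^ m * (χ (.ofAdd a) * Z ^ m) : Bˣ) = W ^ m := by
        rw [div_zpow, mul_zpow, hχm, div_mul_cancel]
      have e1 := congrArg Units.val e
      rw [Units.val_mul, hWm, h, ← hχ, mul_comm] at e1
      refine (χ (.ofAdd a) * Z ^ m).mul_right_inj.mp (e1.trans ?_)
      rw [Units.val_mul]
    · have e1 := congrArg Φ (congrArg Units.val (div_mul_cancel W (η * Z)))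
      rw [Units.val_mul, Units.val_mul, map_mul, map_mul, hη, hχ, map_root Φ hζ, one_mul, hWZ,
        hΦ.map_algEquiv] at e1
      exact mul_right_cancel₀ (Z.isUnit.map Φ).ne_zero (e1.trans (one_mul _).symm)
  · rw [← hχ, ← hη, ← hWZ, ← Units.val_mul, ← Units.val_mul, mul_div_cancel]

end IsFrobeniusResidue

end

/-! ### Generators of B over A -/

section presentation

open BoundarySeries IsLocalRing

theorem LinearMap.bijective_of_surjective_of_finrank_eq {A M N : Type*} [CommRing A]
    [Nontrivial A] [AddCommGroup M] [AddCommGroup N] [Module A M] [Module A N] [Module.Free A M]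
    [Module.Free A N] [Module.Finite A M] [Module.Finite A N]
    (h : Module.finrank A M = Module.finrank A N) {f : M →ₗ[A] N} (hf : Function.Surjective f) :
    Function.Bijective f := by
  refine ⟨?_, hf⟩
  let e := LinearEquiv.ofFinrankEq N M h.symm
  have := OrzechProperty.injective_of_surjective_endomorphism (e.toLinearMap ∘ₗ f)
    (by simpa using hf)
  rw [LinearMap.coe_comp] at this
  exact this.of_comp

/-- If `f` is not a `p`-th power, then `1, f, …, f ^ (p - 1)` span `k((t))` over `k((t)) ^ p`. -/
theorem LaurentSeries.exists_eq_sum_pow_mul_pow {k : Type*} [Field k] [IsAlgClosed k] (p : ℕ)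
    [hp : Fact p.Prime] [CharP k p] {f : LaurentSeries k} (hf : ∀ g, f ≠ g ^ p)
    (g : LaurentSeries k) : ∃ c : Fin p → LaurentSeries k, g = ∑ i, c i ^ p * f ^ (i : ℕ) := by
  let F := (frobenius (LaurentSeries k) p).fieldRange
  have hmem : ∀ x : LaurentSeries k, x ^ p ∈ F := fun x => ⟨x, rfl⟩
  let a : F := ⟨f ^ p, hmem f⟩
  have hmon : (Polynomial.X ^ p - Polynomial.C a).Monic :=
    Polynomial.monic_X_pow_sub_C _ hp.out.ne_zero
  -- As f is not a p-th power, X ^ p - f ^ p is irreducible over the field F of p-th powers. So 1,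
  -- f, …, f ^ (p - 1) are independent, and they span because k((t)) has degree at most p over F.
  have hmin : Polynomial.X ^ p - Polynomial.C a = minpoly F f := by
    refine minpoly.eq_of_irreducible_of_monic (X_pow_sub_C_irreducible_of_prime hp.out ?_) ?_ hmon
    · rintro ⟨_, c, rfl⟩ hc
      have hc : (frobenius _ p c) ^ p = f ^ p := congrArg Subtype.val hc
      exact hf c (frobenius_inj _ p hc).symm
    · simp only [map_sub, map_pow, Polynomial.aeval_X, Polynomial.aeval_C]
      exact sub_self (f ^ p)
  have hdeg : (minpoly F f).natDegree = p := by
    rw [← hmin, Polynomial.natDegree_X_pow_sub_C]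
  have hspan : Submodule.span F
      (Set.range fun i : Fin p => (HahnSeries.single ((i : ℕ) : ℤ) 1 : LaurentSeries k)) = ⊤ := by
    rw [eq_top_iff]
    intro x _
    obtain ⟨c, rfl⟩ := exists_eq_sum_pow p x
    exact Submodule.sum_mem _ fun i _ =>
      Submodule.smul_mem _ (⟨c i ^ p, hmem _⟩ : F) (Submodule.subset_span ⟨i, rfl⟩)
  have : Module.Finite F (LaurentSeries k) :=
    ⟨Submodule.fg_def.mpr ⟨_, Set.finite_range _, hspan⟩⟩
  have hli := linearIndependent_pow (K := F) f
  rw [hdeg] at hli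
  have h1 := finrank_le_of_span_eq_top hspan
  have h2 := hli.fintype_card_le_finrank
  have htop := hli.span_eq_top_of_card_eq_finrank' (le_antisymm h2 h1)
  obtain ⟨c, hc⟩ := (Submodule.mem_span_range_iff_exists_fun F).mp
    (htop ▸ Submodule.mem_top : g ∈ Submodule.span F _)
  choose d hd using fun i => (c i).2
  refine ⟨d, hc.symm.trans (Finset.sum_congr rfl fun i _ => ?_)⟩
  have h3 : d i ^ p = (c i : LaurentSeries k) := hd i
  rw [h3]
  rfl

namespace IsFrobeniusResidue

variable {R : Type*} [CommRing R] [IsDomain R] [IsDiscreteValuationRing R]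
  [IsAdicComplete (maximalIdeal R) R]
  {B : Type*} [CommRing B] [Algebra R B] [Algebra (BoundarySeries R) B]
  [IsScalarTower R (BoundarySeries R) B]
  {p : ℕ} [hp : Fact p.Prime] [IsAlgClosed (ResidueField R)] [CharP (ResidueField R) p]
  {π : R} {Φ : B →+* LaurentSeries (ResidueField R)}

/-- Modulo π the powers of b span, because Φ sends A onto the p-th powers; Nakayama's lemma lifts
this to B. -/
theorem adjoin_eq_top (hΦ : IsFrobeniusResidue π p Φ) (hπ : Irreducible π)
    [Module.Finite (BoundarySeries R) B] {b : B} (hb : ∀ g, Φ b ≠ g ^ p) :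
    Algebra.adjoin (BoundarySeries R) {b} = ⊤ := by
  rw [← Algebra.toSubmodule_eq_top, eq_top_iff]
  have hmax : maximalIdeal (BoundarySeries R) = Ideal.span {algebraMap R _ π} :=
    (irreducible_algebraMap hπ).maximalIdeal_eq
  refine Submodule.le_of_le_smul_of_le_jacobson_bot (I := maximalIdeal (BoundarySeries R))
    Module.Finite.fg_top (IsLocalRing.maximalIdeal_le_jacobson _) fun x _ => ?_
  obtain ⟨c, hc⟩ := LaurentSeries.exists_eq_sum_pow_mul_pow p hb (Φ x)
  choose a ha using fun i => residue_surjective (c i)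
  have h1 : Φ x = Φ (∑ i, algebraMap _ B (a i) * b ^ (i : ℕ)) := by
    rw [hc, map_sum]
    exact Finset.sum_congr rfl fun i _ => by rw [map_mul, map_pow, hΦ.map_algebraMap, ha]
  obtain ⟨d, hd⟩ := hΦ.eq_iff.mp h1
  rw [sub_eq_iff_eq_add] at hd
  rw [hd, add_comm]
  refine Submodule.add_mem_sup ?_ ?_
  · exact Subalgebra.sum_mem _ fun i _ => mul_mem (Subalgebra.algebraMap_mem _ _)
      (pow_mem (Algebra.self_mem_adjoin_singleton _ b) _)
  · rw [IsScalarTower.algebraMap_apply R (BoundarySeries R) B, ← Algebra.smul_def]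
    exact Submodule.smul_mem_smul (hmax ▸ Ideal.mem_span_singleton_self _) Submodule.mem_top

/-- An element generates `B` over `A` if and only if its residue is not a `p`-th power. -/
theorem isPresentedBy_iff (hΦ : IsFrobeniusResidue π p Φ) (hπ : Irreducible π)
    [Module.Finite (BoundarySeries R) B] [Module.Free (BoundarySeries R) B]
    (hrank : Module.finrank (BoundarySeries R) B = p) {f : (BoundarySeries R)[X]} (hf : f.Monic)
    (hdeg : f.natDegree = p) {b : B} (hb : Polynomial.aeval b f = 0) :
    IsPresentedBy f b ↔ ∀ g, Φ b ≠ g ^ p := by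
  constructor
  · rintro ⟨e, he⟩ g hg
    -- If Φ b were a p-th power, so would be Φ of every polynomial in b; but Φ is onto, and t is not
    -- a p-th power by its order.
    obtain ⟨z, hz⟩ := hΦ.surjective (HahnSeries.single 1 1)
    have key : ∀ P : (BoundarySeries R)[X], ∃ c, Φ (Polynomial.aeval b P) = c ^ p := by
      intro P
      induction P using Polynomial.induction_on' with
      | add P Q hP hQ =>
        obtain ⟨c, hc⟩ := hP
        obtain ⟨d, hd⟩ := hQ
        exact ⟨c + d, by rw [map_add, map_add, hc, hd, add_pow_char]⟩
      | monomial n a =>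
        refine ⟨residue a * g ^ n, ?_⟩
        rw [Polynomial.aeval_monomial, map_mul, map_pow, hΦ.map_algebraMap, hg, mul_pow,
          pow_right_comm]
    obtain ⟨P, hP⟩ := AdjoinRoot.mk_surjective (e.symm z)
    have hPz : Polynomial.aeval b P = z := by
      rw [← e.apply_symm_apply z, ← hP, ← AdjoinRoot.aeval_eq, ← Polynomial.aeval_algHom_apply, he]
    obtain ⟨c, hc⟩ := key P
    rw [hPz, hz] at hc
    have h1 := congrArg HahnSeries.order hc
    rw [HahnSeries.order_single one_ne_zero, HahnSeries.order_pow, nsmul_eq_mul] at h1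
    exact hp.out.one_lt.ne'
      (by exact_mod_cast Int.eq_one_of_mul_eq_one_right (by positivity) h1.symm)
  · intro hg
    let e := AdjoinRoot.liftAlgHom f (Algebra.ofId (BoundarySeries R) B) b hb
    have : Module.Free (BoundarySeries R) (AdjoinRoot f) := hf.free_adjoinRoot
    have : Module.Finite (BoundarySeries R) (AdjoinRoot f) := hf.finite_adjoinRoot
    have hsurj : Function.Surjective e := by
      rw [← AlgHom.range_eq_top, eq_top_iff, ← hΦ.adjoin_eq_top hπ hg]
      refine Algebra.adjoin_le ?_
      rw [Set.singleton_subset_iff]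
      exact ⟨AdjoinRoot.root f, AdjoinRoot.liftAlgHom_root ..⟩
    have hfin : Module.finrank (BoundarySeries R) (AdjoinRoot f) =
        Module.finrank (BoundarySeries R) B := by
      rw [hrank, (AdjoinRoot.powerBasis' hf).finrank, AdjoinRoot.powerBasis'_dim, hdeg]
    exact ⟨AlgEquiv.ofBijective e
      (LinearMap.bijective_of_surjective_of_finrank_eq hfin (f := e.toLinearMap) hsurj),
      AdjoinRoot.liftAlgHom_root f _ b hb⟩

end IsFrobeniusResidue

end presentation

/-! ### The different of a monogenic extension -/

section different

open BoundarySeries IsLocalRing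

theorem IsPresentedBy.aeval_eq_zero {A B : Type*} [CommRing A] [CommRing B] [Algebra A B]
    {f : A[X]} {b : B} (h : IsPresentedBy f b) : Polynomial.aeval b f = 0 := by
  obtain ⟨e, rfl⟩ := h
  rw [Polynomial.aeval_algHom_apply, AdjoinRoot.aeval_eq, AdjoinRoot.mk_self, map_zero]

theorem IsPresentedBy.adjoin_eq_top {A B : Type*} [CommRing A] [CommRing B] [Algebra A B]
    {f : A[X]} {b : B} (h : IsPresentedBy f b) : Algebra.adjoin A {b} = ⊤ := by
  obtain ⟨e, rfl⟩ := h
  have := congrArg (Subalgebra.map e.toAlgHom) (AdjoinRoot.adjoinRoot_eq_top (f := f))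
  rw [AlgHom.map_adjoin, Set.image_singleton, Algebra.map_top] at this
  exact this.trans ((AlgHom.range_eq_top _).mpr e.surjective)

theorem IsPresentedBy.minpoly_eq {A B : Type*} [CommRing A] [IsDomain A] [IsIntegrallyClosed A]
    [CommRing B] [IsDomain B] [Algebra A B] [Module.IsTorsionFree A B] {f : A[X]} (hf : f.Monic)
    {b : B} (h : IsPresentedBy f b) : minpoly A b = f := by
  have hint : IsIntegral A b := ⟨f, hf, h.aeval_eq_zero⟩
  obtain ⟨e, rfl⟩ := h
  refine (Polynomial.eq_of_monic_of_dvd_of_natDegree_le (minpoly.monic hint) hf ?_ ?_).symm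
  · exact minpoly.isIntegrallyClosed_dvd hint
      (IsPresentedBy.aeval_eq_zero ⟨e, rfl⟩)
  · refine Polynomial.natDegree_le_of_dvd ?_ (minpoly.monic hint).ne_zero
    rw [← AdjoinRoot.mk_eq_zero, ← AdjoinRoot.aeval_eq]
    apply e.injective
    rw [map_zero, ← e.coe_toAlgHom, ← Polynomial.aeval_algHom_apply]
    exact minpoly.aeval A _

/-- By integrality, denominators in the fraction field of B may be taken in A. -/
theorem Algebra.adjoin_algebraMap_eq_top_of_isFractionRing {A B : Type*} (K L : Type*)
    [CommRing A] [IsDomain A] [CommRing B] [IsDomain B] [Algebra A B] [Algebra.IsIntegral A B]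
    [Module.IsTorsionFree A B] [Field K] [Field L] [Algebra A K] [IsFractionRing A K] [Algebra B L]
    [IsFractionRing B L] [Algebra K L] [Algebra A L] [IsScalarTower A K L] [IsScalarTower A B L]
    {b : B} (h : Algebra.adjoin A {b} = ⊤) : Algebra.adjoin K {algebraMap B L b} = ⊤ := by
  have hB : ∀ y : B, algebraMap B L y ∈ Algebra.adjoin K {algebraMap B L b} := by
    intro y
    have h2 : y ∈ Algebra.adjoin A {b} := h ▸ Algebra.mem_top
    rw [Algebra.adjoin_singleton_eq_range_aeval] at h2
    obtain ⟨P, rfl⟩ := h2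
    have h3 := Polynomial.aeval_mem_adjoin_singleton K (algebraMap B L b)
      (p := P.map (algebraMap A K))
    rwa [Polynomial.aeval_map_algebraMap, Polynomial.aeval_algebraMap_apply] at h3
  have : IsLocalization (Algebra.algebraMapSubmonoid B (nonZeroDivisors A)) L := inferInstance
  rw [Algebra.eq_top_iff]
  intro x
  obtain ⟨y, s, rfl⟩ := IsLocalization.exists_mk'_eq
    (Algebra.algebraMapSubmonoid B (nonZeroDivisors A)) x
  have hs := IsLocalization.mk'_spec L y s
  obtain ⟨_, a, ha, rfl⟩ := s
  have ha0 : algebraMap A K a ≠ 0 :=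
    (map_ne_zero_iff _ (IsFractionRing.injective A K)).mpr (nonZeroDivisors.ne_zero ha)
  have h4 := Subalgebra.smul_mem _ (hB y) (algebraMap A K a)⁻¹
  rw [← hs] at h4
  rw [← IsScalarTower.algebraMap_apply A B L, IsScalarTower.algebraMap_apply A K L, mul_comm,
    ← Algebra.smul_def, inv_smul_smul₀ ha0] at h4
  exact h4

/-- The conductor of a generator is the unit ideal, so the different is generated by the derivative
of the minimal polynomial at it. -/
theorem IsPresentedBy.differentIdeal_eq {A B : Type*} [CommRing A] [IsDomain A] [CharZero A]
    [IsIntegrallyClosed A] [CommRing B] [IsDedekindDomain B] [Algebra A B] [Module.Finite A B]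
    [Module.IsTorsionFree A B] {f : A[X]} (hf : f.Monic) {b : B} (h : IsPresentedBy f b) :
    differentIdeal A B = Ideal.span {Polynomial.aeval b f.derivative} := by
  have hinj : Function.Injective (algebraMap A B) := FaithfulSMul.algebraMap_injective A B
  let := FractionRing.liftAlgebra A (FractionRing B)
  have : CharZero (FractionRing A) :=
    charZero_of_injective_algebraMap (IsFractionRing.injective A (FractionRing A))
  have : IsIntegralClosure B A (FractionRing B) := IsIntegralClosure.of_isIntegrallyClosed _ _ _
  have : Module.Finite (FractionRing A) (FractionRing B) :=
    .of_isLocalization A B (nonZeroDivisors A)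
  have := conductor_mul_differentIdeal A (FractionRing A) (FractionRing B) b
    (Algebra.adjoin_algebraMap_eq_top_of_isFractionRing _ _ h.adjoin_eq_top)
  rwa [conductor_eq_top_iff_adjoin_eq_top.mpr h.adjoin_eq_top, Ideal.top_mul,
    h.minpoly_eq hf] at this

theorem IsDiscreteValuationRing.emultiplicity_algebraMap {R B : Type*} [CommRing R] [IsDomain R]
    [IsDiscreteValuationRing R] [CommRing B] [IsDomain B] [Algebra R B] {π r : R}
    (hπ : Irreducible π) (hπB : Prime (algebraMap R B π)) (hr : r ≠ 0) :
    emultiplicity (algebraMap R B π) (algebraMap R B r) = addVal R r := by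
  obtain ⟨n, u, rfl⟩ := IsDiscreteValuationRing.eq_unit_mul_pow_irreducible hr hπ
  rw [IsDiscreteValuationRing.addVal_def' _ hπ, map_mul, map_pow,
    emultiplicity_mul hπB, emultiplicity_pow_self hπB.ne_zero hπB.not_isUnit,
    emultiplicity_eq_zero.mpr, zero_add]
  exact fun h => hπB.not_isUnit (isUnit_of_dvd_unit h (u.isUnit.map _))

theorem IsPresentedBy.differentVal_eq {R A B : Type*} [CommRing R] [IsDomain R]
    [IsDiscreteValuationRing R] [CommRing A] [IsDomain A] [CharZero A]
    [IsIntegrallyClosed A] [CommRing B] [IsDomain B] [IsDiscreteValuationRing B] [Algebra A B]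
    [Algebra R B] [Module.Finite A B]
    [Module.IsTorsionFree A B] {f : A[X]} (hf : f.Monic) {b : B} (h : IsPresentedBy f b)
    {π r : R} (hπ : Irreducible π) (hπB : Prime (algebraMap R B π)) (hr : r ≠ 0) {v : B}
    (hv : IsUnit v) (hfb : Polynomial.aeval b f.derivative = algebraMap R B r * v) :
    differentVal A (algebraMap R B π) = IsDiscreteValuationRing.addVal R r := by
  rw [differentVal, h.differentIdeal_eq hf, hfb, Ideal.span_singleton_mul_right_unit hv,
    Ideal.emultiplicity_eq_emultiplicity_span,
    IsDiscreteValuationRing.emultiplicity_algebraMap hπ hπB hr]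

end different

/-! ### The polynomial P_n -/

section polynomials

open Polynomial

variable {R : Type*} [CommRing R] [IsDomain R] {π : R} {n p : ℕ} (hp : p.Prime)
  (h : π ^ (n * (p - 1)) ∣ (p : R))

theorem isogenyPoly_natDegree (hπ : π ≠ 0) : (isogenyPoly hp h).natDegree = p := by
  have h1 := congrArg natDegree (isogenyPoly_spec hp h)
  rwa [natDegree_C_mul (pow_ne_zero _ hπ), ← C_1, natDegree_sub_C, natDegree_pow,
    natDegree_add_C, natDegree_C_mul (pow_ne_zero _ hπ), natDegree_X, mul_one] at h1

theorem isogenyPoly_derivative (hπ : π ≠ 0) {c : R} (hc : (p : R) = π ^ (n * (p - 1)) * c) :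
    derivative (isogenyPoly hp h) = C c * (C (π ^ n) * X + 1) ^ (p - 1) := by
  have h1 := congrArg derivative (isogenyPoly_spec hp h)
  rw [derivative_C_mul, derivative_sub, derivative_pow] at h1
  simp only [derivative_one, derivative_add, derivative_C_mul, derivative_X, mul_one, sub_zero,
    add_zero] at h1
  refine mul_left_cancel₀ (C_ne_zero.mpr (pow_ne_zero (p * n) hπ)) (h1.trans ?_)
  have e1 : p * n = n * (p - 1) + n := by
    obtain ⟨q, rfl⟩ : ∃ q, p = q + 1 := ⟨p - 1, by have := hp.pos; omega⟩
    simp; ring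
  rw [hc, e1, pow_add, C_mul, C_mul]
  ring

variable {A : Type*} [CommRing A] [Algebra R A]

theorem isogenyPoly_map_sub_monic (hπ : π ≠ 0) (u : A) :
    ((isogenyPoly hp h).map (algebraMap R A) - C u).Monic := by
  nontriviality A
  refine ((isogenyPoly_monic hp h).map _).sub_of_left (degree_C_le.trans_lt ?_)
  rw [(isogenyPoly_monic hp h).degree_map, degree_eq_natDegree (isogenyPoly_monic hp h).ne_zero,
    isogenyPoly_natDegree hp h hπ]
  exact_mod_cast hp.pos

theorem isogenyPoly_map_sub_natDegree [Nontrivial A] (hπ : π ≠ 0) (u : A) :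
    ((isogenyPoly hp h).map (algebraMap R A) - C u).natDegree = p := by
  rw [natDegree_sub_C, (isogenyPoly_monic hp h).natDegree_map, isogenyPoly_natDegree hp h hπ]

variable {B : Type*} [CommRing B] [Algebra R B] [Algebra A B] [IsScalarTower R A B]

theorem aeval_isogenyPoly_map_sub (u : A) (w : B) :
    aeval w ((isogenyPoly hp h).map (algebraMap R A) - C u) =
      aeval w (isogenyPoly hp h) - algebraMap A B u := by
  rw [map_sub, aeval_map_algebraMap, aeval_C]

theorem isogenyPoly_aeval (w : B) : algebraMap R B (π ^ (p * n)) * aeval w (isogenyPoly hp h) =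
    (algebraMap R B (π ^ n) * w + 1) ^ p - 1 := by
  have := congrArg (aeval w) (isogenyPoly_spec hp h)
  simpa only [map_mul, map_sub, map_pow, map_add, aeval_X, aeval_C, map_one] using this

/-- P_n reduces to X ^ p modulo π: the middle binomial terms are multiples of p π ^ n, and the
strict inequality n(p - 1) < v(p) makes this divisible by π ^ (p n + 1). With equality the reduction
would be separable. -/
theorem dvd_aeval_isogenyPoly_sub_pow [IsDomain B] (hπ : algebraMap R B π ≠ 0)
    (h' : π ^ (n * (p - 1) + 1) ∣ (p : R)) (w : B) :
    algebraMap R B π ∣ w ^ p - aeval w (isogenyPoly hp h) := by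
  obtain ⟨c, hc⟩ := h'
  obtain ⟨r, hr⟩ := exists_add_pow_prime_eq hp (algebraMap R B (π ^ n) * w) 1
  have h1 := isogenyPoly_aeval hp h w
  have hn0 : algebraMap R B (π ^ (p * n)) ≠ 0 := by
    rw [map_pow]
    exact pow_ne_zero _ hπ
  have e1 : p * n = n * (p - 1) + n := by
    obtain ⟨q, rfl⟩ : ∃ q, p = q + 1 := ⟨p - 1, by have := hp.pos; omega⟩
    simp; ring
  have e2 : (algebraMap R B (π ^ n) * w) ^ p = algebraMap R B (π ^ (p * n)) * w ^ p := by
    rw [mul_pow, ← map_pow, ← pow_mul, mul_comm n p]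
  have e3 : (p : B) * algebraMap R B (π ^ n) =
      algebraMap R B (π ^ (p * n)) * (algebraMap R B π * algebraMap R B c) := by
    rw [← map_natCast (algebraMap R B), hc, e1, ← map_mul, ← map_mul, ← map_mul]
    congr 1
    ring
  refine ⟨-(algebraMap R B c * w * r), mul_left_cancel₀ hn0 ?_⟩
  rw [hr, e2] at h1
  linear_combination h1.symm - w * r * e3

end polynomials

/-! ### Divisibilities involving ζ - 1 and π -/

section zeta

variable {R : Type*} [CommRing R] [IsDomain R] {p : ℕ} [hp : Fact p.Prime] {ζ : R}

/-- p is the product of the p - 1 factors 1 - ζ ^ k, each divisible by ζ - 1. -/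
theorem IsPrimitiveRoot.sub_one_pow_dvd (hζ : IsPrimitiveRoot ζ p) :
    (ζ - 1) ^ (p - 1) ∣ (p : R) := by
  obtain ⟨q, rfl⟩ : ∃ q, p = q + 1 := ⟨p - 1, by have := hp.out.pos; omega⟩
  have := hζ.prod_one_sub_pow_eq_order
  push_cast
  rw [← this]
  conv_lhs => rw [← Finset.card_range q, ← Finset.prod_const]
  refine Finset.prod_dvd_prod_of_dvd _ _ fun k _ => ?_
  rw [dvd_sub_comm]
  simpa using sub_dvd_pow_sub_pow ζ 1 (k + 1)

theorem IsPrimitiveRoot.pow_mul_dvd (hζ : IsPrimitiveRoot ζ p) {π : R} {n : ℕ} (h : π ^ n ∣ ζ - 1) :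
    π ^ (n * (p - 1)) ∣ (p : R) := by
  rw [pow_mul]
  exact (pow_dvd_pow_of_dvd h _).trans hζ.sub_one_pow_dvd

end zeta

section dvd

open IsDiscreteValuationRing

/-- A uniformizer of R that stays prime in B gives the same valuation on R. -/
theorem pow_dvd_of_algebraMap_dvd {R B : Type*} [CommRing R] [IsDomain R]
    [IsDiscreteValuationRing R] [CommRing B] [IsDomain B] [Algebra R B] {π r : R}
    (hπ : Irreducible π) (hπB : Prime (algebraMap R B π)) {n : ℕ}
    (h : algebraMap R B π ^ n ∣ algebraMap R B r) : π ^ n ∣ r := by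
  rcases eq_or_ne r 0 with rfl | hr
  · exact dvd_zero _
  · rw [pow_dvd_iff_le_emultiplicity] at h ⊢
    rwa [emultiplicity_algebraMap hπ hπB hr, ← emultiplicity_algebraMap
      (B := R) hπ hπ.prime hr] at h

end dvd

/-! ### Kummer theory: characters and eigenvectors -/

section kummer

open BoundarySeries IsLocalRing

theorem IsPresentedBy.eq_one {A B : Type*} [CommRing A] [CommRing B] [Algebra A B]
    {f : A[X]} {b : B} (h : IsPresentedBy f b) {σ : B ≃ₐ[A] B} (hσ : σ b = b) : σ = 1 := by
  have : (σ : B →ₐ[A] B) = AlgHom.id A B :=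
    AlgHom.ext_of_adjoin_eq_top h.adjoin_eq_top (by simpa using hσ)
  exact AlgEquiv.ext fun x => DFunLike.congr_fun this x

variable {R A B : Type*} [CommRing R] [IsDomain R] [CommRing A] [CommRing B] [IsDomain B]
  [Algebra R A] [Algebra R B] [Algebra A B] [IsScalarTower R A B]
  {p : ℕ} [hp : Fact p.Prime] {ζ : R} {G : Subgroup (B ≃ₐ[A] B)}

theorem algEquiv_algebraMap (σ : B ≃ₐ[A] B) (r : R) : σ (algebraMap R B r) = algebraMap R B r := by
  rw [IsScalarTower.algebraMap_apply R A B, σ.commutes]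

/-- σ y and y have the same p-th power u, so they differ by a power of ζ. The resulting character is
injective by `hgen`, hence bijective by counting. -/
theorem existsUnique_character (hζ : IsPrimitiveRoot ζ p)
    (hinj : Function.Injective (algebraMap R B)) (hG : Nat.card G = p) {y : B} (hy : y ≠ 0) {u : A}
    (hyu : y ^ p = algebraMap A B u) (hgen : ∀ σ : B ≃ₐ[A] B, σ y = y → σ = 1) :
    ∃! φ : G ≃* Multiplicative (ZMod p), ∀ σ : G, (σ : B ≃ₐ[A] B) y =
      algebraMap R B (ζ ^ (φ σ).toAdd.val) * y := by
  have hζB : IsPrimitiveRoot (algebraMap R B ζ) p := hζ.map_of_injective hinj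
  have hex : ∀ σ : G, ∃ a : Multiplicative (ZMod p), (σ : B ≃ₐ[A] B) y =
      algebraMap R B (rootHom hζ.pow_eq_one a) * y := by
    intro σ
    have h1 : ((σ : B ≃ₐ[A] B) y) ^ p = y ^ p := by
      rw [← map_pow, hyu, AlgEquiv.commutes]
    have h2 : ∏ ξ ∈ Polynomial.nthRootsFinset p (1 : B), ((σ : B ≃ₐ[A] B) y - ξ * y) = 0 := by
      rw [← hζB.pow_sub_pow_eq_prod_sub_mul _ _ hp.out.pos, h1, sub_self]
    obtain ⟨ξ, hξ, hξy⟩ := Finset.prod_eq_zero_iff.mp h2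
    rw [Polynomial.mem_nthRootsFinset hp.out.pos] at hξ
    obtain ⟨i, hi, rfl⟩ := hζB.eq_pow_of_pow_eq_one hξ
    refine ⟨.ofAdd (i : ZMod p), ?_⟩
    rw [rootHom_apply, toAdd_ofAdd, ZMod.val_cast_of_lt hi, map_pow]
    exact sub_eq_zero.mp hξy
  choose φ hφ using hex
  have hχ : ∀ a b : Multiplicative (ZMod p),
      algebraMap R B (rootHom hζ.pow_eq_one a) * y = algebraMap R B (rootHom hζ.pow_eq_one b) * y →
        a = b :=
    fun a b h => rootHom_injective hζ (hinj (mul_right_cancel₀ hy h))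
  let φ' : G →* Multiplicative (ZMod p) :=
    { toFun := φ
      map_one' := hχ _ _ (by rw [← hφ, map_one, map_one, one_mul]; rfl)
      map_mul' := fun σ τ => hχ _ _ (by
        rw [← hφ, map_mul, map_mul, mul_assoc, Subgroup.coe_mul, AlgEquiv.mul_apply, hφ τ, map_mul,
          algEquiv_algebraMap, hφ σ]
        ring) }
  have hφ' : Function.Injective φ' := by
    rw [injective_iff_map_eq_one]
    intro σ hσ
    have h1 : (σ : B ≃ₐ[A] B) y = y := by
      have h2 := hφ σ
      rwa [show φ σ = 1 from hσ, map_one, map_one, one_mul] at h2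
    exact Subtype.ext (hgen _ h1)
  have : Finite G := Nat.finite_of_card_ne_zero (hG ▸ hp.out.ne_zero)
  have hbij : Function.Bijective φ' := by
    refine (Nat.bijective_iff_injective_and_card _).mpr ⟨hφ', ?_⟩
    rw [hG]
    exact (Nat.card_zmod p).symm
  refine ⟨MulEquiv.ofBijective φ' hbij, hφ, fun ψ hψ => ?_⟩
  ext1 σ
  exact hχ _ _ ((hψ σ).symm.trans (hφ σ))

/-- Existence of an eigenvector for a character of the group. -/
theorem exists_eigenvector (hζ : ζ ^ p = 1) (hG : Nat.card G = p)
    (φ : G ≃* Multiplicative (ZMod p)) :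
    ∃ y : B, y ≠ 0 ∧ ∀ σ : G, (σ : B ≃ₐ[A] B) y = algebraMap R B (ζ ^ (φ σ).toAdd.val) * y := by
  have : Finite G := Nat.finite_of_card_ne_zero (hG ▸ hp.out.ne_zero)
  have := Fintype.ofFinite G
  let χ : G →* B := (algebraMap R B : R →* B).comp ((rootHom hζ).comp φ.toMonoidHom)
  have hli : LinearIndependent B fun σ : G => ((σ : B ≃ₐ[A] B) : B → B) := by
    have h1 := linearIndependent_monoidHom B B
    refine h1.comp (fun σ : G => ((σ : B ≃ₐ[A] B) : B →* B)) fun σ τ h => ?_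
    exact Subtype.ext (AlgEquiv.ext fun x => DFunLike.congr_fun h x)
  -- Lagrange resolvent: it is a nonzero map by Dedekind's independence of characters, and each of
  -- its values is an eigenvector.
  have hne : ∑ σ : G, χ σ⁻¹ • ((σ : B ≃ₐ[A] B) : B → B) ≠ 0 := by
    intro h0
    have := Fintype.linearIndependent_iff.mp hli (fun σ => χ σ⁻¹) h0 1
    rw [inv_one, map_one] at this
    exact one_ne_zero this
  obtain ⟨b, hb⟩ := Function.ne_iff.mp hne
  rw [Finset.sum_apply] at hb
  refine ⟨_, hb, fun σ => ?_⟩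
  change _ = χ σ * _
  rw [map_sum, Finset.mul_sum]
  refine Fintype.sum_equiv (Equiv.mulLeft σ) _ _ fun τ => ?_
  have h1 : (σ : B ≃ₐ[A] B) (χ τ⁻¹) = χ τ⁻¹ := algEquiv_algebraMap _ _
  have h2 : χ σ * χ (σ * τ)⁻¹ = χ τ⁻¹ := by
    rw [mul_inv_rev, map_mul, mul_left_comm, ← map_mul, mul_inv_cancel, map_one, mul_one]
  rw [Pi.smul_apply, Pi.smul_apply, smul_eq_mul, smul_eq_mul, map_mul, h1, Equiv.coe_mulLeft,
    ← mul_assoc, h2]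
  rfl

end kummer

/-! ### Kummer generators and the valuation of the different -/

section generators

open BoundarySeries IsLocalRing

namespace IsFrobeniusResidue

variable {R : Type*} [CommRing R] [IsDomain R] [IsDiscreteValuationRing R]
  [IsAdicComplete (maximalIdeal R) R]
  {B : Type*} [CommRing B] [IsDomain B] [Algebra R B] [Algebra (BoundarySeries R) B]
  [IsScalarTower R (BoundarySeries R) B]
  {p : ℕ} [hp : Fact p.Prime] [IsAlgClosed (ResidueField R)] [CharP (ResidueField R) p]
  {π : R} {Φ : B →+* LaurentSeries (ResidueField R)}
  [IsAdicComplete (Ideal.span {algebraMap R B π}) B]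
  {ζ : R} {G : Subgroup (B ≃ₐ[BoundarySeries R] B)}

/-- Powers of π are fixed by G, so they may be divided out of an eigenvector. -/
theorem exists_unit_eigenvector (hΦ : IsFrobeniusResidue π p Φ) (hπ : Irreducible π)
    (hπB : algebraMap R B π ≠ 0) (hζ : ζ ^ p = 1) (hG : Nat.card G = p)
    (φ : G ≃* Multiplicative (ZMod p)) :
    ∃ y : B, IsUnit y ∧ ∀ σ : G, (σ : B ≃ₐ[BoundarySeries R] B) y =
      algebraMap R B (ζ ^ (φ σ).toAdd.val) * y := by
  obtain ⟨y, hy, hσ⟩ := exists_eigenvector (R := R) hζ hG φ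
  obtain ⟨n, z, rfl, hz⟩ := exists_eq_pow_mul_of_isHausdorff (ϖ := algebraMap R B π) hy
  refine ⟨z, (hΦ.isUnit_iff hπ).mpr (mt (hΦ.eq_zero_iff z).mp hz), fun σ => ?_⟩
  have h1 := hσ σ
  rw [map_mul, map_pow, algEquiv_algebraMap, mul_left_comm] at h1
  exact mul_left_cancel₀ (pow_ne_zero _ hπB) h1

/-- A character of `G` is afforded by a unit `y` whose residue is not a `p`-th power, or by a
unit `π ^ n w + 1` such that the residue of `w` is not a `p`-th power. -/
theorem exists_kummer (hΦ : IsFrobeniusResidue π p Φ) (hπ : Irreducible π)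
    (hπB : Prime (algebraMap R B π)) (hζ : IsPrimitiveRoot ζ p) (hG : Nat.card G = p)
    (φ : G ≃* Multiplicative (ZMod p)) :
    ∃ n : ℕ, π ^ n ∣ ζ - 1 ∧ ∃ y w : B, (∀ σ : G, (σ : B ≃ₐ[BoundarySeries R] B) y =
      algebraMap R B (ζ ^ (φ σ).toAdd.val) * y) ∧
      ((n = 0 ∧ ∀ g, Φ y ≠ g ^ p) ∨
        (0 < n ∧ y = algebraMap R B (π ^ n) * w + 1 ∧ ∀ g, Φ w ≠ g ^ p)) := by
  classical
  obtain ⟨y, hy, hσ⟩ := hΦ.exists_unit_eigenvector hπ hπB.ne_zero hζ.pow_eq_one hG φ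
  -- P n: y can be approximated by an element of A modulo π ^ n. The largest such n is the one
  -- sought.
  let P : ℕ → Prop := fun n => ∃ a : BoundarySeries R,
    algebraMap R B π ^ n ∣ y - algebraMap _ B a
  -- Take σ with σ y = ζ y; it fixes the approximation a, so π ^ n divides (ζ - 1) y, and y is a
  -- unit.
  have hP : ∀ n, P n → π ^ n ∣ ζ - 1 := by
    rintro n ⟨a, ha⟩
    obtain ⟨σ, hσ1⟩ := φ.surjective (.ofAdd 1)
    have h1 := map_dvd (σ : B ≃ₐ[BoundarySeries R] B) ha
    rw [map_pow, algEquiv_algebraMap, map_sub, AlgEquiv.commutes, hσ σ, hσ1, toAdd_ofAdd,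
      ZMod.val_one'' hp.out.one_lt.ne', pow_one] at h1
    have h2 : algebraMap R B π ^ n ∣ algebraMap R B (ζ - 1) * y := by
      have := dvd_sub h1 ha
      rwa [sub_sub_sub_cancel_right, ← sub_one_mul, ← map_one (algebraMap R B), ← map_sub] at this
    exact pow_dvd_of_algebraMap_dvd hπ hπB (hy.dvd_mul_right.mp h2)
  have hζ1 : ζ - 1 ≠ 0 := sub_ne_zero.mpr (hζ.ne_one hp.out.one_lt)
  obtain ⟨M, hM⟩ : ∃ M : ℕ, ∀ n, P n → n ≤ M := by
    have hfin := FiniteMultiplicity.of_prime_left hπ.prime hζ1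
    exact ⟨multiplicity π (ζ - 1), fun n hn => hfin.le_multiplicity_of_pow_dvd (hP n hn)⟩
  have h0 : P 0 := ⟨0, by simp⟩
  set N := Nat.findGreatest P M with hN
  have hPN : P N := Nat.findGreatest_spec (Nat.zero_le M) h0
  have hmax : ¬ P (N + 1) := fun h => by
    have := Nat.le_findGreatest (hM _ h) h
    omega
  have hdiv := hP N hPN
  rcases Nat.eq_zero_or_pos N with hN0 | hN0
  · refine ⟨0, by simp, y, 0, hσ, Or.inl ⟨rfl, fun g hg => hmax ?_⟩⟩
    obtain ⟨a, ha⟩ := residue_surjective g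
    refine ⟨a, ?_⟩
    rw [hN0, zero_add, pow_one, ← hΦ.eq_iff, hΦ.map_algebraMap, ha, hg]
  · obtain ⟨a, w, hw⟩ := hPN
    have ha : IsUnit a := by
      rw [isUnit_iff_residue_ne_zero]
      intro h1
      have h2 : Φ y = Φ (algebraMap _ B a) :=
        hΦ.eq_iff.mpr ((dvd_pow_self _ hN0.ne').trans ⟨w, hw⟩)
      rw [hΦ.map_algebraMap, h1, zero_pow hp.out.ne_zero] at h2
      exact (hΦ.isUnit_iff hπ).mp hy h2
    obtain ⟨a, rfl⟩ := ha
    -- With c = a⁻¹, the relation y = a + π ^ N w becomes c y = 1 + π ^ N (c w).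
    set c : B := algebraMap _ B ((a⁻¹ : (BoundarySeries R)ˣ) : BoundarySeries R) with hc
    have hca : c * algebraMap _ B (a : BoundarySeries R) = 1 := by
      rw [hc, ← map_mul, Units.inv_mul, map_one]
    refine ⟨N, hdiv, c * y, c * w, fun σ => ?_, Or.inr ⟨hN0, ?_, fun g hg => hmax ?_⟩⟩
    · rw [map_mul, hσ σ, hc, AlgEquiv.commutes]
      ring
    · rw [map_pow]
      linear_combination c * hw + hca
    -- If c w ≡ d modulo π with d in A, then a (1 + π ^ N d) approximates y modulo π ^ (N + 1),
    -- against maximality.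
    · obtain ⟨d, rfl⟩ := residue_surjective g
      rw [← hΦ.map_algebraMap, hΦ.eq_iff] at hg
      obtain ⟨v, hv⟩ := hg
      refine ⟨a * (1 + algebraMap R _ π ^ N * d), v * algebraMap _ B (a : BoundarySeries R), ?_⟩
      rw [map_mul, map_add, map_mul, map_pow, map_one,
        ← IsScalarTower.algebraMap_apply R (BoundarySeries R) B]
      linear_combination hw + algebraMap R B π ^ N * algebraMap _ B (a : BoundarySeries R) * hv -
        algebraMap R B π ^ N * w * hca

section

variable [Module.Finite (BoundarySeries R) B] [Module.Free (BoundarySeries R) B]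

/-- Replaces the presentation by conditions that can be checked on y and Φ y; this is the form used
to change equations. -/
theorem isMultiplicativePresentation_iff (hΦ : IsFrobeniusResidue π p Φ) (hπ : Irreducible π)
    (hrank : Module.finrank (BoundarySeries R) B = p) (φ : G ≃* Multiplicative (ZMod p))
    (u : (BoundarySeries R)ˣ) (y : B) :
    IsMultiplicativePresentation ζ φ u y ↔
      y ^ p = algebraMap _ B (u : BoundarySeries R) ∧ (∀ g, Φ y ≠ g ^ p) ∧
      ∀ σ : G, (σ : B ≃ₐ[BoundarySeries R] B) y =
        algebraMap R B (ζ ^ (φ σ).toAdd.val) * y := by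
  have hmon : (Polynomial.X ^ p - Polynomial.C (u : BoundarySeries R)).Monic :=
    Polynomial.monic_X_pow_sub_C _ hp.out.ne_zero
  have key : Polynomial.aeval y (Polynomial.X ^ p - Polynomial.C (u : BoundarySeries R)) = 0 ↔
      y ^ p = algebraMap _ B (u : BoundarySeries R) := by
    simp [sub_eq_zero]
  have hpres := fun h => hΦ.isPresentedBy_iff hπ hrank hmon Polynomial.natDegree_X_pow_sub_C
    (b := y) (key.mpr h)
  constructor
  · rintro ⟨h1, h2⟩
    have h3 := key.mp h1.aeval_eq_zero
    exact ⟨h3, (hpres h3).mp h1, h2⟩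
  · rintro ⟨h1, h2, h3⟩
    exact ⟨(hpres h1).mpr h2, h3⟩

theorem isAdditivePresentation_iff (hΦ : IsFrobeniusResidue π p Φ) (hπ : Irreducible π)
    (hrank : Module.finrank (BoundarySeries R) B = p) {n : ℕ} (h : π ^ (n * (p - 1)) ∣ (p : R))
    (φ : G ≃* Multiplicative (ZMod p)) (u : BoundarySeries R) (w : B) :
    IsAdditivePresentation hp.out h ζ φ u w ↔
      Polynomial.aeval w (isogenyPoly hp.out h) = algebraMap _ B u ∧ (∀ g, Φ w ≠ g ^ p) ∧
      ∀ σ : G, (σ : B ≃ₐ[BoundarySeries R] B) (algebraMap R B (π ^ n) * w + 1) =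
        algebraMap R B (ζ ^ (φ σ).toAdd.val) * (algebraMap R B (π ^ n) * w + 1) := by
  have hmon := isogenyPoly_map_sub_monic hp.out h hπ.ne_zero u
  have key : Polynomial.aeval w ((isogenyPoly hp.out h).map (algebraMap R (BoundarySeries R)) -
      Polynomial.C u) = 0 ↔ Polynomial.aeval w (isogenyPoly hp.out h) = algebraMap _ B u := by
    rw [aeval_isogenyPoly_map_sub, sub_eq_zero]
  have hpres := fun h' => hΦ.isPresentedBy_iff hπ hrank hmon
    (isogenyPoly_map_sub_natDegree hp.out h hπ.ne_zero u) (b := w) (key.mpr h')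
  constructor
  · rintro ⟨h1, h2⟩
    have h3 := key.mp h1.aeval_eq_zero
    exact ⟨h3, (hpres h3).mp h1, h2⟩
  · rintro ⟨h1, h2, h3⟩
    exact ⟨(hpres h1).mpr h2, h3⟩

theorem isUnit_mul_add_one (hΦ : IsFrobeniusResidue π p Φ) (hπ : Irreducible π) {n : ℕ}
    (hn : 0 < n) (w : B) :
    IsUnit (algebraMap R B (π ^ n) * w + 1) := by
  rw [hΦ.isUnit_iff hπ, map_add, map_one, (hΦ.eq_zero_iff _).mpr, zero_add]
  · exact one_ne_zero
  · rw [map_pow]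
    exact dvd_mul_of_dvd_left (dvd_pow_self _ hn.ne') _

theorem differentVal_of_isPresentedBy_pow (hπ : Irreducible π) [CharZero R]
    [IsDiscreteValuationRing B]
    [Module.IsTorsionFree (BoundarySeries R) B] (hπB : Prime (algebraMap R B π))
    {u : (BoundarySeries R)ˣ} {y : B}
    (h : IsPresentedBy (Polynomial.X ^ p - Polynomial.C (u : BoundarySeries R)) y) :
    differentVal (BoundarySeries R) (algebraMap R B π) =
      IsDiscreteValuationRing.addVal R (p : R) := by
  have : CharZero (BoundarySeries R) :=
    charZero_of_injective_algebraMap BoundarySeries.algebraMap_injective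
  have hy : y ^ p = algebraMap _ B (u : BoundarySeries R) := by
    have := h.aeval_eq_zero
    simpa [sub_eq_zero] using this
  have hyu : IsUnit y := by
    rw [← isUnit_pow_iff hp.out.ne_zero, hy]
    exact u.isUnit.map _
  refine h.differentVal_eq (Polynomial.monic_X_pow_sub_C _ hp.out.ne_zero) hπ hπB
    (Nat.cast_ne_zero.mpr hp.out.ne_zero) (hyu.pow (p - 1)) ?_
  simp [Polynomial.derivative_X_pow]

/-- Writing p = π ^ (n(p - 1)) c, the derivative of P_n at w is c times a power of the unit π ^ n w
+ 1, so the different has valuation v(c). -/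
theorem differentVal_of_isPresentedBy_isogenyPoly (hΦ : IsFrobeniusResidue π p Φ)
    (hπ : Irreducible π)
    [CharZero R] [IsDiscreteValuationRing B]
    [Module.IsTorsionFree (BoundarySeries R) B] (hπB : Prime (algebraMap R B π)) {n : ℕ}
    (hn : 0 < n) (h : π ^ (n * (p - 1)) ∣ (p : R)) {u : BoundarySeries R} {w : B}
    (hw : IsPresentedBy ((isogenyPoly hp.out h).map (algebraMap R (BoundarySeries R)) -
      Polynomial.C u) w) :
    IsDiscreteValuationRing.addVal R (p : R) =
      differentVal (BoundarySeries R) (algebraMap R B π) + (n * (p - 1) : ℕ) := by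
  have : CharZero (BoundarySeries R) :=
    charZero_of_injective_algebraMap BoundarySeries.algebraMap_injective
  have h' := h
  obtain ⟨c, hc⟩ := h'
  have hp0 : (p : R) ≠ 0 := Nat.cast_ne_zero.mpr hp.out.ne_zero
  have hc0 : c ≠ 0 := right_ne_zero_of_mul (hc ▸ hp0)
  rw [hw.differentVal_eq (isogenyPoly_map_sub_monic hp.out h hπ.ne_zero u) hπ hπB hc0
    ((hΦ.isUnit_mul_add_one hπ hn w).pow (p - 1)) ?_, hc, AddValuation.map_mul,
    AddValuation.map_pow, IsDiscreteValuationRing.addVal_uniformizer hπ, add_comm]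
  · simp
  · rw [Polynomial.derivative_sub, Polynomial.derivative_C, sub_zero, Polynomial.derivative_map,
      isogenyPoly_derivative hp.out h hπ.ne_zero hc, Polynomial.aeval_map_algebraMap]
    simp

theorem map_eq_residue_of_pow_eq (hΦ : IsFrobeniusResidue π p Φ) {u : BoundarySeries R} {y : B}
    (h : y ^ p = algebraMap _ B u) : Φ y = residue u :=
  hΦ.dvd_pow_sub.mp (by rw [h, sub_self]; exact dvd_zero _)

/-- Since P_n(w) ≡ w ^ p modulo π, the equation has the reduction of w ^ p = u. -/
theorem map_eq_residue_of_aeval_eq (hΦ : IsFrobeniusResidue π p Φ)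
    (hπB : algebraMap R B π ≠ 0) {n : ℕ}
    (h : π ^ (n * (p - 1)) ∣ (p : R)) (h' : π ^ (n * (p - 1) + 1) ∣ (p : R))
    {u : BoundarySeries R} {w : B}
    (hw : Polynomial.aeval w (isogenyPoly hp.out h) = algebraMap _ B u) : Φ w = residue u :=
  hΦ.dvd_pow_sub.mp (hw ▸ dvd_aeval_isogenyPoly_sub_pow hp.out h hπB h' w)

end

end IsFrobeniusResidue

end generators

/-! ### Torsors tested on a generator -/

section torsor

variable {R A B H : Type*} [CommRing R] [CommRing A] [CommRing B] [Algebra R A] [Algebra R B]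
  [Algebra A B] [IsScalarTower R A B] [CommRing H]

theorem IsPresentedBy.exists_algHom {S : Type*} [CommRing S] [Algebra A S] {f : A[X]} {b : B}
    (h : IsPresentedBy f b) {s : S} (hs : Polynomial.aeval s f = 0) :
    ∃ ρ : B →ₐ[A] S, ρ b = s := by
  obtain ⟨e, rfl⟩ := h
  refine ⟨(AdjoinRoot.liftAlgHom f (Algebra.ofId A S) s hs).comp e.symm.toAlgHom, ?_⟩
  rw [AlgHom.comp_apply]
  exact (congrArg _ (e.symm_apply_apply _)).trans (AdjoinRoot.liftAlgHom_root f _ s hs)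

theorem IsPresentedBy.hom_ext {S : Type*} [CommRing S] [Algebra R S] {f : A[X]} {b : B}
    (h : IsPresentedBy f b) {φ ψ : B →ₐ[R] S}
    (hA : ∀ a, φ (algebraMap A B a) = ψ (algebraMap A B a)) (hb : φ b = ψ b) : φ = ψ := by
  ext x
  have hx : x ∈ Algebra.adjoin A {b} := h.adjoin_eq_top ▸ Algebra.mem_top
  induction hx using Algebra.adjoin_induction with
  | mem y hy => rw [Set.mem_singleton_iff.mp hy, hb]
  | algebraMap a => exact hA a
  | add y z _ _ hy hz => rw [map_add, map_add, hy, hz]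
  | mul y z _ _ hy hz => rw [map_mul, map_mul, hy, hz]

/-- To be a torsor can be tested on a generator. -/
theorem IsPresentedBy.isTorsor [HopfAlgebra R H] [Module.Free R H] [Module.Finite R H]
    [Nontrivial B] [IsNoetherianRing A] {f : A[X]} (hf : f.Monic) {b : B} (h : IsPresentedBy f b)
    [Nontrivial R] (hdeg : Module.finrank R H = f.natDegree) {x : H} (hx : Algebra.adjoin R {x} = ⊤)
    (ρ : B →ₐ[A] B ⊗[R] H)
    (hcoassoc : Algebra.TensorProduct.assoc R R R B H H
        (Algebra.TensorProduct.map (ρ.restrictScalars R) (.id R H) (ρ b)) =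
      Algebra.TensorProduct.map (.id R B) (Bialgebra.comulAlgHom R H) (ρ b))
    (hcounit : Algebra.TensorProduct.map (.id R B) (Bialgebra.counitAlgHom R H) (ρ b) = b ⊗ₜ 1)
    (hsurj : ∃ v : B, v • (ρ b - b ⊗ₜ 1) = 1 ⊗ₜ x ∨ v • ρ b = 1 ⊗ₜ x) :
    IsTorsor ρ := by
  have hρ : ∀ a : A, ρ (algebraMap A B a) = algebraMap A B a ⊗ₜ 1 := fun a => ρ.commutes a
  have : Nontrivial A := (algebraMap A B).domain_nontrivial
  obtain ⟨e, he⟩ := id h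
  have : Module.Free A (AdjoinRoot f) := hf.free_adjoinRoot
  have : Module.Finite A (AdjoinRoot f) := hf.finite_adjoinRoot
  have : Module.Free A B := Module.Free.of_equiv e.toLinearEquiv
  have : Module.Finite A B := Module.Finite.equiv e.toLinearEquiv
  refine ⟨h.hom_ext (fun a => ?_) hcoassoc, h.hom_ext (fun a => ?_) ?_, inferInstance,
    Algebra.FinitePresentation.of_finiteType.mp inferInstance, ?_⟩
  · simp [hρ, Algebra.TensorProduct.one_def]
  · simp [hρ]
  · simpa using hcounit
  -- The image of L contains 1 ⊗ x by `hsurj`, and x generates H, so L is onto. Source and target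
  -- are free over B of the same rank, hence L is bijective.
  · let L : B ⊗[A] B →ₐ[B] B ⊗[R] H := Algebra.TensorProduct.lift
      (Algebra.TensorProduct.includeLeft : B →ₐ[B] B ⊗[R] H) ρ (fun _ _ => Commute.all _ _)
    have hL : ∀ z : B, L (1 ⊗ₜ z) = ρ z := fun z => by
      simp [L, ← Algebra.TensorProduct.one_def]
    have hLb : ∀ z : B, algebraMap B (B ⊗[R] H) z ∈ L.range := fun z =>
      Subalgebra.algebraMap_mem _ z
    have hLx : (1 : B) ⊗ₜ[R] x ∈ L.range := by
      have h1 : ρ b ∈ L.range := ⟨_, hL b⟩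
      obtain ⟨v, hv | hv⟩ := hsurj
      · exact hv ▸ Subalgebra.smul_mem _ (sub_mem h1 (hLb b)) v
      · exact hv ▸ Subalgebra.smul_mem _ h1 v
    have hLH : ∀ y : H, (1 : B) ⊗ₜ[R] y ∈ L.range := by
      intro y
      have hy : y ∈ Algebra.adjoin R {x} := hx ▸ Algebra.mem_top
      have h2 : Algebra.adjoin R {x} ≤ (L.range.restrictScalars R).comap
          (Algebra.TensorProduct.includeRight : H →ₐ[R] B ⊗[R] H) := by
        refine Algebra.adjoin_le ?_
        rw [Set.singleton_subset_iff]
        exact hLx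
      exact h2 hy
    have hLs : Function.Surjective L := by
      intro z
      induction z using TensorProduct.induction_on with
      | zero => exact ⟨0, map_zero _⟩
      | tmul z y =>
        have h3 := Subalgebra.smul_mem _ (hLH y) z
        rwa [TensorProduct.smul_tmul', smul_eq_mul, mul_one] at h3
      | add y z hy hz =>
        obtain ⟨y, rfl⟩ := hy
        obtain ⟨z, rfl⟩ := hz
        exact ⟨y + z, map_add _ _ _⟩
    have hfin : Module.finrank B (B ⊗[A] B) = Module.finrank B (B ⊗[R] H) := by
      rw [Module.finrank_baseChange, Module.finrank_baseChange, hdeg, ← e.toLinearEquiv.finrank_eq,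
        (AdjoinRoot.powerBasis' hf).finrank, AdjoinRoot.powerBasis'_dim]
    exact LinearMap.bijective_of_surjective_of_finrank_eq hfin (f := L.toLinearMap) hLs

theorem pointAction_eq [Algebra R H] {f : A[X]} {b : B} (h : IsPresentedBy f b)
    (ρ : B →ₐ[A] B ⊗[R] H) (g : H →ₐ[R] R) (σ : B ≃ₐ[A] B) (hb : pointAction ρ g b = σ b) (x : B) :
    pointAction ρ g x = σ x := by
  have hρ : ∀ a : A, ρ (algebraMap A B a) = algebraMap A B a ⊗ₜ 1 := fun a => ρ.commutes a
  have : pointAction ρ g = (σ : B →ₐ[A] B).restrictScalars R :=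
    h.hom_ext (fun a => by simp [pointAction, hρ]) hb
  exact DFunLike.congr_fun this x

end torsor

/-! ### The μ_p-torsor -/

section mu

theorem MuRing.x_pow (R : Type*) [CommRing R] (p i : ℕ) :
    MuRing.x R p ^ i = MonoidAlgebra.single (.ofAdd (i : ZMod p)) 1 := by
  rw [MuRing.x, ← map_pow, MonoidAlgebra.of_apply, ← ofAdd_nsmul, nsmul_one]

theorem MuRing.adjoin_x (R : Type*) [CommRing R] (p : ℕ) [hp : Fact p.Prime] :
    Algebra.adjoin R {MuRing.x R p} = ⊤ := by
  rw [Algebra.eq_top_iff]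
  intro h
  induction h using MonoidAlgebra.induction_on with
  | of a =>
    have := MuRing.x_pow R p a.toAdd.val
    rw [ZMod.natCast_zmod_val, ofAdd_toAdd] at this
    rw [MonoidAlgebra.of_apply, ← this]
    exact pow_mem (Algebra.self_mem_adjoin_singleton _ _) _
  | add a b ha hb => exact add_mem ha hb
  | smul r a ha => exact Subalgebra.smul_mem _ ha r

variable {R A B : Type*} [CommRing R] [CommRing A] [CommRing B] [Algebra R A] [Algebra R B]
  [Algebra A B] [IsScalarTower R A B] [Nontrivial R] [Nontrivial B] [IsNoetherianRing A] {p : ℕ}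
  [hp : Fact p.Prime] {ζ : R} {G : Subgroup (B ≃ₐ[A] B)}

/-- The coaction is y ↦ y ⊗ x, compatible with y ^ p = u because x ^ p = 1; invertibility of y
recovers 1 ⊗ x. -/
theorem IsMultiplicativePresentation.exists_isTorsor (hζ : ζ ^ p = 1)
    {φ : G ≃* Multiplicative (ZMod p)} {u : Aˣ} {y : B}
    (h : IsMultiplicativePresentation ζ φ u y) :
    ∃ ρ : B →ₐ[A] B ⊗[R] MuRing R p, IsTorsor ρ ∧
      ∀ σ : G, ∃ g : MuRing R p →ₐ[R] R, g (MuRing.x R p) = ζ ^ (φ σ).toAdd.val ∧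
        ∀ b : B, pointAction ρ g b = (σ : B ≃ₐ[A] B) b := by
  have hpr := h.isPresentedBy
  have : Nontrivial A := (algebraMap A B).domain_nontrivial
  have hy : y ^ p = algebraMap A B u := by
    have := hpr.aeval_eq_zero
    simpa [sub_eq_zero] using this
  have hyu : IsUnit y := by
    rw [← isUnit_pow_iff hp.out.ne_zero, hy]
    exact u.isUnit.map _
  have hxp : MuRing.x R p ^ p = 1 := by
    rw [MuRing.x_pow, ZMod.natCast_self]
    rfl
  obtain ⟨ρ, hρ⟩ := hpr.exists_algHom (s := y ⊗ₜ[R] MuRing.x R p) (by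
    rw [map_sub, map_pow, Polynomial.aeval_X, Polynomial.aeval_C, Algebra.TensorProduct.tmul_pow,
      hxp, hy, sub_eq_zero]
    rfl)
  refine ⟨ρ, hpr.isTorsor (Polynomial.monic_X_pow_sub_C _ hp.out.ne_zero) ?_ (MuRing.adjoin_x R p) ρ
    ?_ ?_ ?_, fun σ => ?_⟩
  · rw [Polynomial.natDegree_X_pow_sub_C, Module.finrank_eq_nat_card_basis
      (MonoidAlgebra.basis _ _)]
    exact Nat.card_zmod p
  · rw [hρ]
    simp [hρ, MuRing.x]
  · rw [hρ]
    simp [MuRing.x]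
  · obtain ⟨v, hv⟩ := hyu.exists_left_inv
    refine ⟨v, Or.inr ?_⟩
    rw [hρ, TensorProduct.smul_tmul', smul_eq_mul, hv]
  · have hz : (ζ ^ (φ σ).toAdd.val) ^ p = 1 := by rw [pow_right_comm, hζ, one_pow]
    have hg : MonoidAlgebra.lift R R _ (rootHom hz) (MuRing.x R p) = ζ ^ (φ σ).toAdd.val := by
      rw [MuRing.x, MonoidAlgebra.lift_of, rootHom_apply, toAdd_ofAdd,
        ZMod.val_one'' hp.out.one_lt.ne', pow_one]
    refine ⟨_, hg, pointAction_eq hpr ρ _ _ ?_⟩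
    rw [h.action σ, pointAction]
    simp only [AlgHom.comp_apply, AlgHom.restrictScalars_apply, hρ,
      Algebra.TensorProduct.map_tmul, hg]
    simp [Algebra.smul_def]

end mu

/-! ### The ℋ_n-torsor -/

section additive

variable {R A B : Type*} [CommRing R] [IsDomain R] [CommRing A] [CommRing B] [Algebra R A]
  [Algebra R B] [Algebra A B] [IsScalarTower R A B] [IsDomain B] [IsNoetherianRing A] {p : ℕ}
  [hp : Fact p.Prime] {ζ : R} {G : Subgroup (B ≃ₐ[A] B)}

/-- The coaction is chosen so that π ^ n w + 1 goes to (π ^ n w + 1) ⊗ (π ^ n x + 1), the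
multiplicative coaction rescaled by π ^ n. -/
theorem IsAdditivePresentation.exists_isTorsor [Module.Flat R B] {π : R} (hπ : π ≠ 0)
    {n : ℕ} (hn : π ^ (n * (p - 1)) ∣ (p : R)) (hζn : π ^ n ∣ ζ - 1)
    (hζ : ζ ^ p = 1) {φ : G ≃* Multiplicative (ZMod p)} {u : A} {w : B}
    (hw : IsUnit (algebraMap R B (π ^ n) * w + 1))
    (h : IsAdditivePresentation hp.out hn ζ φ u w) :
    ∃ ρ : B →ₐ[A] B ⊗[R] HRing hπ hp.out hn, IsTorsor ρ ∧
      ∀ σ : G, ∃ g : HRing hπ hp.out hn →ₐ[R] R,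
        π ^ n * g (HRing.x hπ hp.out hn) + 1 = ζ ^ (φ σ).toAdd.val ∧
        ∀ b : B, pointAction ρ g b = (σ : B ≃ₐ[A] B) b := by
  have hpr := h.isPresentedBy
  have hmon := isogenyPoly_map_sub_monic hp.out hn hπ u
  have : Nontrivial A := (algebraMap A B).domain_nontrivial
  have hπn : π ^ n ≠ 0 := pow_ne_zero _ hπ
  have hw0 : Polynomial.aeval w (isogenyPoly hp.out hn) = algebraMap A B u := by
    have := hpr.aeval_eq_zero
    rwa [aeval_isogenyPoly_map_sub, sub_eq_zero] at this
  set x := HRing.x hπ hp.out hn with hx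
  set s : B ⊗[R] HRing hπ hp.out hn := w ⊗ₜ 1 + 1 ⊗ₜ x + π ^ n • (w ⊗ₜ x) with hs
  have hs1 : algebraMap R _ (π ^ n) * s + 1 =
      (algebraMap R B (π ^ n) * w + 1) ⊗ₜ[R] (algebraMap R _ (π ^ n) * x + 1) := by
    simp only [hs, ← Algebra.smul_def, TensorProduct.add_tmul, TensorProduct.tmul_add, smul_add,
      TensorProduct.smul_tmul', TensorProduct.tmul_smul, Algebra.TensorProduct.one_def]
    abel
  have hs0 : Polynomial.aeval s (isogenyPoly hp.out hn) = algebraMap A B u ⊗ₜ 1 := by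
    have h1 := isogenyPoly_aeval hp.out hn s
    rw [hs1, Algebra.TensorProduct.tmul_pow, HRing.pow_eq_one, Algebra.TensorProduct.one_def,
      ← TensorProduct.sub_tmul, ← isogenyPoly_aeval hp.out hn w, hw0, ← Algebra.smul_def,
      ← Algebra.smul_def, ← TensorProduct.smul_tmul'] at h1
    -- B is flat and the coordinate ring is free over R, so π ^ (p n) can be cancelled in the tensor
    -- product.
    exact smul_right_injective _ (pow_ne_zero _ hπ) h1
  obtain ⟨ρ, hρ⟩ := hpr.exists_algHom (s := s) (by
    rw [aeval_isogenyPoly_map_sub, hs0, sub_eq_zero]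
    rfl)
  have : Module.Finite R (HRing hπ hp.out hn) := (isogenyPoly_monic hp.out hn).finite_adjoinRoot
  refine ⟨ρ, hpr.isTorsor hmon ?_ (x := x) AdjoinRoot.adjoinRoot_eq_top ρ ?_ ?_ ?_, fun σ => ?_⟩
  · rw [isogenyPoly_map_sub_natDegree hp.out hn hπ,
      (AdjoinRoot.powerBasis' (isogenyPoly_monic hp.out hn)).finrank, AdjoinRoot.powerBasis'_dim,
      isogenyPoly_natDegree hp.out hn hπ]
  · have hc : Bialgebra.comulAlgHom R (HRing hπ hp.out hn) x =
        x ⊗ₜ 1 + 1 ⊗ₜ x + π ^ n • (x ⊗ₜ x) := HRing.comul_x ..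
    rw [hρ, hs]
    simp only [map_add, map_smul, Algebra.TensorProduct.map_tmul, AlgHom.restrictScalars_apply, hρ,
      hs, hc, map_one, AlgHom.id_apply, TensorProduct.add_tmul, TensorProduct.tmul_add,
      ← TensorProduct.smul_tmul', TensorProduct.tmul_smul, Algebra.TensorProduct.assoc_tmul,
      Algebra.TensorProduct.one_def, smul_add]
    abel
  · have hc : Bialgebra.counitAlgHom R (HRing hπ hp.out hn) x = 0 := HRing.counit_x ..
    rw [hρ, hs]
    simp [hc]
  · obtain ⟨v, hv⟩ := hw.exists_left_inv
    refine ⟨v, Or.inl ?_⟩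
    have h2 : ρ w - w ⊗ₜ 1 = (algebraMap R B (π ^ n) * w + 1) ⊗ₜ x := by
      rw [hρ, hs, TensorProduct.add_tmul, ← Algebra.smul_def, ← TensorProduct.smul_tmul']
      abel
    rw [h2, TensorProduct.smul_tmul', smul_eq_mul, hv]
  -- The point by which σ acts is x = θ = (ζ ^ φ(σ) - 1) / π ^ n, integral because π ^ n divides ζ -
  -- 1.
  · obtain ⟨θ, hθ⟩ : π ^ n ∣ ζ ^ (φ σ).toAdd.val - 1 :=
      hζn.trans (by simpa using sub_dvd_pow_sub_pow ζ 1 (φ σ).toAdd.val)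
    have hθ1 : π ^ n * θ + 1 = ζ ^ (φ σ).toAdd.val := by rw [← hθ, sub_add_cancel]
    have hg : HRing.lift hπ hp.out hn θ (by
        rw [Algebra.algebraMap_self_apply, hθ1, pow_right_comm, hζ, one_pow]) x = θ :=
      HRing.lift_x ..
    refine ⟨_, by rw [hg, hθ1], pointAction_eq hpr ρ _ _ ?_⟩
    have h3 : pointAction ρ (HRing.lift hπ hp.out hn θ (by
        rw [Algebra.algebraMap_self_apply, hθ1, pow_right_comm, hζ, one_pow])) w =
        w + algebraMap R B θ + algebraMap R B (π ^ n) * (algebraMap R B θ * w) := by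
      rw [pointAction]
      simp only [AlgHom.comp_apply, AlgHom.restrictScalars_apply, hρ, hs, map_add, map_smul,
        Algebra.TensorProduct.map_tmul, hg, map_one, AlgHom.id_apply]
      simp [Algebra.smul_def]
    have h4 := h.action σ
    rw [map_add, map_one, map_mul, algEquiv_algebraMap, ← hθ1, map_add, map_one, map_mul] at h4
    rw [h3]
    refine smul_right_injective B hπn ?_
    simp only [Algebra.smul_def]
    linear_combination -h4

end additive

theorem Int.isCoprime_natCast_of_not_dvd {p : ℕ} (hp : p.Prime) {m : ℤ} (h : ¬ (p : ℤ) ∣ m) :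
    IsCoprime m (p : ℤ) :=
  (((Nat.prime_iff_prime_int.mp hp).irreducible.coprime_iff_not_dvd).mpr h).symm

theorem ZMod.natCast_val_intCast_eq (p : ℕ) [NeZero p] (k : Type*) [Ring k] [CharP k p] (m : ℤ) :
    (((m : ZMod p).val : ℕ) : k) = (m : k) := by
  rw [ZMod.natCast_val, ZMod.cast_intCast dvd_rfl]

/-! ### Normal forms in k((t)) modulo p-th powers -/

namespace LaurentSeries

section normalForm

variable {k : Type*} [Field k]

theorem order_add_eq_left {f g : LaurentSeries k} (hf : f ≠ 0) (hg : g ≠ 0)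
    (h : f.order < g.order) : (f + g).order = f.order := by
  have h1 : f.orderTop < g.orderTop := by
    rw [← HahnSeries.order_eq_orderTop_of_ne_zero hf, ← HahnSeries.order_eq_orderTop_of_ne_zero hg]
    exact_mod_cast h
  have h2 := HahnSeries.orderTop_add_eq_left h1
  have h3 : f + g ≠ 0 := by
    rw [← HahnSeries.orderTop_ne_top, h2]
    exact HahnSeries.orderTop_ne_top.mpr hf
  rw [← HahnSeries.order_eq_orderTop_of_ne_zero hf, ← HahnSeries.order_eq_orderTop_of_ne_zero h3]
    at h2
  exact_mod_cast h2

variable [IsAlgClosed k] (p : ℕ) [hp : Fact p.Prime] [CharP k p]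

theorem order_mul_pow {f g : LaurentSeries k} (hf : f ≠ 0) (hg : g ≠ 0) (n : ℕ) :
    (f * g ^ n).order = f.order + n * g.order := by
  rw [HahnSeries.order_mul hf (pow_ne_zero _ hg), HahnSeries.order_pow, nsmul_eq_mul]

/-- Modulo `p`-th powers, a series which is not a `p`-th power has order prime to `p`. -/
theorem exists_eq_pow_add_of_ne_pow {f : LaurentSeries k} (hf : ∀ g, f ≠ g ^ p) :
    ∃ g r : LaurentSeries k, f = g ^ p + r ∧ ¬ (p : ℤ) ∣ r.order ∧
      derivative k f = derivative k r ∧ derivative k f ≠ 0 ∧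
      (derivative k f).order = r.order - 1 := by
  obtain ⟨g, r, hgr, h1, -⟩ := exists_eq_pow_add p f
  have hr : r ≠ 0 := by
    rintro rfl
    exact hf g (by rw [hgr, add_zero])
  have hd : derivative k f = derivative k r := by
    rw [hgr, map_add, derivative_pow, zero_add]
  have hro := order_not_dvd p hr h1
  obtain ⟨h2, h3⟩ := order_derivative p hro
  exact ⟨g, r, hgr, hro, hd, hd ▸ h2, hd ▸ h3⟩

/-- Write f = g ^ p + r with ord r prime to p. As p divides ord f, the p-th power dominates, and
dividing by it leaves 1 plus a term of positive order prime to p. This does not change the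
logarithmic derivative, whose order is then visible. -/
theorem exists_mul_pow_eq_one_add {f : LaurentSeries k} (hf : ∀ g, f ≠ g ^ p)
    (hord : (p : ℤ) ∣ f.order) :
    ∃ g r : LaurentSeries k, g ≠ 0 ∧ f * g ^ p = 1 + r ∧ 0 < r.order ∧ ¬ (p : ℤ) ∣ r.order ∧
      (derivative k f / f).order = r.order - 1 := by
  have hf0 : f ≠ 0 := by
    rintro rfl
    exact hf 0 (zero_pow hp.out.ne_zero).symm
  obtain ⟨g, r, hgr, hr, -⟩ := exists_eq_pow_add_of_ne_pow p hf
  have hr0 : r ≠ 0 := by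
    rintro rfl
    simp at hr
  have hg : g ≠ 0 := by
    rintro rfl
    rw [zero_pow hp.out.ne_zero, zero_add] at hgr
    exact hr (hgr ▸ hord)
  have hgp := pow_ne_zero p hg
  have hgo : (g ^ p).order = p * g.order := by
    rw [HahnSeries.order_pow, nsmul_eq_mul]
  have hlt : (p : ℤ) * g.order < r.order := by
    rcases lt_trichotomy ((p : ℤ) * g.order) r.order with h | h | h
    · exact h
    · exact absurd ⟨_, h.symm⟩ hr
    · rw [← hgo] at h
      have := order_add_eq_left hr0 hgp h
      rw [add_comm, ← hgr] at this
      exact absurd (this ▸ hord) hr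
  have hso : (r * g⁻¹ ^ p).order = r.order - p * g.order := by
    rw [order_mul_pow hr0 (inv_ne_zero hg), order_inv hg]
    ring
  have hsd : ¬ (p : ℤ) ∣ (r * g⁻¹ ^ p).order := by
    rw [hso]
    exact fun h => hr ((dvd_sub_left (dvd_mul_right _ _)).mp h)
  have hs0 : 0 < (r * g⁻¹ ^ p).order := by
    rw [hso]
    exact sub_pos.mpr hlt
  have he : f * g⁻¹ ^ p = 1 + r * g⁻¹ ^ p := by
    rw [hgr, add_mul, inv_pow, mul_inv_cancel₀ hgp]
  refine ⟨g⁻¹, r * g⁻¹ ^ p, inv_ne_zero hg, he, hs0, hsd, ?_⟩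
  have h1 := derivative_mul_pow_div p f (inv_ne_zero hg)
  obtain ⟨h2, h3⟩ := order_derivative p hsd
  have h4 : (1 + r * g⁻¹ ^ p).order = 0 := by
    rw [order_add_eq_left one_ne_zero _ (by rwa [HahnSeries.order_one]), HahnSeries.order_one]
    exact mul_ne_zero hr0 (pow_ne_zero _ (inv_ne_zero hg))
  have h5 : (1 + r * g⁻¹ ^ p) ≠ 0 := by
    rw [← he]
    exact mul_ne_zero hf0 (pow_ne_zero _ (inv_ne_zero hg))
  have h6 : derivative k (1 + r * g⁻¹ ^ p) = derivative k (r * g⁻¹ ^ p) := by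
    have := derivative_pow p (1 : LaurentSeries k)
    rw [one_pow] at this
    rw [map_add, this, zero_add]
  rw [← h1, he, h6, div_eq_mul_inv, HahnSeries.order_mul h2 (inv_ne_zero h5), order_inv h5, h3, h4]
  ring

end normalForm

end LaurentSeries

/-! ### Changing the equation of B -/

section equations

open BoundarySeries IsLocalRing

namespace IsFrobeniusResidue

variable {R : Type*} [CommRing R] [IsDomain R] [IsDiscreteValuationRing R]
  [IsAdicComplete (maximalIdeal R) R]
  {B : Type*} [CommRing B] [IsDomain B] [Algebra R B] [Algebra (BoundarySeries R) B]
  [IsScalarTower R (BoundarySeries R) B]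
  {p : ℕ} [hp : Fact p.Prime] [IsAlgClosed (ResidueField R)] [CharP (ResidueField R) p]
  {π : R} {Φ : B →+* LaurentSeries (ResidueField R)}
  [IsAdicComplete (Ideal.span {algebraMap R B π}) B]
  {ζ : R} {G : Subgroup (B ≃ₐ[BoundarySeries R] B)}
  [Module.Finite (BoundarySeries R) B] [Module.Free (BoundarySeries R) B]

/-- The quotient of two eigenvectors for the same character is fixed by G, hence lies in A. -/
theorem exists_eq_algebraMap_mul
    (hfix : ∀ b : B, (∀ σ ∈ G, σ b = b) → b ∈ (algebraMap (BoundarySeries R) B).range)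
    {φ : G ≃* Multiplicative (ZMod p)} {y y' : B} (hy : IsUnit y)
    (h : ∀ σ : G, (σ : B ≃ₐ[BoundarySeries R] B) y = algebraMap R B (ζ ^ (φ σ).toAdd.val) * y)
    (h' : ∀ σ : G, (σ : B ≃ₐ[BoundarySeries R] B) y' = algebraMap R B (ζ ^ (φ σ).toAdd.val) * y') :
    ∃ a, y' = algebraMap (BoundarySeries R) B a * y := by
  obtain ⟨c, hc⟩ := hy.exists_left_inv
  obtain ⟨a, ha⟩ := hfix (c * y') fun σ hσ => by
    refine hy.mul_left_cancel ?_
    have h1 := congrArg σ hc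
    rw [map_mul, map_one] at h1
    have h2 := h ⟨σ, hσ⟩
    have h3 := h' ⟨σ, hσ⟩
    simp only at h2 h3
    rw [map_mul, h3]
    rw [h2] at h1
    linear_combination y' * h1 - y' * hc
  refine ⟨a, ?_⟩
  rw [ha]
  linear_combination (-y') * hc

theorem ne_pow_of_mul_pow {b : B} (hb : ∀ g, Φ b ≠ g ^ p) {v : LaurentSeries (ResidueField R)}
    (hv : v ≠ 0) (g : LaurentSeries (ResidueField R)) : v ^ p * Φ b ≠ g ^ p := fun h =>
  hb (g / v) (by rw [div_pow, ← h, mul_div_cancel_left₀ _ (pow_ne_zero _ hv)])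

theorem ne_pow_of_add_pow {b : B} (hb : ∀ g, Φ b ≠ g ^ p) (v g : LaurentSeries (ResidueField R)) :
    Φ b + v ^ p ≠ g ^ p := fun h =>
  hb (g - v) (by rw [sub_pow_char, ← h, add_sub_cancel_right])

theorem multiplicative_mul_pow (hΦ : IsFrobeniusResidue π p Φ) (hπ : Irreducible π)
    (hrank : Module.finrank (BoundarySeries R) B = p)
    {φ : G ≃* Multiplicative (ZMod p)} {u : (BoundarySeries R)ˣ} {y : B}
    (h : IsMultiplicativePresentation ζ φ u y) (v : (BoundarySeries R)ˣ) :
    IsMultiplicativePresentation ζ φ (u * v ^ p)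
      (algebraMap _ B (v : BoundarySeries R) * y) := by
  rw [hΦ.isMultiplicativePresentation_iff hπ hrank] at h ⊢
  obtain ⟨h1, h2, h3⟩ := h
  refine ⟨?_, fun g => ?_, fun σ => ?_⟩
  · rw [mul_pow, h1, Units.val_mul, Units.val_pow_eq_pow_val, map_mul, map_pow, mul_comm]
  · rw [map_mul, hΦ.map_algebraMap]
    exact ne_pow_of_mul_pow h2 (isUnit_iff_residue_ne_zero.mp v.isUnit) g
  · rw [map_mul, AlgEquiv.commutes, h3]
    ring

/-- Two generators differ by an element of A, whose p-th power is the quotient of the two units u'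
and u; it is therefore a unit itself. -/
theorem multiplicative_unique (hΦ : IsFrobeniusResidue π p Φ) (hπ : Irreducible π)
    (hrank : Module.finrank (BoundarySeries R) B = p)
    (hinj : Function.Injective (algebraMap (BoundarySeries R) B))
    (hfix : ∀ b : B, (∀ σ ∈ G, σ b = b) → b ∈ (algebraMap (BoundarySeries R) B).range)
    {φ : G ≃* Multiplicative (ZMod p)} {u : (BoundarySeries R)ˣ} {y : B}
    (h : IsMultiplicativePresentation ζ φ u y) (u' : (BoundarySeries R)ˣ) :
    (∃ y' : B, IsMultiplicativePresentation ζ φ u' y') ↔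
      ∃ v : (BoundarySeries R)ˣ, u' = u * v ^ p := by
  constructor
  · rintro ⟨y', h'⟩
    have h1 := ((hΦ.isMultiplicativePresentation_iff hπ hrank _ _ _).mp h).1
    have h1' := ((hΦ.isMultiplicativePresentation_iff hπ hrank _ _ _).mp h').1
    have hy : IsUnit y := by
      rw [← isUnit_pow_iff hp.out.ne_zero, h1]
      exact u.isUnit.map _
    obtain ⟨a, rfl⟩ := exists_eq_algebraMap_mul hfix hy h.action h'.action
    have h2 : (u' : BoundarySeries R) = u * a ^ p := by
      apply hinj
      rw [← h1', mul_pow, h1, map_mul, map_pow, mul_comm]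
    have ha : IsUnit a := by
      rw [← isUnit_pow_iff hp.out.ne_zero]
      exact isUnit_of_dvd_unit ⟨_, h2.trans (mul_comm _ _)⟩ u'.isUnit
    obtain ⟨v, rfl⟩ := ha
    exact ⟨v, Units.ext h2⟩
  · rintro ⟨v, rfl⟩
    exact ⟨_, hΦ.multiplicative_mul_pow hπ hrank h v⟩

/-- (π ^ n w + 1) ^ p is fixed by G because ζ ^ p = 1; cancelling π ^ (p n), so is P_n(w), which
therefore lies in A. -/
theorem exists_additivePresentation (hΦ : IsFrobeniusResidue π p Φ) (hπ : Irreducible π)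
    (hrank : Module.finrank (BoundarySeries R) B = p) (hπB : algebraMap R B π ≠ 0) (hζ : ζ ^ p = 1)
    (hfix : ∀ b : B, (∀ σ ∈ G, σ b = b) → b ∈ (algebraMap (BoundarySeries R) B).range)
    {φ : G ≃* Multiplicative (ZMod p)} {n : ℕ} (hn : π ^ (n * (p - 1)) ∣ (p : R)) {w : B}
    (hw : ∀ g, Φ w ≠ g ^ p)
    (h : ∀ σ : G, (σ : B ≃ₐ[BoundarySeries R] B) (algebraMap R B (π ^ n) * w + 1) =
        algebraMap R B (ζ ^ (φ σ).toAdd.val) * (algebraMap R B (π ^ n) * w + 1)) :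
    ∃ u, IsAdditivePresentation hp.out hn ζ φ u w := by
  obtain ⟨u, hu⟩ := hfix (Polynomial.aeval w (isogenyPoly hp.out hn)) fun σ hσ => by
    have h1 := isogenyPoly_aeval hp.out hn w
    have h2 := congrArg σ h1
    have h3 := h ⟨σ, hσ⟩
    simp only at h3
    rw [map_mul, algEquiv_algebraMap, map_sub, map_pow σ, h3, map_one, mul_pow,
      ← map_pow (algebraMap R B),
      pow_right_comm, hζ, one_pow, map_one, one_mul, ← h1] at h2
    refine mul_left_cancel₀ ?_ h2
    rw [map_pow]
    exact pow_ne_zero _ hπB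
  exact ⟨u, (hΦ.isAdditivePresentation_iff hπ hrank _ _ _ _).mpr ⟨hu.symm, hw, h⟩⟩

/-- Multiplying π ^ n w + 1 by 1 + π ^ n C, with C in A lifting c, changes w to an element with Φ
equal to Φ w + c ^ p. -/
theorem additive_add_pow (hΦ : IsFrobeniusResidue π p Φ) (hπ : Irreducible π)
    (hrank : Module.finrank (BoundarySeries R) B = p) (hπB : algebraMap R B π ≠ 0) (hζ : ζ ^ p = 1)
    (hfix : ∀ b : B, (∀ σ ∈ G, σ b = b) → b ∈ (algebraMap (BoundarySeries R) B).range)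
    {φ : G ≃* Multiplicative (ZMod p)} {n : ℕ} (hn0 : 0 < n) (hn : π ^ (n * (p - 1)) ∣ (p : R))
    (h' : π ^ (n * (p - 1) + 1) ∣ (p : R))
    {u : BoundarySeries R} {w : B} (h : IsAdditivePresentation hp.out hn ζ φ u w)
    (c : LaurentSeries (ResidueField R)) :
    ∃ u' w', IsAdditivePresentation hp.out hn ζ φ u' w' ∧ residue u' = residue u + c ^ p := by
  have h0 := h
  rw [hΦ.isAdditivePresentation_iff hπ hrank] at h
  obtain ⟨h1, h2, h3⟩ := h
  obtain ⟨C, rfl⟩ := residue_surjective c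
  set w' := w + algebraMap _ B C * (algebraMap R B (π ^ n) * w + 1) with hw'
  have hπn : Φ (algebraMap R B (π ^ n)) = 0 := by
    rw [hΦ.eq_zero_iff, map_pow]
    exact dvd_pow_self _ hn0.ne'
  have hΦw : Φ w' = Φ w + residue C ^ p := by
    rw [hw', map_add, map_mul, map_add, map_mul, hπn, hΦ.map_algebraMap, map_one]
    ring
  have he : algebraMap R B (π ^ n) * w' + 1 =
      algebraMap _ B (1 + algebraMap R _ (π ^ n) * C) * (algebraMap R B (π ^ n) * w + 1) := by
    rw [map_add, map_one, map_mul, ← IsScalarTower.algebraMap_apply, hw']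
    ring
  obtain ⟨u', hu'⟩ := hΦ.exists_additivePresentation hπ hrank hπB hζ hfix hn (φ := φ) (w := w')
    (fun g => hΦw ▸ ne_pow_of_add_pow h2 _ g) (fun σ => by
      rw [he, map_mul, AlgEquiv.commutes, h3]
      ring)
  refine ⟨u', w', hu', ?_⟩
  rw [← hΦ.map_eq_residue_of_aeval_eq hπB hn h'
    ((hΦ.isAdditivePresentation_iff hπ hrank _ _ _ _).mp hu').1, hΦw,
    hΦ.map_eq_residue_of_aeval_eq hπB hn h' h1]

/-- The two elements π ^ n w + 1 differ by a factor a in A which is 1 modulo π ^ n. Writing a = 1 +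
π ^ n c, the two reductions differ by the p-th power of that of c. -/
theorem additive_unique (hΦ : IsFrobeniusResidue π p Φ) (hπ : Irreducible π)
    (hrank : Module.finrank (BoundarySeries R) B = p) (hπB : Prime (algebraMap R B π))
    (hfix : ∀ b : B, (∀ σ ∈ G, σ b = b) → b ∈ (algebraMap (BoundarySeries R) B).range)
    {φ : G ≃* Multiplicative (ZMod p)} {n : ℕ} (hn0 : 0 < n) (hn : π ^ (n * (p - 1)) ∣ (p : R))
    (h' : π ^ (n * (p - 1) + 1) ∣ (p : R))
    {u u' : BoundarySeries R} {w w' : B} (h : IsAdditivePresentation hp.out hn ζ φ u w)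
    (hw' : IsAdditivePresentation hp.out hn ζ φ u' w') :
    ∃ c, residue u' = residue u + c ^ p := by
  obtain ⟨h1, h2, h3⟩ := (hΦ.isAdditivePresentation_iff hπ hrank _ _ _ _).mp h
  obtain ⟨h1', h2', h3'⟩ := (hΦ.isAdditivePresentation_iff hπ hrank _ _ _ _).mp hw'
  have hY := hΦ.isUnit_mul_add_one hπ hn0 w
  obtain ⟨a, ha⟩ := exists_eq_algebraMap_mul hfix hY h3 h3'
  have hdvd : algebraMap _ B (algebraMap R (BoundarySeries R) π) ^ n ∣ algebraMap _ B (a - 1) := by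
    rw [← IsScalarTower.algebraMap_apply, ← hY.dvd_mul_right]
    refine ⟨w' - w, ?_⟩
    rw [map_sub, map_one, ← map_pow]
    linear_combination -ha
  obtain ⟨c, hc⟩ := pow_dvd_of_algebraMap_dvd (irreducible_algebraMap hπ)
    (by rwa [← IsScalarTower.algebraMap_apply]) hdvd
  have hww : w' = w + algebraMap _ B c * (algebraMap R B (π ^ n) * w + 1) := by
    have h4 := congrArg (algebraMap _ B) hc
    rw [map_sub, map_one, map_mul, map_pow, ← IsScalarTower.algebraMap_apply] at h4
    refine mul_left_cancel₀ (pow_ne_zero n hπB.ne_zero) ?_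
    rw [map_pow] at *
    linear_combination ha + (algebraMap R B π ^ n * w + 1) * h4
  have hπn : Φ (algebraMap R B (π ^ n)) = 0 := by
    rw [hΦ.eq_zero_iff, map_pow]
    exact dvd_pow_self _ hn0.ne'
  refine ⟨residue c, ?_⟩
  rw [← hΦ.map_eq_residue_of_aeval_eq hπB.ne_zero hn h' h1,
    ← hΦ.map_eq_residue_of_aeval_eq hπB.ne_zero hn h' h1', hww, map_add, map_mul, map_add, map_mul,
    hπn, hΦ.map_algebraMap, map_one]
  ring

end IsFrobeniusResidue

end equations

/-! ### Normal equations and the action on the parameter -/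

section normalEquations

open BoundarySeries IsLocalRing

namespace IsFrobeniusResidue

variable {R : Type*} [CommRing R] [IsDomain R] [IsDiscreteValuationRing R]
  [IsAdicComplete (maximalIdeal R) R]
  {B : Type*} [CommRing B] [IsDomain B] [Algebra R B] [Algebra (BoundarySeries R) B]
  [IsScalarTower R (BoundarySeries R) B]
  {p : ℕ} [hp : Fact p.Prime] [IsAlgClosed (ResidueField R)] [CharP (ResidueField R) p]
  {π : R} {Φ : B →+* LaurentSeries (ResidueField R)}
  [IsAdicComplete (Ideal.span {algebraMap R B π}) B]
  {ζ : R} {G : Subgroup (B ≃ₐ[BoundarySeries R] B)}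
  [Module.Finite (BoundarySeries R) B] [Module.Free (BoundarySeries R) B]

theorem isParameter_of_order_eq_one (hΦ : IsFrobeniusResidue π p Φ) (hπ : Irreducible π)
    (hπB : algebraMap R B π ≠ 0) {Z : B} (hZ : (Φ Z).order = 1) : IsParameter R Z :=
  hΦ.isParameter hπ hπB (Module.Free.chooseBasis (BoundarySeries R) B) hZ

theorem map_eq_residue_of_multiplicative (hΦ : IsFrobeniusResidue π p Φ) (hπ : Irreducible π)
    (hrank : Module.finrank (BoundarySeries R) B = p)
    {φ : G ≃* Multiplicative (ZMod p)} {u : (BoundarySeries R)ˣ} {y : B}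
    (h : IsMultiplicativePresentation ζ φ u y) : Φ y = residue (u : BoundarySeries R) :=
  hΦ.map_eq_residue_of_pow_eq ((hΦ.isMultiplicativePresentation_iff hπ hrank _ _ _).mp h).1

theorem residue_ne_pow_of_multiplicative (hΦ : IsFrobeniusResidue π p Φ) (hπ : Irreducible π)
    (hrank : Module.finrank (BoundarySeries R) B = p)
    {φ : G ≃* Multiplicative (ZMod p)} {u : (BoundarySeries R)ˣ} {y : B}
    (h : IsMultiplicativePresentation ζ φ u y) (g : LaurentSeries (ResidueField R)) :
    residue (u : BoundarySeries R) ≠ g ^ p :=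
  hΦ.map_eq_residue_of_multiplicative hπ hrank h ▸
    ((hΦ.isMultiplicativePresentation_iff hπ hrank _ _ _).mp h).2.1 g

/-- Here p does not divide ord Φ y, so y itself is a power of a parameter; the principal root in the
action formula is a root of 1, hence trivial. -/
theorem exists_parameter_zpow (hΦ : IsFrobeniusResidue π p Φ) (hπ : Irreducible π)
    (hrank : Module.finrank (BoundarySeries R) B = p) (hπB : algebraMap R B π ≠ 0)
    (hζ : ζ ^ p = 1) {φ : G ≃* Multiplicative (ZMod p)} {u : (BoundarySeries R)ˣ} {y : B}
    (h : IsMultiplicativePresentation ζ φ u y) {a : ZMod p}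
    (ha : (((residue (u : BoundarySeries R)).order : ℤ) : ZMod p) = a) (ha0 : a ≠ 0) :
    ∃ Z : Bˣ, IsParameter R (Z : B) ∧
      y = ((Z ^ (residue (u : BoundarySeries R)).order : Bˣ) : B) ∧
      ∀ σ : G, (σ : B ≃ₐ[BoundarySeries R] B) (Z : B) =
        algebraMap R B (ζ ^ (a⁻¹ * (φ σ).toAdd).val) * Z := by
  have hy := hΦ.map_eq_residue_of_multiplicative hπ hrank h
  have hnd : ¬ (p : ℤ) ∣ (Φ y).order := by
    rw [hy, ← ZMod.intCast_zmod_eq_zero_iff_dvd, ha]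
    exact ha0
  obtain ⟨Z, hZ, hZ1⟩ := hΦ.exists_zpow_eq hπ hnd
  refine ⟨Z, hΦ.isParameter_of_order_eq_one hπ hπB hZ1, by rw [← hy, hZ], fun σ => ?_⟩
  obtain ⟨ρ, hρ, hσ⟩ := hΦ.exists_action_eq hπ hζ hnd (σ : B ≃ₐ[BoundarySeries R] B) Z
    (φ σ).toAdd 1 (by rw [hZ, h.action, mul_one])
  have hρ1 : 1 = ρ := (hρ 1).mp ((hΦ.isPrincipalRoot_iff hπ).mpr (by simp))
  rw [hσ, ← hρ1, hy, ha, Units.val_one, mul_one]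

theorem exists_parameter_zpow_of_eq (hΦ : IsFrobeniusResidue π p Φ) (hπ : Irreducible π)
    (hrank : Module.finrank (BoundarySeries R) B = p) (hπB : algebraMap R B π ≠ 0)
    (hζ : ζ ^ p = 1) {φ : G ≃* Multiplicative (ZMod p)} {u : (BoundarySeries R)ˣ} {y : B}
    (h : IsMultiplicativePresentation ζ φ u y) {a : ZMod p}
    (ha : (((residue (u : BoundarySeries R)).order : ℤ) : ZMod p) = a) (ha0 : a ≠ 0) {N : ℤ}
    (hN : (N : ZMod p) = a) :
    ∃ (u : (BoundarySeries R)ˣ) (y : B) (Z : Bˣ),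
      IsMultiplicativePresentation ζ φ u y ∧ IsParameter R (Z : B) ∧ y = ((Z ^ N : Bˣ) : B) ∧
      ∀ σ : G, (σ : B ≃ₐ[BoundarySeries R] B) (Z : B) =
        algebraMap R B (ζ ^ (a⁻¹ * (φ σ).toAdd).val) * Z := by
  -- Multiplying u by the p-th power of a lift of t ^ j shifts the order of its reduction by p j.
  obtain ⟨j, hj⟩ : (p : ℤ) ∣ N - (residue (u : BoundarySeries R)).order := by
    rw [← ZMod.intCast_zmod_eq_zero_iff_dvd, Int.cast_sub, hN, ha, sub_self]
  have hs := LaurentSeries.single_ne_zero (k := ResidueField R) j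
  obtain ⟨v, hv⟩ := residue_surjective (HahnSeries.single j (1 : ResidueField R))
  obtain ⟨v, rfl⟩ : IsUnit v := by rwa [isUnit_iff_residue_ne_zero, hv]
  have h' := hΦ.multiplicative_mul_pow hπ hrank h v
  have ho : (residue ((u * v ^ p : (BoundarySeries R)ˣ) : BoundarySeries R)).order = N := by
    rw [Units.val_mul, Units.val_pow_eq_pow_val, map_mul, map_pow, hv,
      LaurentSeries.order_mul_pow (isUnit_iff_residue_ne_zero.mp u.isUnit) hs,
      HahnSeries.order_single one_ne_zero, ← hj]
    ring
  obtain ⟨Z, h1, h2, h3⟩ := hΦ.exists_parameter_zpow hπ hrank hπB hζ h' (by rw [ho, hN]) ha0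
  rw [ho] at h2
  exact ⟨_, _, Z, h', h1, h2, h3⟩

/-- As p divides the order of the reduction of u, that reduction can be normalised to 1 + r with ord
r = m prime to p. Then Φ (y - 1) = r, so y - 1 is the m-th power of a parameter. -/
theorem exists_parameter_one_add (hΦ : IsFrobeniusResidue π p Φ) (hπ : Irreducible π)
    (hrank : Module.finrank (BoundarySeries R) B = p) (hπB : algebraMap R B π ≠ 0)
    (hζ : ζ ^ p = 1) {φ : G ≃* Multiplicative (ZMod p)} {u : (BoundarySeries R)ˣ} {y : B}
    (h : IsMultiplicativePresentation ζ φ u y)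
    (hord : (p : ℤ) ∣ (residue (u : BoundarySeries R)).order) {ω : LaurentSeries (ResidueField R)}
    (hω : ω = LaurentSeries.derivative (ResidueField R) (residue (u : BoundarySeries R)) /
      residue (u : BoundarySeries R)) :
    0 < 1 + ω.order ∧ IsCoprime (1 + ω.order) (p : ℤ) ∧
      ∃ (u : (BoundarySeries R)ˣ) (y : B) (Z : Bˣ),
        IsMultiplicativePresentation ζ φ u y ∧ IsParameter R (Z : B) ∧
        y = 1 + ((Z ^ (1 + ω.order) : Bˣ) : B) ∧
        ∀ σ : G, ∃ ρ : Bˣ,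
          (∀ ρ' : Bˣ, IsPrincipalRoot R (1 + ω.order)
            (1 + algebraMap R B (ζ ^ (-(φ σ).toAdd).val * (ζ ^ (φ σ).toAdd.val - 1)) *
              ((Z ^ (-(1 + ω.order)) : Bˣ) : B)) ρ' ↔ ρ' = ρ) ∧
          (σ : B ≃ₐ[BoundarySeries R] B) (Z : B) =
            algebraMap R B (ζ ^ ((((1 + ω.order : ℤ) : ZMod p))⁻¹ *
              (φ σ).toAdd).val) * Z * ρ := by
  obtain ⟨g, r, hg, hgr, hr0, hrp, hd⟩ := LaurentSeries.exists_mul_pow_eq_one_add p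
    (hΦ.residue_ne_pow_of_multiplicative hπ hrank h) hord
  obtain ⟨v, rfl⟩ := residue_surjective g
  obtain ⟨v, rfl⟩ := isUnit_iff_residue_ne_zero.mpr hg
  have h' := hΦ.multiplicative_mul_pow hπ hrank h v
  set y' := algebraMap _ B (v : BoundarySeries R) * y with hy'
  have hy := hΦ.map_eq_residue_of_multiplicative hπ hrank h'
  rw [Units.val_mul, Units.val_pow_eq_pow_val, map_mul BoundarySeries.residue,
    map_pow BoundarySeries.residue, hgr] at hy
  have hy1 : Φ (y' - 1) = r := by rw [map_sub, hy, map_one, add_sub_cancel_left]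
  have hm : (Φ (y' - 1)).order = 1 + ω.order := by rw [hy1, hω, hd]; ring
  rw [← hm]
  have hnd : ¬ (p : ℤ) ∣ (Φ (y' - 1)).order := by rwa [hy1]
  obtain ⟨Z, hZ, hZ1⟩ := hΦ.exists_zpow_eq hπ hnd
  refine ⟨by rwa [hy1], Int.isCoprime_natCast_of_not_dvd hp.out hnd, _, y', Z, h',
    hΦ.isParameter_of_order_eq_one hπ hπB hZ1, by rw [hZ, add_sub_cancel], fun σ =>
    hΦ.exists_action_eq hπ hζ hnd (σ : B ≃ₐ[BoundarySeries R] B) Z (φ σ).toAdd _ ?_⟩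
  have e1 : algebraMap R B (ζ ^ (φ σ).toAdd.val) * algebraMap R B (ζ ^ (-(φ σ).toAdd).val) = 1 := by
    have := map_mul (rootHom hζ) (φ σ) (φ σ)⁻¹
    rw [mul_inv_cancel, map_one, rootHom_apply, rootHom_apply, toAdd_inv] at this
    rw [← map_mul, ← this, map_one]
  have e2 : ((Z ^ (Φ (y' - 1)).order : Bˣ) : B) * ((Z ^ (-(Φ (y' - 1)).order) : Bˣ) : B) = 1 := by
    rw [← Units.val_mul, zpow_neg, mul_inv_cancel, Units.val_one]
  have e3 := h'.action σ
  rw [hZ] at e2 ⊢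
  rw [map_sub, map_one, e3, map_mul, map_sub, map_one]
  -- With a = φ(σ): σ (Z ^ m) = ζ ^ a (1 + Z ^ m) - 1 = ζ ^ a Z ^ m (1 + ζ ^ (-a) (ζ ^ a - 1) Z ^
  -- (-m)).
  linear_combination (-(algebraMap R B (ζ ^ (φ σ).toAdd.val) - 1)) *
    (e1 + algebraMap R B (ζ ^ (φ σ).toAdd.val) * algebraMap R B (ζ ^ (-(φ σ).toAdd).val) * e2)

theorem residue_ne_pow_of_additive (hΦ : IsFrobeniusResidue π p Φ) (hπ : Irreducible π)
    (hrank : Module.finrank (BoundarySeries R) B = p) (hπB : algebraMap R B π ≠ 0)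
    {φ : G ≃* Multiplicative (ZMod p)} {n : ℕ} (hn : π ^ (n * (p - 1)) ∣ (p : R))
    (h' : π ^ (n * (p - 1) + 1) ∣ (p : R))
    {u : BoundarySeries R} {w : B} (h : IsAdditivePresentation hp.out hn ζ φ u w)
    (g : LaurentSeries (ResidueField R)) : residue u ≠ g ^ p := by
  obtain ⟨h1, h2, h3⟩ := (hΦ.isAdditivePresentation_iff hπ hrank _ _ _ _).mp h
  rw [← hΦ.map_eq_residue_of_aeval_eq hπB hn h' h1]
  exact h2 g

/-- Subtracting the p-th power part from the reduction of u leaves a series r of order prime to p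
with the same derivative. Then Φ w = r, so w is the power of a parameter with exponent ord r = 1 +
ord ω. -/
theorem exists_parameter_additive (hΦ : IsFrobeniusResidue π p Φ) (hπ : Irreducible π)
    (hrank : Module.finrank (BoundarySeries R) B = p) (hπB : Prime (algebraMap R B π))
    (hζ : ζ ^ p = 1)
    (hfix : ∀ b : B, (∀ σ ∈ G, σ b = b) → b ∈ (algebraMap (BoundarySeries R) B).range)
    {φ : G ≃* Multiplicative (ZMod p)} {n : ℕ} (hn0 : 0 < n) (hn : π ^ (n * (p - 1)) ∣ (p : R))
    (h' : π ^ (n * (p - 1) + 1) ∣ (p : R)) (hζn : π ^ n ∣ ζ - 1)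
    {u : BoundarySeries R} {w : B} (h : IsAdditivePresentation hp.out hn ζ φ u w) :
    ∃ ω : LaurentSeries (ResidueField R),
      (∀ (u : BoundarySeries R) (w : B), IsAdditivePresentation hp.out hn ζ φ u w →
        ω = LaurentSeries.derivative (ResidueField R) (residue u)) ∧
      ω ≠ 0 ∧ IsCoprime (1 + ω.order) (p : ℤ) ∧
      ∃ (u : BoundarySeries R) (w : B) (Z : Bˣ),
        IsAdditivePresentation hp.out hn ζ φ u w ∧ IsParameter R (Z : B) ∧
        w = ((Z ^ (1 + ω.order) : Bˣ) : B) ∧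
        ∀ σ : G, ∃ (θ : R) (ρ : Bˣ), π ^ n * θ = ζ ^ (φ σ).toAdd.val - 1 ∧
          (∀ ρ' : Bˣ, IsPrincipalRoot R (1 + ω.order)
            (1 + algebraMap R B (θ * ζ ^ (-(φ σ).toAdd).val) *
              ((Z ^ (-(1 + ω.order)) : Bˣ) : B)) ρ' ↔ ρ' = ρ) ∧
          (σ : B ≃ₐ[BoundarySeries R] B) (Z : B) =
            algebraMap R B (ζ ^ ((((1 + ω.order : ℤ) : ZMod p))⁻¹ *
              (φ σ).toAdd).val) * Z * ρ := by
  obtain ⟨g, r, hgr, hr, -, hd0, hdo⟩ := LaurentSeries.exists_eq_pow_add_of_ne_pow p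
    (hΦ.residue_ne_pow_of_additive hπ hrank hπB.ne_zero hn h' h)
  refine ⟨_, fun u' w' hu' => ?_, hd0, ?_⟩
  · obtain ⟨c, hc⟩ := hΦ.additive_unique hπ hrank hπB hfix hn0 hn h' h hu'
    rw [hc, map_add, LaurentSeries.derivative_pow, add_zero]
  obtain ⟨u', w', hu', hur⟩ := hΦ.additive_add_pow hπ hrank hπB.ne_zero hζ hfix hn0 hn h' h (-g)
  -- The sign is handled by additivity of Frobenius, which covers p = 2.
  have hng : (-g) ^ p = -g ^ p := map_neg (frobenius (LaurentSeries (ResidueField R)) p) g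
  rw [hng, hgr, add_neg_cancel_comm] at hur
  have hw : Φ w' = r := by
    rw [hΦ.map_eq_residue_of_aeval_eq hπB.ne_zero hn h'
      ((hΦ.isAdditivePresentation_iff hπ hrank _ _ _ _).mp hu').1, hur]
  have hm : 1 + (LaurentSeries.derivative (ResidueField R) (residue u)).order = (Φ w').order := by
    rw [hdo, hw]
    ring
  have hnd : ¬ (p : ℤ) ∣ (Φ w').order := by rwa [hw]
  rw [hm]
  obtain ⟨Z, hZ, hZ1⟩ := hΦ.exists_zpow_eq hπ hnd
  refine ⟨Int.isCoprime_natCast_of_not_dvd hp.out hnd, u', w', Z, hu',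
    hΦ.isParameter_of_order_eq_one hπ hπB.ne_zero hZ1, hZ.symm, fun σ => ?_⟩
  obtain ⟨θ, hθ⟩ : π ^ n ∣ ζ ^ (φ σ).toAdd.val - 1 :=
    hζn.trans (by simpa using sub_dvd_pow_sub_pow ζ 1 (φ σ).toAdd.val)
  have e1 : algebraMap R B (ζ ^ (φ σ).toAdd.val) * algebraMap R B (ζ ^ (-(φ σ).toAdd).val) = 1 := by
    have := map_mul (rootHom hζ) (φ σ) (φ σ)⁻¹
    rw [mul_inv_cancel, map_one, rootHom_apply, rootHom_apply, toAdd_inv] at this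
    rw [← map_mul, ← this, map_one]
  have e2 : ((Z ^ (Φ w').order : Bˣ) : B) * ((Z ^ (-(Φ w').order) : Bˣ) : B) = 1 := by
    rw [← Units.val_mul, zpow_neg, mul_inv_cancel, Units.val_one]
  have e3 := hu'.action σ
  have e4 := congrArg (algebraMap R B) hθ
  rw [map_add, map_mul, algEquiv_algebraMap, map_one] at e3
  rw [map_sub, map_one, map_mul] at e4
  -- The action on π ^ n w + 1, divided by π ^ n, is affine on w.
  have e5 : (σ : B ≃ₐ[BoundarySeries R] B) w' =
      algebraMap R B (ζ ^ (φ σ).toAdd.val) * w' + algebraMap R B θ := by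
    have hn0 : algebraMap R B (π ^ n) ≠ 0 := by
      rw [map_pow]
      exact pow_ne_zero _ hπB.ne_zero
    refine mul_left_cancel₀ hn0 ?_
    linear_combination e3 + e4
  obtain ⟨ρ, hρ⟩ := hΦ.exists_action_eq hπ hζ hnd (σ : B ≃ₐ[BoundarySeries R] B) Z (φ σ).toAdd
    (1 + algebraMap R B (θ * ζ ^ (-(φ σ).toAdd).val) * ((Z ^ (-(Φ w').order) : Bˣ) : B)) (by
      rw [hZ] at e2 ⊢
      rw [e5, map_mul]
      linear_combination (-algebraMap R B θ) *
    (e1 + algebraMap R B (ζ ^ (φ σ).toAdd.val) * algebraMap R B (ζ ^ (-(φ σ).toAdd).val) * e2))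
  exact ⟨θ, ρ, hθ.symm, hρ⟩

end IsFrobeniusResidue

end normalEquations

/-! ### The two reduction types -/

section dichotomy

open BoundarySeries IsLocalRing

namespace IsFrobeniusResidue

/-- A character of `G` is afforded by a multiplicative or by an additive presentation, and the
valuation of the different tells which. -/
theorem exists_presentation {R : Type*} [CommRing R] [IsDomain R] [IsDiscreteValuationRing R]
    [IsAdicComplete (maximalIdeal R) R] [CharZero R]
    {B : Type*} [CommRing B] [IsDomain B] [IsDiscreteValuationRing B] [Algebra R B]
    [Algebra (BoundarySeries R) B] [IsScalarTower R (BoundarySeries R) B]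
    {p : ℕ} [hp : Fact p.Prime] [IsAlgClosed (ResidueField R)] [CharP (ResidueField R) p]
    {π : R} {Φ : B →+* LaurentSeries (ResidueField R)}
    [IsAdicComplete (Ideal.span {algebraMap R B π}) B]
    {ζ : R} {G : Subgroup (B ≃ₐ[BoundarySeries R] B)}
    [Module.Finite (BoundarySeries R) B] [Module.Free (BoundarySeries R) B]
    [Module.IsTorsionFree (BoundarySeries R) B]
    (hΦ : IsFrobeniusResidue π p Φ) (hπ : Irreducible π)
    (hrank : Module.finrank (BoundarySeries R) B = p) (hπB : Prime (algebraMap R B π))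
    (hζ : IsPrimitiveRoot ζ p) (hG : Nat.card G = p)
    (hfix : ∀ b : B, (∀ σ ∈ G, σ b = b) → b ∈ (algebraMap (BoundarySeries R) B).range)
    (φ : G ≃* Multiplicative (ZMod p)) :
    (differentVal (BoundarySeries R) (algebraMap R B π) =
        IsDiscreteValuationRing.addVal R (p : R) ∧
      ∃ (u : (BoundarySeries R)ˣ) (y : B), IsMultiplicativePresentation ζ φ u y) ∨
    ∃ (n : ℕ) (hn : π ^ (n * (p - 1)) ∣ (p : R)), 0 < n ∧ π ^ n ∣ ζ - 1 ∧
      IsDiscreteValuationRing.addVal R (p : R) =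
        differentVal (BoundarySeries R) (algebraMap R B π) + (n * (p - 1) : ℕ) ∧
      ∃ (u : BoundarySeries R) (w : B), IsAdditivePresentation hp.out hn ζ φ u w := by
  obtain ⟨n, hn, y, w, hy, ⟨-, hyp⟩ | ⟨hn0, rfl, hw⟩⟩ := hΦ.exists_kummer hπ hπB hζ hG φ
  · refine Or.inl ?_
    have hyu : IsUnit y := (hΦ.isUnit_iff hπ).mpr fun h0 =>
      hyp 0 (by rw [h0, zero_pow hp.out.ne_zero])
    -- y ^ p is fixed by G because ζ ^ p = 1, which provides u.
    obtain ⟨u, hu⟩ := hfix (y ^ p) fun σ hσ => by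
      have h1 := hy ⟨σ, hσ⟩
      simp only at h1
      rw [map_pow, h1, mul_pow, ← map_pow, pow_right_comm, hζ.pow_eq_one, one_pow, map_one, one_mul]
    have huu : IsUnit u := by
      rw [isUnit_iff_residue_ne_zero, ← hΦ.map_eq_residue_of_pow_eq hu.symm]
      exact (hΦ.isUnit_iff hπ).mp hyu
    obtain ⟨u, rfl⟩ := huu
    have hpres := (hΦ.isMultiplicativePresentation_iff hπ hrank φ u y).mpr ⟨hu.symm, hyp, hy⟩
    exact ⟨differentVal_of_isPresentedBy_pow hπ hπB hpres.isPresentedBy, u, y, hpres⟩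
  · refine Or.inr ⟨n, hζ.pow_mul_dvd hn, hn0, hn, ?_⟩
    obtain ⟨u, hu⟩ := hΦ.exists_additivePresentation hπ hrank hπB.ne_zero hζ.pow_eq_one hfix
      (hζ.pow_mul_dvd hn) hw hy
    exact ⟨hΦ.differentVal_of_isPresentedBy_isogenyPoly hπ hπB hn0 _ hu.isPresentedBy, u, w, hu⟩

end IsFrobeniusResidue

end dichotomy

/-! ### The main theorem -/

theorem mainTheorem6 {R : Type*} [CommRing R] [IsDomain R] [IsDiscreteValuationRing R]
    [IsAdicComplete (IsLocalRing.maximalIdeal R) R] [CharZero R]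
    (p : ℕ) [hp : Fact p.Prime] [IsAlgClosed (IsLocalRing.ResidueField R)]
    [CharP (IsLocalRing.ResidueField R) p]
    (π : R) (hπ : Irreducible π) (ζ : R) (hζ : IsPrimitiveRoot ζ p)
    {B : Type*} [CommRing B] [Algebra R B] [Algebra (BoundarySeries R) B]
    [IsScalarTower R (BoundarySeries R) B] [Module.Finite (BoundarySeries R) B]
    [Module.Flat R B] (hrank : Module.finrank (BoundarySeries R) B = p)
    (G : Subgroup (B ≃ₐ[BoundarySeries R] B)) (hG : Nat.card G = p)
    (hinj : Function.Injective (algebraMap (BoundarySeries R) B))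
    (hfix : ∀ b : B, (∀ σ ∈ G, σ b = b) → b ∈ (algebraMap (BoundarySeries R) B).range)
    (hfield : IsField (SpecialFiber R B))
    (hinsep : IsPurelyInseparable (SpecialFiber R (BoundarySeries R)) (SpecialFiber R B))
    (hdeg : Module.finrank (SpecialFiber R (BoundarySeries R)) (SpecialFiber R B) = p) :
    ∃ (_ : IsDomain B) (_ : IsDiscreteValuationRing B)
      (_ : Module.IsTorsionFree (BoundarySeries R) B),
      -- `B` is a complete discrete valuation ring with uniformizer `π`
      Irreducible (algebraMap R B π) ∧
      IsAdicComplete (Ideal.span {algebraMap R B π}) B ∧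
      -- its residue field is of the form `k((z))`, and every lift of `z` is a parameter
      (∃ z : SpecialFiber R B, IsResidueParameter R z) ∧
      (∀ Z : B, IsResidueParameter R (SpecialFiber.mk R Z) → IsParameter R Z) ∧
      -- (A) multiplicative reduction
      (differentVal (BoundarySeries R) (algebraMap R B π) =
          IsDiscreteValuationRing.addVal R (p : R) →
        (∀ (u : (BoundarySeries R)ˣ) (y : B),
          IsPresentedBy (Polynomial.X ^ p - Polynomial.C (u : BoundarySeries R)) y →
          ∃! φ : G ≃* Multiplicative (ZMod p), ∀ σ : G, (σ : B ≃ₐ[BoundarySeries R] B) y =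
            algebraMap R B (ζ ^ (φ σ).toAdd.val) * y) ∧
        ∀ φ : G ≃* Multiplicative (ZMod p),
          -- `Spec B` is a torsor under `μ_p`, where `σ` acts as the point `ζ ^ φ(σ)` of `μ_p`
          (∃ ρ : B →ₐ[BoundarySeries R] B ⊗[R] MuRing R p, IsTorsor ρ ∧
            ∀ σ : G, ∃ g : MuRing R p →ₐ[R] R, g (MuRing.x R p) = ζ ^ (φ σ).toAdd.val ∧
              ∀ b : B, pointAction ρ g b = (σ : B ≃ₐ[BoundarySeries R] B) b) ∧
          -- the equation `y ^ p = u`; `u` is unique up to the `p`-th power of a unit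
          (∃ (u : (BoundarySeries R)ˣ) (y : B), IsMultiplicativePresentation ζ φ u y) ∧
          (∀ (u : (BoundarySeries R)ˣ) (y : B), IsMultiplicativePresentation ζ φ u y →
            ∀ u' : (BoundarySeries R)ˣ,
              (∃ y' : B, IsMultiplicativePresentation ζ φ u' y') ↔
                ∃ v : (BoundarySeries R)ˣ, u' = u * v ^ p) ∧
          -- the differential form `ω dt = dū / ū`
          ∃ ω : LaurentSeries (IsLocalRing.ResidueField R),
            (∀ (u : (BoundarySeries R)ˣ) (y : B), IsMultiplicativePresentation ζ φ u y →
              ω = LaurentSeries.derivative (IsLocalRing.ResidueField R)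
                (BoundarySeries.residue (u : BoundarySeries R)) /
                  BoundarySeries.residue (u : BoundarySeries R)) ∧
            ω ≠ 0 ∧
            -- its residue `h`
            ∃ h : ZMod p, ω.coeff (-1) = (h.val : IsLocalRing.ResidueField R) ∧
              (h ≠ 0 →
                (∀ (u : (BoundarySeries R)ˣ) (y : B), IsMultiplicativePresentation ζ φ u y →
                  (((BoundarySeries.residue (u : BoundarySeries R)).order : ℤ) : ZMod p) = h ∧
                  ∃ Z : Bˣ, IsParameter R (Z : B) ∧
                    y = ((Z ^ (BoundarySeries.residue (u : BoundarySeries R)).order : Bˣ) : B) ∧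
                    ∀ σ : G, (σ : B ≃ₐ[BoundarySeries R] B) (Z : B) =
                      algebraMap R B (ζ ^ (h⁻¹ * (φ σ).toAdd).val) * Z) ∧
                (∀ N : ℤ, (N : ZMod p) = h →
                  ∃ (u : (BoundarySeries R)ˣ) (y : B) (Z : Bˣ),
                    IsMultiplicativePresentation ζ φ u y ∧ IsParameter R (Z : B) ∧
                    y = ((Z ^ N : Bˣ) : B) ∧
                    ∀ σ : G, (σ : B ≃ₐ[BoundarySeries R] B) (Z : B) =
                      algebraMap R B (ζ ^ (h⁻¹ * (φ σ).toAdd).val) * Z)) ∧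
              (h = 0 →
                0 < 1 + ω.order ∧ IsCoprime (1 + ω.order) (p : ℤ) ∧
                ∃ (u : (BoundarySeries R)ˣ) (y : B) (Z : Bˣ),
                  IsMultiplicativePresentation ζ φ u y ∧ IsParameter R (Z : B) ∧
                  y = 1 + ((Z ^ (1 + ω.order) : Bˣ) : B) ∧
                  ∀ σ : G, ∃ ρ : Bˣ,
                    (∀ ρ' : Bˣ, IsPrincipalRoot R (1 + ω.order)
                      (1 + algebraMap R B (ζ ^ (-(φ σ).toAdd).val * (ζ ^ (φ σ).toAdd.val - 1)) *
                        ((Z ^ (-(1 + ω.order)) : Bˣ) : B)) ρ' ↔ ρ' = ρ) ∧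
                    (σ : B ≃ₐ[BoundarySeries R] B) (Z : B) =
                      algebraMap R B (ζ ^ ((((1 + ω.order : ℤ) : ZMod p))⁻¹ *
                        (φ σ).toAdd).val) * Z * ρ)) ∧
      -- (B) additive reduction
      (0 < differentVal (BoundarySeries R) (algebraMap R B π) →
        differentVal (BoundarySeries R) (algebraMap R B π) <
          IsDiscreteValuationRing.addVal R (p : R) →
        ∃ (n : ℕ) (hn : π ^ (n * (p - 1)) ∣ (p : R)), 0 < n ∧
          IsDiscreteValuationRing.addVal R (p : R) =
            differentVal (BoundarySeries R) (algebraMap R B π) + (n * (p - 1) : ℕ) ∧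
          (∀ (u : BoundarySeries R) (w : B),
            IsPresentedBy ((isogenyPoly hp.out hn).map (algebraMap R (BoundarySeries R)) -
              Polynomial.C u) w →
            ∃! φ : G ≃* Multiplicative (ZMod p), ∀ σ : G,
              (σ : B ≃ₐ[BoundarySeries R] B) (algebraMap R B (π ^ n) * w + 1) =
                algebraMap R B (ζ ^ (φ σ).toAdd.val) * (algebraMap R B (π ^ n) * w + 1)) ∧
          ∀ φ : G ≃* Multiplicative (ZMod p),
            -- `Spec B` is a torsor under `ℋ_n`, where `σ` acts as the point `x` with
            -- `π ^ n x + 1 = ζ ^ φ(σ)`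
            (∃ ρ : B →ₐ[BoundarySeries R] B ⊗[R] HRing hπ.ne_zero hp.out hn, IsTorsor ρ ∧
              ∀ σ : G, ∃ g : HRing hπ.ne_zero hp.out hn →ₐ[R] R,
                π ^ n * g (HRing.x hπ.ne_zero hp.out hn) + 1 = ζ ^ (φ σ).toAdd.val ∧
                ∀ b : B, pointAction ρ g b = (σ : B ≃ₐ[BoundarySeries R] B) b) ∧
            -- the equation; `ū` is not in `k((t ^ p))`, and is unique up to adding a `p`-th power
            (∃ (u : BoundarySeries R) (w : B), IsAdditivePresentation hp.out hn ζ φ u w) ∧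
            (∀ (u : BoundarySeries R) (w : B), IsAdditivePresentation hp.out hn ζ φ u w →
              (∃ i : ℤ, ¬ (p : ℤ) ∣ i ∧ (BoundarySeries.residue u).coeff i ≠ 0) ∧
              ∀ f : LaurentSeries (IsLocalRing.ResidueField R),
                (∃ (u' : BoundarySeries R) (w' : B), IsAdditivePresentation hp.out hn ζ φ u' w' ∧
                  BoundarySeries.residue u' = f) ↔
                ∃ c : LaurentSeries (IsLocalRing.ResidueField R),
                  f = BoundarySeries.residue u + c ^ p) ∧
            -- the differential form `ω dt = dū`
            ∃ ω : LaurentSeries (IsLocalRing.ResidueField R),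
              (∀ (u : BoundarySeries R) (w : B), IsAdditivePresentation hp.out hn ζ φ u w →
                ω = LaurentSeries.derivative (IsLocalRing.ResidueField R)
                  (BoundarySeries.residue u)) ∧
              ω ≠ 0 ∧ IsCoprime (1 + ω.order) (p : ℤ) ∧
              ∃ (u : BoundarySeries R) (w : B) (Z : Bˣ),
                IsAdditivePresentation hp.out hn ζ φ u w ∧ IsParameter R (Z : B) ∧
                w = ((Z ^ (1 + ω.order) : Bˣ) : B) ∧
                ∀ σ : G, ∃ (θ : R) (ρ : Bˣ), π ^ n * θ = ζ ^ (φ σ).toAdd.val - 1 ∧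
                  (∀ ρ' : Bˣ, IsPrincipalRoot R (1 + ω.order)
                    (1 + algebraMap R B (θ * ζ ^ (-(φ σ).toAdd).val) *
                      ((Z ^ (-(1 + ω.order)) : Bˣ) : B)) ρ' ↔ ρ' = ρ) ∧
                  (σ : B ≃ₐ[BoundarySeries R] B) (Z : B) =
                    algebraMap R B (ζ ^ ((((1 + ω.order : ℤ) : ZMod p))⁻¹ *
                      (φ σ).toAdd).val) * Z * ρ) := by
  have hTF : Module.IsTorsionFree (BoundarySeries R) B := isTorsionFree_of_flat
  -- A finite torsion-free module over a principal ideal domain is free.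
  have : Module.Free (BoundarySeries R) B := inferInstance
  have hA := BoundarySeries.isAdicComplete hπ
  have hB : IsAdicComplete (Ideal.span {algebraMap R B π}) B := by
    rw [IsScalarTower.algebraMap_apply R (BoundarySeries R) B]
    exact isAdicComplete_of_basis (Module.Free.chooseBasis (BoundarySeries R) B)
  have hquot := SpecialFiber.isField_quotient hπ hfield
  have hreg : ∀ x : B, algebraMap R B π * x = 0 → x = 0 := fun x hx => by
    rw [← Algebra.smul_def] at hx
    exact (smul_eq_zero_iff_right hπ.ne_zero).mp hx
  have hD : IsDomain B := isDomain_of_isField_quotient hquot hreg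
  have hDVR : IsDiscreteValuationRing B := isDiscreteValuationRing_of_isField_quotient hquot hreg
  have hirr : Irreducible (algebraMap R B π) := irreducible_of_isField_quotient hquot hreg
  have hπB := hirr.prime
  obtain ⟨Φ, hΦ⟩ := exists_isFrobeniusResidue hπ hfield hinsep hdeg
  have hdich := hΦ.exists_presentation hπ hrank hπB hζ hG hfix
  have hinjR : Function.Injective (algebraMap R B) := by
    rw [IsScalarTower.algebraMap_eq R (BoundarySeries R) B]
    exact hinj.comp BoundarySeries.algebraMap_injective
  have hp0 : (p : R) ≠ 0 := Nat.cast_ne_zero.mpr hp.out.ne_zero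
  have hvp : IsDiscreteValuationRing.addVal R (p : R) ≠ ⊤ :=
    mt IsDiscreteValuationRing.addVal_eq_top_iff.mp hp0
  refine ⟨hD, hDVR, hTF, hirr, hB, hΦ.exists_isResidueParameter hπ, fun Z hZ =>
    hΦ.isParameter_of_order_eq_one hπ hπB.ne_zero (hΦ.order_eq_one hπ hZ), fun hδ => ⟨?_, ?_⟩, ?_⟩
  · intro u y hpr
    have hyu : y ^ p = algebraMap _ B (u : BoundarySeries R) := by
      have := hpr.aeval_eq_zero
      simpa [sub_eq_zero] using this
    refine existsUnique_character hζ hinjR hG ?_ hyu fun σ hσ => hpr.eq_one hσ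
    rintro rfl
    rw [zero_pow hp.out.ne_zero] at hyu
    exact (u.isUnit.map (algebraMap (BoundarySeries R) B)).ne_zero hyu.symm
  · intro φ
    -- An additive presentation would give δ = v(p) - n(p - 1) < v(p).
    obtain ⟨u, y, huy⟩ : ∃ (u : (BoundarySeries R)ˣ) (y : B),
        IsMultiplicativePresentation ζ φ u y := by
      rcases hdich φ with h | ⟨n, hn, hn0, -, h, -⟩
      · exact h.2
      · exfalso
        rw [hδ] at h
        lift IsDiscreteValuationRing.addVal R (p : R) to ℕ using hvp with d
        have h1 : d = d + n * (p - 1) := by exact_mod_cast h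
        have h2 : 0 < n * (p - 1) := Nat.mul_pos hn0 (Nat.sub_pos_of_lt hp.out.one_lt)
        omega
    have hun := fun {u y} h => hΦ.multiplicative_unique (ζ := ζ) (u := u) (y := y) (φ := φ)
      hπ hrank hinj hfix h
    have hu0 : BoundarySeries.residue (u : BoundarySeries R) ≠ 0 :=
      BoundarySeries.isUnit_iff_residue_ne_zero.mp u.isUnit
    have hnp := hΦ.residue_ne_pow_of_multiplicative hπ hrank huy
    -- The witness for h is the order of the reduction of u modulo p, since the residue of a
    -- logarithmic derivative is the order.
    refine ⟨huy.exists_isTorsor hζ.pow_eq_one, ⟨u, y, huy⟩, fun u y h u' => hun h u',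
      LaurentSeries.derivative (IsLocalRing.ResidueField R)
        (BoundarySeries.residue (u : BoundarySeries R)) /
          BoundarySeries.residue (u : BoundarySeries R), fun u' y' h' => ?_, ?_,
      ((BoundarySeries.residue (u : BoundarySeries R)).order : ZMod p), ?_, fun hne => ⟨?_, ?_⟩,
      fun h0 => ?_⟩
    · obtain ⟨v, rfl⟩ := (hun huy u').mp ⟨y', h'⟩
      rw [Units.val_mul, Units.val_pow_eq_pow_val, map_mul, map_pow,
        LaurentSeries.derivative_mul_pow_div p _
          (BoundarySeries.isUnit_iff_residue_ne_zero.mp v.isUnit)]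
    · refine div_ne_zero (fun h => ?_) hu0
      obtain ⟨g, hg⟩ := (LaurentSeries.derivative_eq_zero_iff p _).mp h
      exact hnp g hg
    · rw [LaurentSeries.coeff_derivative_div hu0, ZMod.natCast_val_intCast_eq]
    · intro u' y' h'
      have ho : (((BoundarySeries.residue (u' : BoundarySeries R)).order : ℤ) : ZMod p) =
          ((BoundarySeries.residue (u : BoundarySeries R)).order : ZMod p) := by
        obtain ⟨v, rfl⟩ := (hun huy u').mp ⟨y', h'⟩
        rw [Units.val_mul, Units.val_pow_eq_pow_val, map_mul, map_pow,
          LaurentSeries.order_mul_pow hu0 (BoundarySeries.isUnit_iff_residue_ne_zero.mp v.isUnit)]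
        simp
      exact ⟨ho, hΦ.exists_parameter_zpow hπ hrank hπB.ne_zero hζ.pow_eq_one h' ho hne⟩
    · intro N hN
      exact hΦ.exists_parameter_zpow_of_eq hπ hrank hπB.ne_zero hζ.pow_eq_one huy rfl hne hN
    · exact hΦ.exists_parameter_one_add hπ hrank hπB.ne_zero hζ.pow_eq_one huy
        ((ZMod.intCast_zmod_eq_zero_iff_dvd _ p).mp h0) rfl
  · intro hδ0 hδ
    have hdich' : ∀ φ : G ≃* Multiplicative (ZMod p),
        ∃ (n : ℕ) (hn : π ^ (n * (p - 1)) ∣ (p : R)), 0 < n ∧ π ^ n ∣ ζ - 1 ∧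
        IsDiscreteValuationRing.addVal R (p : R) =
          differentVal (BoundarySeries R) (algebraMap R B π) + (n * (p - 1) : ℕ) ∧
        ∃ (u : BoundarySeries R) (w : B), IsAdditivePresentation hp.out hn ζ φ u w :=
      fun φ => (hdich φ).resolve_left fun h => hδ.ne h.1
    -- n must not depend on φ; it is first obtained from an arbitrary isomorphism.
    obtain ⟨n, hn, hn0, hζn, hv, -⟩ :=
      hdich' (mulEquivOfPrimeCardEq (p := p) hG (Nat.card_zmod p))
    -- This is where δ > 0 enters: n(p - 1) < v(p), so P_n reduces to X ^ p.
    have h' : π ^ (n * (p - 1) + 1) ∣ (p : R) := by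
      rw [← IsDiscreteValuationRing.addVal_le_iff_dvd, AddValuation.map_pow,
        IsDiscreteValuationRing.addVal_uniformizer hπ, hv, add_comm (differentVal _ _)]
      simp only [nsmul_eq_mul, mul_one, Nat.cast_add, Nat.cast_one]
      gcongr
      exact Order.one_le_iff_pos.mpr hδ0
    refine ⟨n, hn, hn0, hv, fun u w hpr => ?_, fun φ => ?_⟩
    · have hw : Polynomial.aeval w (isogenyPoly hp.out hn) = algebraMap _ B u := by
        have := hpr.aeval_eq_zero
        rwa [aeval_isogenyPoly_map_sub, sub_eq_zero] at this
      refine existsUnique_character hζ hinjR hG (hΦ.isUnit_mul_add_one hπ hn0 w).ne_zero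
        (u := 1 + algebraMap R _ (π ^ (p * n)) * u) ?_ fun σ hσ => hpr.eq_one ?_
      · have := isogenyPoly_aeval hp.out hn w
        rw [hw] at this
        rw [map_add, map_one, map_mul, ← IsScalarTower.algebraMap_apply, this]
        ring
      · rw [map_add, map_one, map_mul, algEquiv_algebraMap, add_left_inj] at hσ
        refine mul_left_cancel₀ ?_ hσ
        rw [map_pow]
        exact pow_ne_zero _ hπB.ne_zero
    · obtain ⟨u, w, huw⟩ : ∃ (u : BoundarySeries R) (w : B),
          IsAdditivePresentation hp.out hn ζ φ u w := by
        obtain ⟨n', hn', -, -, hv', h⟩ := hdich' φ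
        -- The relation v(p) = δ + n(p - 1), with δ finite, determines n.
        obtain rfl : n' = n := by
          rw [hv] at hv' hvp
          lift differentVal (BoundarySeries R) (algebraMap R B π) to ℕ using
            (fun h => hvp (by rw [h, top_add])) with d
          have h1 : d + n * (p - 1) = d + n' * (p - 1) := by exact_mod_cast hv'
          exact (Nat.eq_of_mul_eq_mul_right (Nat.sub_pos_of_lt hp.out.one_lt)
            (Nat.add_left_cancel h1)).symm
        exact h
      refine ⟨huw.exists_isTorsor hπ.ne_zero hn hζn hζ.pow_eq_one (hΦ.isUnit_mul_add_one hπ hn0 w),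
        ⟨u, w, huw⟩, fun u w h => ⟨?_, fun f => ⟨?_, ?_⟩⟩,
        hΦ.exists_parameter_additive hπ hrank hπB hζ.pow_eq_one hfix hn0 hn h' hζn huw⟩
      · have := hΦ.residue_ne_pow_of_additive hπ hrank hπB.ne_zero hn h' h
        by_contra! hall
        obtain ⟨g, hg⟩ := (LaurentSeries.exists_eq_pow_iff p _).mpr hall
        exact this g hg
      · rintro ⟨u', w', hw', rfl⟩
        exact hΦ.additive_unique hπ hrank hπB hfix hn0 hn h' h hw'
      · rintro ⟨c, rfl⟩
        exact hΦ.additive_add_pow hπ hrank hπB.ne_zero hζ.pow_eq_one hfix hn0 hn h' h c
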